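/- Let $W\subset\mathbb R$ be open, let $\omega:W\to\mathbb R$ and $F,G:\mathbb R\times W\times\mathbb R\to\mathbb R$ be real analytic, with $F(\alpha,A,t)$, $G(\alpha,A,t)$ of period $2\pi$ in $\alpha$ and in $t$, and consider for real $\varepsilon$ the system $$\dot\alpha=\omega(A)+\varepsilon F(\alpha,A,t),\qquad \dot A=\varepsilon G(\alpha,A,t)\qquad\text{on }\mathbb T\times W. \tag{1}$$ Let $A_0\in W$ with $\omega(A_0)=p/q$, where $p\neq 0$, $q\ge 1$ are coprime integers, and $\omega'(A_0)\ne0$. Put $T=2\pi q$, $\alpha_0(t)=pt/q$, and write $\langle\cdot\rangle$ for the average over a period $T$. *Melnikov functions.* For $t_0,\beta_0\in\mathbb R$ there is a unique formal power series in $\varepsilon$, $\beta(t)=\beta_0+\sum_{k\ge1}\varepsilon^k\beta^{(k)}(t)$, $B(t)=\sum_{k\ge1}\varepsilon^kB^{(k)}(t)$, with $T$-periodic coefficients and $\langle\beta^{(k)}\rangle=0$, solving $$\dot\beta=\omega(A_0+B)-\omega(A_0)+\varepsilon F(\alpha_0+\beta,A_0+B,t+t_0),\qquad \dot B=\Gamma-\langle\Gamma\rangle,\qquad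 \Gamma=\varepsilon G(\alpha_0+\beta,A_0+B,t+t_0).$$ Let $\Gamma_0^{(k)}(t_0,\beta_0)$ be the coefficient of $\varepsilon^k$ in $\langle\Gamma\rangle$ and $M_k(t_0)=\Gamma_0^{(k+1)}(t_0,0)$; in particular $M_0(t_0)=\frac1T\int_0^TG(\alpha_0(t),A_0,t+t_0)\,dt$. Assume that for some $\kappa\ge0$ the functions $M_0,\dots,M_{\kappa-1}$ vanish identically and that $t_0\in[0,2\pi)$ is a zero of $M_\kappa$ of finite order $\mathfrak n\ge1$. Fix this $t_0$ and let $$\mathcal F(\varepsilon,\beta_0)=\sum_{k,j\ge0}\mathcal F_{k,j}\varepsilon^k\beta_0^j,\qquad \mathcal F_{k,j}=\frac1{j!}\,\partial_{\beta_0}^j\Gamma_0^{(k+\kappa+1)}(t_0,0),$$ so that $\langle\Gamma\rangle=\varepsilon^{\kappa+1}\mathcal F$. *Newton–Puiseux process.* Fix a sign $\sigma\in\{1,-1\}$ and put $\mathcal F^{(0)}=\mathcal F$, $\sigma_0=\sigma$, and $\sigma_i=1$ for $i\ge1$. The $i$-th step consists of the choice of a segment of the Newton polygon of $\mathcal F^{(i)}=\sum\mathcal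 F^{(i)}_{k,j}\varepsilon_i^ky_i^j$, that is, of integers $\mathfrak p_i,\mathfrak h_i\ge1$, coprime, and $\mathfrak s_i$ such that all $(k,j)$ with $\mathcal F^{(i)}_{k,j}\ne0$ satisfy $\mathfrak p_ik+\mathfrak h_ij\ge\mathfrak s_i$, with equality for at least two of them, and of a real root $c_i$ of the polynomial $$P^{(i)}(c)=\sum_{\mathfrak p_ik+\mathfrak h_ij=\mathfrak s_i}\mathcal F^{(i)}_{k,j}\sigma_i^kc^j;$$ then $\mathcal F^{(i+1)}$ is given by $\mathcal F^{(i)}(\sigma_i\eta^{\mathfrak p_i},\eta^{\mathfrak h_i}(c_i+y))=\eta^{\mathfrak s_i}\mathcal F^{(i+1)}(\eta,y)$. Assume that for some $i_0\ge0$ steps $0,\dots,i_0$ can be chosen such that $c_{i_0}$ is a simple root of $P^{(i_0)}$. **Theorem.** There is an explicitly computable $\bar\varepsilon>0$ such that for every $\varepsilon$ with $|\varepsilon|<\bar\varepsilon$ and $\sigma\varepsilon\ge0$ the system (1) has at least one subharmonic solution, with $\alpha(t+2\pi q)=\alpha(t)+2\pi p$ and $A(t+2\pi q)=A(t)$, which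 is given by convergent power series in $|\varepsilon|^{1/\mathfrak n!}$, $$\alpha(t)=\alpha_0(t-t_0)+\sum_{k\ge1}b_k(t)\,|\varepsilon|^{k/\mathfrak n!},\qquad A(t)=A_0+\sum_{k\ge1}B_k(t)\,|\varepsilon|^{k/\mathfrak n!}$$ with continuous $T$-periodic coefficients $b_k,B_k$ that do not depend on $\varepsilon$, satisfying $\sup_{k,t}|b_k(t)|\,\bar\varepsilon^{k/\mathfrak n!}<\infty$ and $\sup_{k,t}|B_k(t)|\,\bar\varepsilon^{k/\mathfrak n!}<\infty$. (If the assumption on the Newton–Puiseux process holds for both signs, this covers all $|\varepsilon|<\bar\varepsilon$.) Here *explicitly computable* means the following. There is a computable function $e:\mathbb N\to\mathbb N$, the same for all systems, such that one can take $\bar\varepsilon=1/(e(N)+1)$ for every $N\in\mathbb N$ that bounds the data, and every system and process as above has such a bound $N$. That $N$ bounds the data means: $q,|p|,\kappa,\mathfrak n,i_0\le N$; $(A_0-\frac1N,A_0+\frac1N)\subset W$; $|\omega^{(m)}(A_0)|\le N^{m+1}m!$ and $\|D^mF(\alpha,A_0,t)\|,\|D^mG(\alpha,A_0,t)\|\le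 N^{m+1}m!$ for all $m\ge0$ and all $\alpha,t$; $|\omega'(A_0)|\ge1/N$; $\mathfrak p_i,\mathfrak h_i,\mathfrak s_i,|c_i|\le N$ for $i\le i_0$; and $|(P^{(i_0)})'(c_{i_0})|\ge1/N$. -/

import Mathlib

noncomputable section

/-- A system `α' = ω(A) + ε F(α,A,t)`, `A' = ε G(α,A,t)` on `𝕋 × W`, with `W ⊆ ℝ` open, all functions
real analytic, and `F`, `G` of period `2π` in `α` and in `t`.  The arguments of `F` and `G` are
ordered as `(α, A, t)`. -/
structure PerturbedSystem where
  W : Set ℝ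
  ω : ℝ → ℝ
  F : ℝ × ℝ × ℝ → ℝ
  G : ℝ × ℝ × ℝ → ℝ
  isOpen_W : IsOpen W
  analytic_ω : AnalyticOnNhd ℝ ω W
  analytic_F : AnalyticOnNhd ℝ F {x | x.2.1 ∈ W}
  analytic_G : AnalyticOnNhd ℝ G {x | x.2.1 ∈ W}
  periodic_F : ∀ α t : ℝ, ∀ A ∈ W,
    F (α + 2 * Real.pi, A, t) = F (α, A, t) ∧ F (α, A, t + 2 * Real.pi) = F (α, A, t)
  periodic_G : ∀ α t : ℝ, ∀ A ∈ W,
    G (α + 2 * Real.pi, A, t) = G (α, A, t) ∧ G (α, A, t + 2 * Real.pi) = G (α, A, t)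

/-- `(α, A)` is a subharmonic solution at the parameter value `ε`: it solves the system for all
times and closes up on `𝕋 × W` after time `2πq`, with `α` (lifted to `ℝ`) increasing by `2πp`. -/
def PerturbedSystem.IsSubharmonicSolution (S : PerturbedSystem) (p : ℤ) (q : ℕ) (ε : ℝ)
    (α A : ℝ → ℝ) : Prop :=
  (∀ t, A t ∈ S.W) ∧
  (∀ t, HasDerivAt α (S.ω (A t) + ε * S.F (α t, A t, t)) t) ∧
  (∀ t, HasDerivAt A (ε * S.G (α t, A t, t)) t) ∧
  (∀ t, α (t + 2 * Real.pi * q) = α t + 2 * Real.pi * p) ∧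
  (∀ t, A (t + 2 * Real.pi * q) = A t)

/-- Average over the period `T`. -/
def average (T : ℝ) (g : ℝ → ℝ) : ℝ := T⁻¹ * ∫ t in (0 : ℝ)..T, g t

/-- The zero-average primitive of `g - ⟨g⟩`: on `T`-periodic functions it divides the Fourier
coefficient of index `ν ≠ 0` by `2πiν/T`, and sets the coefficient of index `0` to zero. -/
def zeroMeanPrimitive (T : ℝ) (g : ℝ → ℝ) (t : ℝ) : ℝ :=
  (∫ s in (0 : ℝ)..t, (g s - average T g)) -
    average T (fun u => ∫ s in (0 : ℝ)..u, (g s - average T g))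

/-- The Taylor coefficient of order `k` at `0`. -/
def taylorCoeff (k : ℕ) (f : ℝ → ℝ) : ℝ := iteratedDeriv k f 0 / (k.factorial : ℝ)

/-- A torus `A = A₀` with the integers `p`, `q` of its frequency `p/q`, and an initial phase `t₀`. -/
structure ResonantOrbit where
  A₀ : ℝ
  p : ℤ
  q : ℕ
  t₀ : ℝ

namespace ResonantOrbit

/-- The period `T = 2πq` in the extended phase space. -/
def T (o : ResonantOrbit) : ℝ := 2 * Real.pi * o.q

/-- The unperturbed angle `α₀(t) = (p/q) t`. -/
def α₀ (o : ResonantOrbit) (t : ℝ) : ℝ := (o.p : ℝ) / (o.q : ℝ) * t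

/-- The same torus with the initial phase `t₀`. -/
def withPhase (o : ResonantOrbit) (t₀ : ℝ) : ResonantOrbit := { o with t₀ := t₀ }

end ResonantOrbit

namespace PerturbedSystem

variable (S : PerturbedSystem) (o : ResonantOrbit)

/-- `Γ(t) = ε G(α₀(t) + β(t), A₀ + B(t), t + t₀)` for `ε`-dependent corrections
`x.1 ε t = β(t)`, `x.2 ε t = B(t)`. -/
def gammaFun (x : (ℝ → ℝ → ℝ) × (ℝ → ℝ → ℝ)) (t ε : ℝ) : ℝ :=
  ε * S.G (o.α₀ t + x.1 ε t, o.A₀ + x.2 ε t, t + o.t₀)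

/-- `Φ(t) = ε F(α₀(t) + β(t), A₀ + B(t), t + t₀) + ω(A₀ + B(t)) - ω(A₀) - ω'(A₀) B(t)`. -/
def phiFun (x : (ℝ → ℝ → ℝ) × (ℝ → ℝ → ℝ)) (t ε : ℝ) : ℝ :=
  ε * S.F (o.α₀ t + x.1 ε t, o.A₀ + x.2 ε t, t + o.t₀)
    + S.ω (o.A₀ + x.2 ε t) - S.ω o.A₀ - deriv S.ω o.A₀ * x.2 ε t

/-- The truncation at order `k` in `ε` of the formal solution `(β, B)` of the auxiliary system,
whose angular part has the prescribed average `β₀`.  At order `k + 1`, with `Γ` and `Φ` the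
coefficients of `ε ^ (k + 1)`, in Fourier space:
`β_ν = Φ_ν / (iων) + ω'(A₀) Γ_ν / (iων)²` and `B_ν = Γ_ν / (iων)` for `ν ≠ 0` (here `ω = 1/q`), and
`B_0 = - Φ_0 / ω'(A₀)`. -/
def formalSolution (β₀ : ℝ) : ℕ → (ℝ → ℝ → ℝ) × (ℝ → ℝ → ℝ)
  | 0 => (fun _ _ => β₀, fun _ _ => 0)
  | k + 1 =>
    let x := formalSolution β₀ k
    let Γ : ℝ → ℝ := fun t => taylorCoeff (k + 1) (S.gammaFun o x t)
    let Φ : ℝ → ℝ := fun t => taylorCoeff (k + 1) (S.phiFun o x t)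
    let β : ℝ → ℝ := fun t => zeroMeanPrimitive o.T Φ t
      + deriv S.ω o.A₀ * zeroMeanPrimitive o.T (zeroMeanPrimitive o.T Γ) t
    let B : ℝ → ℝ := fun t => zeroMeanPrimitive o.T Γ t - average o.T Φ / deriv S.ω o.A₀
    (fun ε t => x.1 ε t + ε ^ (k + 1) * β t, fun ε t => x.2 ε t + ε ^ (k + 1) * B t)

/-- The average over a period of the coefficient of `ε ^ (k + 1)` of `Γ`, along the formal solution
with average angle `β₀`. -/
def gammaMean (k : ℕ) (β₀ : ℝ) : ℝ :=
  average o.T (fun t => taylorCoeff (k + 1) (S.gammaFun o (S.formalSolution o β₀ k) t))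

/-- The subharmonic Melnikov functions `M_k` as functions of the initial phase; `M_0` is the average
of `G(α₀(t), A₀, t + t₀)`. -/
def melnikov (k : ℕ) (t₀ : ℝ) : ℝ := S.gammaMean (o.withPhase t₀) k 0

/-- The Taylor coefficients of the function `𝓕` of `(ε, β₀)` with `⟨Γ⟩ = ε ^ (κ + 1) 𝓕(ε, β₀)`: the
coefficient of `ε ^ k β₀ ^ j` (when `M_0, …, M_{κ - 1}` vanish identically). -/
def bifurcationSeries (κ k j : ℕ) : ℝ := taylorCoeff j (S.gammaMean o (k + κ))

end PerturbedSystem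

/-! ### The Newton-Puiseux process.  A series `∑ a_{k,j} ε^k y^j` is given by its coefficients. -/

/-- The choices made in one step: a segment on the line `𝔭 k + 𝔥 j = 𝔰`, and a root `c`. -/
structure PuiseuxStep where
  𝔭 : ℕ
  𝔥 : ℕ
  𝔰 : ℕ
  c : ℝ

/-- The line `𝔭 k + 𝔥 j = 𝔰` carries a segment of the Newton polygon of the series `a`: all points of
the carrier lie on it or above it, and at least two points of the carrier lie on it. -/
def IsNewtonSegment (a : ℕ → ℕ → ℝ) (s : PuiseuxStep) : Prop :=
  0 < s.𝔭 ∧ 0 < s.𝔥 ∧ Nat.Coprime s.𝔭 s.𝔥 ∧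
  (∀ k j, a k j ≠ 0 → s.𝔰 ≤ s.𝔭 * k + s.𝔥 * j) ∧
  ∃ v w : ℕ × ℕ, v ≠ w ∧ a v.1 v.2 ≠ 0 ∧ a w.1 w.2 ≠ 0 ∧
    s.𝔭 * v.1 + s.𝔥 * v.2 = s.𝔰 ∧ s.𝔭 * w.1 + s.𝔥 * w.2 = s.𝔰

/-- The coefficient of `η ^ m` in `∑ a_{k,j} (σ η ^ 𝔭) ^ k (c η ^ 𝔥) ^ j`, a polynomial in `c`
(for `𝔭, 𝔥 ≥ 1`). -/
def weightedPart (σ : ℝ) (a : ℕ → ℕ → ℝ) (𝔭 𝔥 m : ℕ) : Polynomial ℝ :=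
  ∑ v ∈ (Finset.range (m + 1) ×ˢ Finset.range (m + 1)).filter
      (fun v : ℕ × ℕ => 𝔭 * v.1 + 𝔥 * v.2 = m),
    Polynomial.C (a v.1 v.2 * σ ^ v.1) * Polynomial.X ^ v.2

/-- The polynomial attached to a segment of the Newton polygon. -/
def segmentPolynomial (σ : ℝ) (a : ℕ → ℕ → ℝ) (s : PuiseuxStep) : Polynomial ℝ :=
  weightedPart σ a s.𝔭 s.𝔥 s.𝔰

/-- The series `a'` with `a(σ η ^ 𝔭, η ^ 𝔥 (c + y)) = η ^ 𝔰 a'(η, y)`. -/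
def nextSeries (σ : ℝ) (a : ℕ → ℕ → ℝ) (s : PuiseuxStep) (k j : ℕ) : ℝ :=
  (Polynomial.taylor s.c (weightedPart σ a s.𝔭 s.𝔥 (s.𝔰 + k))).coeff j

/-- The sign used at the `i`-th step: the sign `σ` of `ε` at the first step, and `+1` afterwards, when
the variable is a power of `|ε|`. -/
def stepSign (σ : ℝ) (i : ℕ) : ℝ := if i = 0 then σ else 1

/-- The series reached after `i` steps, for given choices in the steps. -/
def puiseuxSeries (σ : ℝ) (a : ℕ → ℕ → ℝ) (s : ℕ → PuiseuxStep) : ℕ → ℕ → ℕ → ℝ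
  | 0 => a
  | i + 1 => nextSeries (stepSign σ i) (puiseuxSeries σ a s i) (s i)

/-- The polynomial chosen in the `i`-th step. -/
def puiseuxPolynomial (σ : ℝ) (a : ℕ → ℕ → ℝ) (s : ℕ → PuiseuxStep) (i : ℕ) : Polynomial ℝ :=
  segmentPolynomial (stepSign σ i) (puiseuxSeries σ a s i) (s i)

/-- With the choices `s`, the process runs through the steps `0, …, i₀`, following a real root in each
of them, and the root in the step `i₀` is simple. -/
def ReachesSimpleRoot (σ : ℝ) (a : ℕ → ℕ → ℝ) (s : ℕ → PuiseuxStep) (i₀ : ℕ) : Prop :=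
  (∀ i ≤ i₀, IsNewtonSegment (puiseuxSeries σ a s i) (s i) ∧
    (puiseuxPolynomial σ a s i).IsRoot (s i).c) ∧
  (puiseuxPolynomial σ a s i₀).rootMultiplicity (s i₀).c = 1

/-- `N` bounds the data: the integers, the distance of `A₀` to the complement of `W`, the size and the
domain of analyticity of `ω`, `F`, `G` at the torus `A = A₀` (through Cauchy estimates), the inverse of
`ω'(A₀)`, the choices made in the process and the inverse of the derivative at the simple root. -/
structure DataBound (S : PerturbedSystem) (o : ResonantOrbit) (κ n : ℕ) (σ : ℝ)
    (s : ℕ → PuiseuxStep) (i₀ : ℕ) (N : ℕ) : Prop where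
  q_le : o.q ≤ N
  p_le : o.p.natAbs ≤ N
  κ_le : κ ≤ N
  n_le : n ≤ N
  i₀_le : i₀ ≤ N
  ball_subset : Metric.ball o.A₀ (1 / (N : ℝ)) ⊆ S.W
  ω_le : ∀ m : ℕ, |iteratedDeriv m S.ω o.A₀| ≤ (N : ℝ) ^ (m + 1) * (m.factorial : ℝ)
  F_le : ∀ (m : ℕ) (α t : ℝ),
    ‖iteratedFDeriv ℝ m S.F (α, o.A₀, t)‖ ≤ (N : ℝ) ^ (m + 1) * (m.factorial : ℝ)
  G_le : ∀ (m : ℕ) (α t : ℝ),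
    ‖iteratedFDeriv ℝ m S.G (α, o.A₀, t)‖ ≤ (N : ℝ) ^ (m + 1) * (m.factorial : ℝ)
  twist_le : 1 ≤ (N : ℝ) * |deriv S.ω o.A₀|
  step_le : ∀ i ≤ i₀, (s i).𝔭 ≤ N ∧ (s i).𝔥 ≤ N ∧ (s i).𝔰 ≤ N ∧ |(s i).c| ≤ (N : ℝ)
  root_le : 1 ≤ (N : ℝ) *
    |(puiseuxPolynomial σ (S.bifurcationSeries o κ) s i₀).derivative.eval (s i₀).c|

end

set_option linter.unusedSectionVars false

/-! Write the correction to the resonant orbit as `β`, `B`, and drop for the moment the condition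
that the mean of `Γ` vanishes. The remaining auxiliary system, in integral form, expresses `β`
through a prescribed average angle and zero-mean primitives, and fixes the mean of `B` by dividing
by `ω'(A₀) ≠ 0`. After rescaling all unknowns it is a contraction. A true solution appears exactly
where the leftover mean of `Γ` is zero, so the theorem reduces to finding a real branch of zeros of
`𝓕(ε, β₀)`.

The contraction uses only a Banach algebra and a norm-nonincreasing homomorphism into it from the
continuous periodic functions (`AuxData.Small.exists_isSol`). It is applied in the algebra of double
power series in the parameter and the average angle, with absolutely summable coefficients.
Homomorphisms compatible with primitives and averages carry solutions to solutions
(`AuxData.IsSol.map`), so this one universal solution specializes to real parameters, where it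
solves the differential equations (`AuxData.Represents.hasDerivAt`), and to series in `ε` at fixed
`β₀`. Series solutions of the latter kind have the formal solution as their Taylor expansion
(`AuxData.Represents.formalSolution_eq`). Hence `𝓕` is a convergent series with explicit geometric
bounds on its coefficients.

Changing the average angle is the same as translating time, that is, changing the initial phase
(`LocalBound.gammaMean_eq_melnikov`). Since `p ≠ 0`, every angle is reached, so identical vanishing
of `M_0, …, M_{κ-1}` removes the factor `ε ^ (κ + 1)` for all angles, and `𝓕(0, β₀)`, being `M_κ`
after an affine change of variable, vanishes exactly to order `n`.

Each step of the Newton-Puiseux process preserves geometric bounds, with a controlled loss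
(`GeomBound.nextSeries`). At a simple root the transformed series has a nonzero linear coefficient
in `y` and no constant term, so the implicit function theorem gives a convergent branch
(`exists_implicit_series`), which is substituted back through the steps. The exponent `n!` suffices
because the order `n'` after a step satisfies `𝔭 n'! ∣ n!`
(`IsNewtonSegment.exists_hasOrder_nextSeries`): a nonzero root of multiplicity `n'` of a polynomial
whose exponents lie in a progression of step `𝔭` forces degree at least `𝔭 n'`, while a zero root
leaves `n' + 𝔭 ≤ n`. Thus all ramification indices together divide `n!`.

All radii are explicit in the bound `N`: an iterate of a polynomial-exponential function, hence
computable. That some `N` exists follows from Cauchy estimates, uniform on the compact torus. -/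

noncomputable section

/-! ### Absolutely convergent power series over a Banach algebra -/

/-- Power series over `E` whose coefficients are absolutely summable. -/
def absSeriesSubalgebra (E : Type*) [NormedCommRing E] [NormedAlgebra ℝ E] [CompleteSpace E] :
    Subalgebra ℝ (PowerSeries E) where
  carrier := {f | Summable fun n => ‖PowerSeries.coeff n f‖}
  mul_mem' := by
    intro f g hf hg
    have := summable_norm_sum_mul_antidiagonal_of_summable_norm hf hg
    simpa only [Set.mem_ofPred_eq, PowerSeries.coeff_mul] using this
  add_mem' := by
    intro f g hf hg
    refine Summable.of_nonneg_of_le (fun n => norm_nonneg _) (fun n => ?_) (hf.add hg)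
    simpa using norm_add_le _ _
  algebraMap_mem' := by
    intro r
    refine summable_of_ne_finset_zero (s := {0}) fun n hn => ?_
    have hn : n ≠ 0 := by simpa using hn
    rw [PowerSeries.algebraMap_apply, PowerSeries.coeff_C, if_neg hn, norm_zero]

/-- The Banach algebra of power series with absolutely summable coefficients. -/
def AbsSeries (E : Type*) [NormedCommRing E] [NormedAlgebra ℝ E] [CompleteSpace E] : Type _ :=
  absSeriesSubalgebra E

namespace AbsSeries

variable {E : Type*} [NormedCommRing E] [NormedAlgebra ℝ E] [CompleteSpace E]

instance : CommRing (AbsSeries E) := inferInstanceAs (CommRing (absSeriesSubalgebra E))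
instance : Algebra ℝ (AbsSeries E) := inferInstanceAs (Algebra ℝ (absSeriesSubalgebra E))

/-- The coefficient of order `n`. -/
def coeff (n : ℕ) (a : AbsSeries E) : E := PowerSeries.coeff n a.1

theorem summable_norm_coeff (a : AbsSeries E) : Summable fun n => ‖a.coeff n‖ := a.2

theorem ext {a b : AbsSeries E} (h : ∀ n, a.coeff n = b.coeff n) : a = b :=
  Subtype.ext (PowerSeries.ext h)

/-- The series with given coefficients. -/
def mk (f : ℕ → E) (hf : Summable fun n => ‖f n‖) : AbsSeries E :=
  ⟨PowerSeries.mk f, by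
    change Summable _
    simpa using hf⟩

@[simp] theorem coeff_mk (f : ℕ → E) (hf : Summable fun n => ‖f n‖) (n : ℕ) :
    (mk f hf).coeff n = f n := PowerSeries.coeff_mk n f

@[simp] theorem coeff_zero (n : ℕ) : (0 : AbsSeries E).coeff n = 0 :=
  map_zero (PowerSeries.coeff (R := E) n)

@[simp] theorem coeff_add (n : ℕ) (a b : AbsSeries E) :
    (a + b).coeff n = a.coeff n + b.coeff n := map_add (PowerSeries.coeff n) a.1 b.1

@[simp] theorem coeff_sub (n : ℕ) (a b : AbsSeries E) :
    (a - b).coeff n = a.coeff n - b.coeff n := map_sub (PowerSeries.coeff n) a.1 b.1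

@[simp] theorem coeff_smul (n : ℕ) (r : ℝ) (a : AbsSeries E) :
    (r • a).coeff n = r • a.coeff n := rfl

theorem coeff_mul (n : ℕ) (a b : AbsSeries E) :
    (a * b).coeff n = ∑ v ∈ Finset.HasAntidiagonal.antidiagonal n, a.coeff v.1 * b.coeff v.2 :=
  PowerSeries.coeff_mul n a.1 b.1

theorem coeff_one (n : ℕ) : (1 : AbsSeries E).coeff n = if n = 0 then 1 else 0 :=
  PowerSeries.coeff_one n

/-- The sequence of coefficients as an element of `ℓ¹`. -/
def toLp : AbsSeries E →+ lp (fun _ : ℕ => E) 1 where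
  toFun a := ⟨fun n => a.coeff n, memℓp_gen (by simpa using a.summable_norm_coeff)⟩
  map_zero' := by ext n; simp
  map_add' a b := by ext n; exact coeff_add n a b

theorem toLp_apply (a : AbsSeries E) (n : ℕ) : toLp a n = a.coeff n := rfl

theorem toLp_injective : Function.Injective (toLp : AbsSeries E → _) := fun a b h =>
  ext fun n => by rw [← toLp_apply, h, toLp_apply]

theorem toLp_surjective : Function.Surjective (toLp : AbsSeries E → _) := fun x =>
  ⟨mk x (by simpa using (lp.memℓp x).summable (by simp)), by ext n; simp [toLp_apply]⟩

instance : NormedAddCommGroup (AbsSeries E) :=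
  NormedAddCommGroup.induced (AbsSeries E) (lp (fun _ : ℕ => E) 1) toLp toLp_injective

theorem norm_def (a : AbsSeries E) : ‖a‖ = ∑' n, ‖a.coeff n‖ := by
  change ‖toLp a‖ = _
  rw [lp.norm_eq_tsum_rpow (by simp)]
  simp [toLp_apply]

theorem hasSum_norm (a : AbsSeries E) : HasSum (fun n => ‖a.coeff n‖) ‖a‖ := by
  rw [norm_def]; exact a.summable_norm_coeff.hasSum

theorem norm_coeff_le (a : AbsSeries E) (n : ℕ) : ‖a.coeff n‖ ≤ ‖a‖ :=
  le_hasSum a.hasSum_norm n fun _ _ => norm_nonneg _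

instance : CompleteSpace (AbsSeries E) := by
  have hi : Isometry (toLp : AbsSeries E → lp (fun _ : ℕ => E) 1) :=
    AddMonoidHomClass.isometry_of_norm _ fun _ => rfl
  exact (IsometryEquiv.mk (Equiv.ofBijective _ ⟨toLp_injective, toLp_surjective⟩) hi).completeSpace

theorem norm_mul_le' (a b : AbsSeries E) : ‖a * b‖ ≤ ‖a‖ * ‖b‖ := by
  have ha : Summable fun n => ‖‖a.coeff n‖‖ := by simpa using a.summable_norm_coeff
  have hb : Summable fun n => ‖‖b.coeff n‖‖ := by simpa using b.summable_norm_coeff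
  rw [norm_def, norm_def a, norm_def b,
    tsum_mul_tsum_eq_tsum_sum_antidiagonal_of_summable_norm (f := fun n => ‖a.coeff n‖)
      (g := fun n => ‖b.coeff n‖) ha hb]
  refine (a * b).summable_norm_coeff.tsum_le_tsum (fun n => ?_)
    (summable_norm_sum_mul_antidiagonal_of_summable_norm (f := fun n => ‖a.coeff n‖)
      (g := fun n => ‖b.coeff n‖) ha hb).of_norm
  rw [coeff_mul]
  exact (norm_sum_le _ _).trans (Finset.sum_le_sum fun v _ => norm_mul_le _ _)

instance : NormedCommRing (AbsSeries E) where
  dist_eq := NormedAddCommGroup.dist_eq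
  norm_mul_le := norm_mul_le'
  mul_comm := mul_comm

instance : NormedAlgebra ℝ (AbsSeries E) where
  norm_smul_le r a := by
    rw [norm_def, norm_def, ← tsum_mul_left]
    refine Summable.tsum_le_tsum (fun n => ?_) (r • a).summable_norm_coeff
      (a.summable_norm_coeff.mul_left _)
    rw [coeff_smul]; exact norm_smul_le _ _

theorem norm_mk_le {f : ℕ → E} {g : ℕ → ℝ} {C : ℝ} (hg : HasSum g C) (h : ∀ n, ‖f n‖ ≤ g n) :
    ‖mk f (hg.summable.of_nonneg_of_le (fun _ => norm_nonneg _) h)‖ ≤ C := by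
  refine hasSum_le (fun n => ?_) (hasSum_norm _) hg
  simpa using h n

instance [NormOneClass E] : NormOneClass (AbsSeries E) where
  norm_one := by
    rw [norm_def, tsum_eq_single 0]
    · simp [coeff_one]
    · intro n hn; simp [coeff_one, hn]

/-- Taking coefficients is a continuous linear map. -/
def coeffCLM (n : ℕ) : AbsSeries E →L[ℝ] E :=
  LinearMap.mkContinuous
    { toFun := coeff n, map_add' := coeff_add n, map_smul' := coeff_smul n } 1
    fun a => by simpa using a.norm_coeff_le n

@[simp] theorem coeffCLM_apply (n : ℕ) (a : AbsSeries E) : coeffCLM n a = a.coeff n := rfl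

/-- The series of a finitely supported sequence of coefficients: a monomial. -/
def monomial (n : ℕ) (x : E) : AbsSeries E :=
  mk (fun m => if m = n then x else 0)
    (summable_of_ne_finset_zero (s := {n}) fun m hm => by simp_all)

theorem coeff_monomial (n m : ℕ) (x : E) : (monomial n x).coeff m = if m = n then x else 0 :=
  coeff_mk _ _ _

theorem norm_monomial (n : ℕ) (x : E) : ‖monomial n x‖ = ‖x‖ := by
  rw [norm_def, tsum_eq_single n]
  · simp [coeff_monomial]
  · intro m hm; simp [coeff_monomial, hm]

theorem coeff_mul_monomial (n m : ℕ) (a : AbsSeries E) (x : E) :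
    (a * monomial n x).coeff m = if n ≤ m then a.coeff (m - n) * x else 0 := by
  rw [coeff_mul]
  split_ifs with h
  · rw [Finset.sum_eq_single (m - n, n)]
    · simp [coeff_monomial]
    · rintro ⟨i, j⟩ hij hne
      rw [Finset.HasAntidiagonal.mem_antidiagonal] at hij
      have : j ≠ n := fun hj => hne (by ext <;> simp <;> omega)
      simp [coeff_monomial, this]
    · intro hm; exact absurd (Finset.HasAntidiagonal.mem_antidiagonal.2 (by simp; omega)) hm
  · refine Finset.sum_eq_zero fun v hv => ?_
    rw [Finset.HasAntidiagonal.mem_antidiagonal] at hv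
    have : v.2 ≠ n := by omega
    simp [coeff_monomial, this]

end AbsSeries

/-! ### Norm-nonincreasing homomorphisms -/

/-- Norm-nonincreasing homomorphisms of commutative normed algebras. -/
structure ContrHom (A B : Type*) [NormedCommRing A] [NormedAlgebra ℝ A] [NormedCommRing B]
    [NormedAlgebra ℝ B] extends A →ₐ[ℝ] B where
  norm_le' : ∀ x, ‖toFun x‖ ≤ ‖x‖

namespace ContrHom

variable {A B C : Type*} [NormedCommRing A] [NormedAlgebra ℝ A] [NormedCommRing B]
  [NormedAlgebra ℝ B] [NormedCommRing C] [NormedAlgebra ℝ C]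

instance : FunLike (ContrHom A B) A B where
  coe φ := φ.toFun
  coe_injective φ ψ h := by
    cases φ; cases ψ; congr; exact DFunLike.coe_injective h

instance : AlgHomClass (ContrHom A B) ℝ A B where
  map_mul φ := φ.map_mul'
  map_one φ := φ.map_one'
  map_add φ := φ.map_add'
  map_zero φ := φ.map_zero'
  commutes φ := φ.commutes'

theorem norm_le (φ : ContrHom A B) (x : A) : ‖φ x‖ ≤ ‖x‖ := φ.norm_le' x

@[ext] theorem ext {φ ψ : ContrHom A B} (h : ∀ x, φ x = ψ x) : φ = ψ := DFunLike.ext _ _ h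

protected theorem continuous (φ : ContrHom A B) : Continuous φ :=
  AddMonoidHomClass.continuous_of_bound φ 1 fun x => by simpa using φ.norm_le x

protected theorem hasSum (φ : ContrHom A B) {ι : Type*} {f : ι → A} {a : A} (h : HasSum f a) :
    HasSum (fun i => φ (f i)) (φ a) := h.map φ φ.continuous

/-- The composition of norm-nonincreasing homomorphisms. -/
def comp (ψ : ContrHom B C) (φ : ContrHom A B) : ContrHom A C where
  toAlgHom := ψ.toAlgHom.comp φ.toAlgHom
  norm_le' x := (ψ.norm_le _).trans (φ.norm_le x)

@[simp] theorem comp_apply (ψ : ContrHom B C) (φ : ContrHom A B) (x : A) :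
    ψ.comp φ x = ψ (φ x) := rfl

/-- The identity. -/
protected def id (A : Type*) [NormedCommRing A] [NormedAlgebra ℝ A] : ContrHom A A where
  toAlgHom := AlgHom.id ℝ A
  norm_le' _ := le_rfl

@[simp] theorem id_apply (x : A) : ContrHom.id A x = x := rfl

/-- The structure map of a normed algebra in which `1` has norm `1`. -/
def ofReal (A : Type*) [NormedCommRing A] [NormedAlgebra ℝ A] [NormOneClass A] :
    ContrHom ℝ A where
  toAlgHom := Algebra.ofId ℝ A
  norm_le' x := (norm_algebraMap' A x).le

end ContrHom

/-! ### Evaluation -/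

namespace AbsSeries

variable {E : Type*} [NormedCommRing E] [NormedAlgebra ℝ E] [CompleteSpace E]
variable {B : Type*} [NormedCommRing B] [NormedAlgebra ℝ B] [CompleteSpace B] [NormOneClass B]
variable {B' : Type*} [NormedCommRing B'] [NormedAlgebra ℝ B'] [CompleteSpace B'] [NormOneClass B']

theorem norm_eval_term_le (φ : ContrHom E B) {x : B} (hx : ‖x‖ ≤ 1) (a : AbsSeries E) (n : ℕ) :
    ‖φ (a.coeff n) * x ^ n‖ ≤ ‖a.coeff n‖ :=
  (norm_mul_le _ _).trans <| (mul_le_mul (φ.norm_le _)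
    ((norm_pow_le x n).trans (pow_le_one₀ (norm_nonneg _) hx)) (norm_nonneg _)
    (norm_nonneg _)).trans (mul_one _).le

theorem summable_norm_eval_term (φ : ContrHom E B) {x : B} (hx : ‖x‖ ≤ 1) (a : AbsSeries E) :
    Summable fun n => ‖φ (a.coeff n) * x ^ n‖ :=
  a.summable_norm_coeff.of_nonneg_of_le (fun _ => norm_nonneg _) (norm_eval_term_le φ hx a)

/-- Evaluation at a point of the unit ball. -/
def evalOfLe (φ : ContrHom E B) (x : B) (hx : ‖x‖ ≤ 1) : ContrHom (AbsSeries E) B where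
  toFun a := ∑' n, φ (a.coeff n) * x ^ n
  map_one' := by
    rw [tsum_eq_single 0]
    · simp [coeff_one]
    · intro n hn; simp [coeff_one, hn]
  map_zero' := by simp
  map_add' a b := by
    rw [← (summable_norm_eval_term φ hx a).of_norm.tsum_add (summable_norm_eval_term φ hx b).of_norm]
    simp [add_mul]
  map_mul' a b := by
    rw [tsum_mul_tsum_eq_tsum_sum_antidiagonal_of_summable_norm (summable_norm_eval_term φ hx a)
      (summable_norm_eval_term φ hx b)]
    refine tsum_congr fun n => ?_
    rw [coeff_mul, map_sum, Finset.sum_mul]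
    refine Finset.sum_congr rfl fun v hv => ?_
    rw [← Finset.HasAntidiagonal.mem_antidiagonal.1 hv, map_mul, pow_add]; ring
  commutes' r := by
    have h : ∀ n, (algebraMap ℝ (AbsSeries E) r).coeff n = if n = 0 then algebraMap ℝ E r else 0 := by
      intro n
      rw [Algebra.algebraMap_eq_smul_one, coeff_smul, coeff_one]
      split_ifs <;> simp [Algebra.algebraMap_eq_smul_one]
    rw [tsum_eq_single 0]
    · simpa [h] using AlgHomClass.commutes φ r
    · intro n hn; simp [h, hn]
  norm_le' a := by
    refine (norm_tsum_le_tsum_norm (summable_norm_eval_term φ hx a)).trans ?_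
    rw [norm_def]
    exact (summable_norm_eval_term φ hx a).tsum_le_tsum (norm_eval_term_le φ hx a)
      a.summable_norm_coeff

open Classical in
/-- Evaluation at `x`, or at `0` if `x` is not in the unit ball. -/
def eval (φ : ContrHom E B) (x : B) : ContrHom (AbsSeries E) B :=
  if hx : ‖x‖ ≤ 1 then evalOfLe φ x hx else evalOfLe φ 0 (by simp)

theorem hasSum_eval (φ : ContrHom E B) {x : B} (hx : ‖x‖ ≤ 1) (a : AbsSeries E) :
    HasSum (fun n => φ (a.coeff n) * x ^ n) (eval φ x a) := by
  rw [eval, dif_pos hx]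
  exact (summable_norm_eval_term φ hx a).of_norm.hasSum

/-- Evaluation is a convergent sum of products, so it commutes with continuous homomorphisms. This
naturality is what moves solutions between algebras. -/
theorem map_eval (ψ : ContrHom B B') (φ : ContrHom E B) {x : B} (hx : ‖x‖ ≤ 1)
    (a : AbsSeries E) : ψ (eval φ x a) = eval (ψ.comp φ) (ψ x) a := by
  refine (ψ.hasSum (hasSum_eval φ hx a)).unique ?_
  simpa using hasSum_eval (ψ.comp φ) ((ψ.norm_le x).trans hx) a

theorem comp_eval (ψ : ContrHom B B') (φ : ContrHom E B) {x : B} (hx : ‖x‖ ≤ 1) :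
    ψ.comp (eval φ x) = eval (ψ.comp φ) (ψ x) := by
  ext a; exact map_eval ψ φ hx a

theorem eval_monomial (φ : ContrHom E B) {x : B} (hx : ‖x‖ ≤ 1) (n : ℕ) (y : E) :
    eval φ x (monomial n y) = φ y * x ^ n := by
  refine (hasSum_eval φ hx _).unique ?_
  have := hasSum_single (f := fun m => φ ((monomial n y).coeff m) * x ^ m) n
    fun m hm => by simp [coeff_monomial, hm]
  simpa [coeff_monomial] using this

/-- The constant series. -/
def const (E : Type*) [NormedCommRing E] [NormedAlgebra ℝ E] [CompleteSpace E] :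
    ContrHom E (AbsSeries E) where
  toFun := monomial 0
  map_one' := ext fun n => by rw [coeff_monomial, coeff_one]
  map_zero' := ext fun n => by simp [coeff_monomial]
  map_add' x y := ext fun n => by simp only [coeff_monomial, coeff_add]; split_ifs <;> simp
  map_mul' x y := ext fun n => by
    rw [coeff_mul_monomial, coeff_monomial, coeff_monomial]; simp; 
  commutes' r := ext fun n => by
    rw [Algebra.algebraMap_eq_smul_one (A := AbsSeries E), coeff_smul, coeff_one, coeff_monomial]
    split_ifs <;> simp [Algebra.algebraMap_eq_smul_one]
  norm_le' x := (norm_monomial 0 x).le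

theorem const_apply (x : E) : const E x = monomial 0 x := rfl

theorem eval_const (φ : ContrHom E B) {x : B} (hx : ‖x‖ ≤ 1) (y : E) :
    eval φ x (const E y) = φ y := by
  rw [const_apply, eval_monomial φ hx, pow_zero, mul_one]

theorem eval_comp_const (φ : ContrHom E B) {x : B} (hx : ‖x‖ ≤ 1) :
    (eval φ x).comp (const E) = φ := by
  ext y; exact eval_const φ hx y

/-- Evaluating at the formal variable of another series algebra amounts to applying a homomorphism
coefficient by coefficient. Presenting it as an evaluation makes it a `ContrHom` without further
proof. -/
theorem coeff_eval_monomial_one {D : Type*} [NormedCommRing D] [NormedAlgebra ℝ D] [CompleteSpace D]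
    [NormOneClass E] (φ : ContrHom D E) (a : AbsSeries D) (n : ℕ) :
    (eval ((const E).comp φ) (monomial 1 1) a).coeff n = φ (a.coeff n) := by
  have h1 : ‖(monomial 1 1 : AbsSeries E)‖ ≤ 1 := by rw [norm_monomial, norm_one]
  have hp : ∀ m, (monomial 1 1 : AbsSeries E) ^ m = monomial m 1 := by
    intro m
    induction m with
    | zero => exact ext fun k => by rw [pow_zero, coeff_monomial, coeff_one]
    | succ m ih =>
      refine ext fun k => ?_
      rw [pow_succ, ih, coeff_mul_monomial, coeff_monomial, coeff_monomial]
      by_cases hk : k = m + 1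
      · simp [hk]
      · have : ¬ (1 ≤ k ∧ k - 1 = m) := by omega
        by_cases h : 1 ≤ k <;> simp_all
  refine ((coeffCLM n).hasSum (hasSum_eval ((const E).comp φ) h1 a)).unique ?_
  have : ∀ m, coeffCLM n (((const E).comp φ) (a.coeff m) * monomial 1 1 ^ m) =
      if m = n then φ (a.coeff n) else 0 := by
    intro m
    rw [hp, coeffCLM_apply, coeff_mul_monomial, ContrHom.comp_apply, const_apply, coeff_monomial]
    by_cases h : m = n
    · simp [h]
    · have : ¬ (m ≤ n ∧ n - m = 0) := by omega
      by_cases h' : m ≤ n <;> simp_all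
  simp only [this]
  exact hasSum_ite_eq n _

/-! ### Lipschitz estimates on the ball of radius `1 / 2` -/

theorem norm_pow_sub_pow_le {x y : B} (hx : ‖x‖ ≤ 1 / 2) (hy : ‖y‖ ≤ 1 / 2) (n : ℕ) :
    ‖x ^ n - y ^ n‖ ≤ ‖x - y‖ := by
  -- The derivative of the power at radius `1 / 2` gives the constant `(n + 1) / 2 ^ n`, which is at
  -- most `1`; the induction needs the sharp form.
  have key : ∀ n : ℕ, ‖x ^ (n + 1) - y ^ (n + 1)‖ ≤ (n + 1) * (1 / 2) ^ n * ‖x - y‖ := by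
    intro n
    induction n with
    | zero => simp
    | succ n ih =>
      have : x ^ (n + 1 + 1) - y ^ (n + 1 + 1) =
          x ^ (n + 1) * (x - y) + (x ^ (n + 1) - y ^ (n + 1)) * y := by ring
      rw [this]
      have h1 : ‖x ^ (n + 1) * (x - y)‖ ≤ (1 / 2) ^ (n + 1) * ‖x - y‖ :=
        (norm_mul_le _ _).trans (mul_le_mul_of_nonneg_right
          ((norm_pow_le x _).trans (pow_le_pow_left₀ (norm_nonneg _) hx _)) (norm_nonneg _))
      have h2 : ‖(x ^ (n + 1) - y ^ (n + 1)) * y‖ ≤ ((n + 1) * (1 / 2) ^ n * ‖x - y‖) * (1 / 2) :=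
        (norm_mul_le _ _).trans (mul_le_mul ih hy (norm_nonneg _) (by positivity))
      refine (norm_add_le _ _).trans ((add_le_add h1 h2).trans (le_of_eq ?_))
      push_cast; ring
  rcases n with _ | n
  · simp
  · refine (key n).trans (mul_le_of_le_one_left (norm_nonneg _) ?_)
    have : ((n : ℝ) + 1) ≤ 2 ^ n := by exact_mod_cast Nat.lt_two_pow_self (n := n)
    rw [one_div, inv_pow, ← div_eq_mul_inv]
    exact (div_le_one (by positivity)).2 this

theorem norm_eval_sub_le (φ : ContrHom E B) {x y : B} (hx : ‖x‖ ≤ 1 / 2) (hy : ‖y‖ ≤ 1 / 2)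
    (a : AbsSeries E) : ‖eval φ x a - eval φ y a‖ ≤ ‖a‖ * ‖x - y‖ := by
  have h := (hasSum_eval φ (hx.trans (by norm_num)) a).sub
    (hasSum_eval φ (hy.trans (by norm_num)) a)
  refine h.norm_le_of_bounded (a.hasSum_norm.mul_right _) fun n => ?_
  rw [← mul_sub]
  exact (norm_mul_le _ _).trans (mul_le_mul (φ.norm_le _) (norm_pow_sub_pow_le hx hy n)
    (norm_nonneg _) (norm_nonneg _))

/-- In a double series the inner variable enters through the homomorphism applied to the
coefficients, so dependence on it is dependence on that homomorphism. -/
theorem norm_eval_sub_le_of_hom {φ ψ : ContrHom E B} {C : ℝ} (hC : ∀ e, ‖φ e - ψ e‖ ≤ C * ‖e‖)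
    {x : B} (hx : ‖x‖ ≤ 1) (a : AbsSeries E) : ‖eval φ x a - eval ψ x a‖ ≤ C * ‖a‖ := by
  have h := (hasSum_eval φ hx a).sub (hasSum_eval ψ hx a)
  refine h.norm_le_of_bounded (a.hasSum_norm.mul_left _) fun n => ?_
  rw [← sub_mul]
  refine (norm_mul_le _ _).trans ((mul_le_mul (hC _)
    ((norm_pow_le x n).trans (pow_le_one₀ (norm_nonneg _) hx)) (norm_nonneg _)
    ((norm_nonneg _).trans (hC _))).trans (mul_one _).le)

theorem norm_eval_eval_sub_le (φ : ContrHom E B) {x y x' y' : B} (hx : ‖x‖ ≤ 1 / 2)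
    (hy : ‖y‖ ≤ 1 / 2) (hx' : ‖x'‖ ≤ 1 / 2) (hy' : ‖y'‖ ≤ 1 / 2) (a : AbsSeries (AbsSeries E)) :
    ‖eval (eval φ x) y a - eval (eval φ x') y' a‖ ≤ ‖a‖ * (‖x - x'‖ + ‖y - y'‖) := by
  have h1 := norm_eval_sub_le (eval φ x) hy hy' a
  have h2 : ‖eval (eval φ x) y' a - eval (eval φ x') y' a‖ ≤ ‖x - x'‖ * ‖a‖ :=
    norm_eval_sub_le_of_hom (fun e => (norm_eval_sub_le φ hx hx' e).trans (mul_comm _ _).le)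
      (hy'.trans (by norm_num)) a
  calc _ = ‖(eval (eval φ x) y a - eval (eval φ x) y' a) +
        (eval (eval φ x) y' a - eval (eval φ x') y' a)‖ := by abel_nf
    _ ≤ _ := norm_add_le _ _
    _ ≤ _ := add_le_add h1 h2
    _ = _ := by ring

/-! ### Linear maps acting on the coefficients -/

variable {E' : Type*} [NormedCommRing E'] [NormedAlgebra ℝ E'] [CompleteSpace E']

/-- The action of a continuous linear map on the coefficients. -/
def map (Z : E →L[ℝ] E') : AbsSeries E →L[ℝ] AbsSeries E' :=
  LinearMap.mkContinuous
    { toFun := fun a => mk (fun n => Z (a.coeff n))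
        ((a.summable_norm_coeff.mul_left ‖Z‖).of_nonneg_of_le (fun _ => norm_nonneg _)
          fun n => Z.le_opNorm _)
      map_add' := fun a b => ext fun n => by simp
      map_smul' := fun r a => ext fun n => by simp } ‖Z‖
    fun a => norm_mk_le (a.hasSum_norm.mul_left ‖Z‖) fun n => Z.le_opNorm _

@[simp] theorem coeff_map (Z : E →L[ℝ] E') (a : AbsSeries E) (n : ℕ) :
    (map Z a).coeff n = Z (a.coeff n) := PowerSeries.coeff_mk n fun n => Z (a.coeff n)

theorem norm_map_le (Z : E →L[ℝ] E') : ‖map Z‖ ≤ ‖Z‖ :=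
  LinearMap.mkContinuous_norm_le _ (norm_nonneg _) _

/-- A homomorphism commuting with linear maps commutes with them after evaluation at a scalar. -/
theorem map_eval_algebraMap (φ : ContrHom E B) (φ' : ContrHom E' B') (Z : E →L[ℝ] E')
    (Y : B →L[ℝ] B') (h : ∀ x, φ' (Z x) = Y (φ x)) {r : ℝ} (hr : |r| ≤ 1) (a : AbsSeries E) :
    eval φ' (algebraMap ℝ B' r) (map Z a) = Y (eval φ (algebraMap ℝ B r) a) := by
  have h1 : ‖algebraMap ℝ B r‖ ≤ 1 := by simpa using hr
  have h2 : ‖algebraMap ℝ B' r‖ ≤ 1 := by simpa using hr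
  refine (hasSum_eval φ' h2 _).unique ?_
  convert! Y.hasSum (hasSum_eval φ h1 a) using 2 with n
  rw [coeff_map, h, ← map_pow, ← map_pow, mul_comm, mul_comm (φ _), ← Algebra.smul_def,
    ← Algebra.smul_def, map_smul]

/-- A homomorphism commuting with linear maps commutes with them after the passage to series. -/
theorem map_eval_monomial (φ : ContrHom E B) (φ' : ContrHom E' B') (Z : E →L[ℝ] E')
    (Y : B →L[ℝ] B') (h : ∀ x, φ' (Z x) = Y (φ x)) (a : AbsSeries E) :
    eval ((const B').comp φ') (monomial 1 1) (map Z a) =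
      map Y (eval ((const B).comp φ) (monomial 1 1) a) := by
  refine ext fun n => ?_
  rw [coeff_eval_monomial_one, coeff_map, coeff_map, coeff_eval_monomial_one, h]

end AbsSeries
end

noncomputable section

namespace AbsSeries

/-! ### Series whose first coefficients vanish -/

section Vanish

variable {D : Type*} [NormedCommRing D] [NormedAlgebra ℝ D] [CompleteSpace D]
variable {E : Type*} [NormedCommRing E] [NormedAlgebra ℝ E] [CompleteSpace E]

/-- The ideal of series whose coefficients of order less than `m` vanish. -/
def vanish (E : Type*) [NormedCommRing E] [NormedAlgebra ℝ E] [CompleteSpace E] (m : ℕ) :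
    Ideal (AbsSeries E) where
  carrier := {a | ∀ i < m, a.coeff i = 0}
  add_mem' ha hb i hi := by rw [coeff_add, ha i hi, hb i hi, add_zero]
  zero_mem' i _ := coeff_zero i
  smul_mem' c a ha i hi := by
    rw [smul_eq_mul, coeff_mul]
    refine Finset.sum_eq_zero fun v hv => ?_
    have := Finset.HasAntidiagonal.mem_antidiagonal.1 hv
    rw [ha v.2 (by omega), mul_zero]

theorem mul_mem_vanish {m k : ℕ} {a b : AbsSeries E} (ha : a ∈ vanish E m) (hb : b ∈ vanish E k) :
    a * b ∈ vanish E (m + k) := by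
  intro i hi
  rw [coeff_mul]
  refine Finset.sum_eq_zero fun v hv => ?_
  have := Finset.HasAntidiagonal.mem_antidiagonal.1 hv
  rcases lt_or_ge v.1 m with h | h
  · rw [ha _ h, zero_mul]
  · rw [hb _ (by omega), mul_zero]

theorem smul_mem_vanish {m : ℕ} (r : ℝ) {a : AbsSeries E} (ha : a ∈ vanish E m) :
    r • a ∈ vanish E m := fun i hi => by rw [coeff_smul, ha i hi, smul_zero]

theorem hasSum_mem_vanish {m : ℕ} {f : ℕ → AbsSeries E} {a : AbsSeries E} (h : HasSum f a)
    (hf : ∀ n, f n ∈ vanish E m) : a ∈ vanish E m := by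
  intro i hi
  refine ((coeffCLM i).hasSum h).unique ?_
  have : (fun n => coeffCLM i (f n)) = fun _ => 0 := funext fun n => hf n i hi
  rw [this]; exact hasSum_zero

theorem pow_sub_pow_mem_vanish {m : ℕ} {x y : AbsSeries E} (h : x - y ∈ vanish E m) (n : ℕ) :
    x ^ n - y ^ n ∈ vanish E m :=
  Ideal.mem_of_dvd _ (sub_dvd_pow_sub_pow x y n) h

variable [NormOneClass E]

theorem eval_sub_mem_vanish {φ ψ : ContrHom D (AbsSeries E)} {m : ℕ}
    (h : ∀ d, φ d - ψ d ∈ vanish E m) {x y : AbsSeries E} (hx : ‖x‖ ≤ 1) (hy : ‖y‖ ≤ 1)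
    (hxy : x - y ∈ vanish E m) (a : AbsSeries D) : eval φ x a - eval ψ y a ∈ vanish E m := by
  refine hasSum_mem_vanish ((hasSum_eval φ hx a).sub (hasSum_eval ψ hy a)) fun n => ?_
  have : φ (a.coeff n) * x ^ n - ψ (a.coeff n) * y ^ n =
      (φ (a.coeff n) - ψ (a.coeff n)) * x ^ n + ψ (a.coeff n) * (x ^ n - y ^ n) := by ring
  rw [this]
  exact add_mem (Ideal.mul_mem_right _ _ (h _))
    (Ideal.mul_mem_left _ _ (pow_sub_pow_mem_vanish hxy n))

/-- Each difference of powers of order at least two factors as `x - y` times sums of products that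
contain at least one more factor `x` or `y`, and these have no constant term. This gains one order,
and it replaces the factor `ε` that is missing in front of the nonlinear part of `ω`. -/
theorem eval_sub_mem_vanish_of_quadratic (φ : ContrHom D (AbsSeries E)) {m : ℕ}
    {x y : AbsSeries E} (hx : ‖x‖ ≤ 1) (hy : ‖y‖ ≤ 1) (hx0 : x ∈ vanish E 1) (hy0 : y ∈ vanish E 1)
    (hxy : x - y ∈ vanish E m) {a : AbsSeries D} (ha : a ∈ vanish D 2) :
    eval φ x a - eval φ y a ∈ vanish E (m + 1) := by
  refine hasSum_mem_vanish ((hasSum_eval φ hx a).sub (hasSum_eval φ hy a)) fun n => ?_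
  rw [← mul_sub]
  rcases lt_or_ge n 2 with hn | hn
  · rw [ha n hn, map_zero, zero_mul]; exact zero_mem _
  · refine Ideal.mul_mem_left _ _ ?_
    obtain ⟨n, rfl⟩ := Nat.exists_eq_add_of_le' (show 1 ≤ n by omega)
    have : x ^ (n + 1) - y ^ (n + 1) = (x - y) * x ^ n + (x ^ n - y ^ n) * y := by ring
    rw [this]
    refine add_mem (mul_mem_vanish hxy ?_) (mul_mem_vanish (pow_sub_pow_mem_vanish hxy n) hy0)
    exact Ideal.pow_mem_of_mem _ hx0 _ (by omega)

/-- The polynomial obtained by keeping the coefficients of order at most `m`. -/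
def trunc (m : ℕ) (a : AbsSeries E) : AbsSeries E :=
  mk (fun n => if n ≤ m then a.coeff n else 0) (a.summable_norm_coeff.of_nonneg_of_le
    (fun _ => norm_nonneg _) fun n => by split_ifs <;> simp)

theorem coeff_trunc (m n : ℕ) (a : AbsSeries E) :
    (trunc m a).coeff n = if n ≤ m then a.coeff n else 0 := coeff_mk _ _ _

theorem norm_trunc_le (m : ℕ) (a : AbsSeries E) : ‖trunc m a‖ ≤ ‖a‖ :=
  norm_mk_le a.hasSum_norm fun n => by split_ifs <;> simp

theorem trunc_sub_mem_vanish (m : ℕ) (a : AbsSeries E) : trunc m a - a ∈ vanish E (m + 1) := by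
  intro i hi
  rw [coeff_sub, coeff_trunc, if_pos (by omega), sub_self]

end Vanish

/-! ### Double series -/

section Double

variable {E : Type*} [NormedCommRing E] [NormedAlgebra ℝ E] [CompleteSpace E]
variable {B : Type*} [NormedCommRing B] [NormedAlgebra ℝ B] [CompleteSpace B] [NormOneClass B]

theorem hasSum_half_geometric (C : ℝ) : HasSum (fun n : ℕ => C * (1 / 2) ^ n) (C * 2) := by
  exact hasSum_geometric_two.mul_left C

/-- The series whose coefficients decay like `2 ^ (-n)`. -/
def mkHalf (f : ℕ → E) (C : ℝ) (h : ∀ n, ‖f n‖ ≤ C * (1 / 2) ^ n) : AbsSeries E :=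
  mk f ((hasSum_half_geometric C).summable.of_nonneg_of_le (fun _ => norm_nonneg _) h)

theorem norm_mkHalf_le (f : ℕ → E) (C : ℝ) (h : ∀ n, ‖f n‖ ≤ C * (1 / 2) ^ n) :
    ‖mkHalf f C h‖ ≤ C * 2 := norm_mk_le (hasSum_half_geometric C) h

@[simp] theorem coeff_mkHalf (f : ℕ → E) (C : ℝ) (h : ∀ n, ‖f n‖ ≤ C * (1 / 2) ^ n) (n : ℕ) :
    (mkHalf f C h).coeff n = f n := coeff_mk _ _ _

/-- The double series whose coefficients decay like `2 ^ (-k - j)`. -/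
def mkHalf₂ (f : ℕ → ℕ → E) (C : ℝ) (h : ∀ k j, ‖f k j‖ ≤ C * (1 / 2) ^ k * (1 / 2) ^ j) :
    AbsSeries (AbsSeries E) :=
  mkHalf (fun k => mkHalf (f k) (C * (1 / 2) ^ k) (h k)) (C * 2) fun k =>
    (norm_mkHalf_le _ _ _).trans (by ring_nf; rfl)

theorem norm_mkHalf₂_le (f : ℕ → ℕ → E) (C : ℝ)
    (h : ∀ k j, ‖f k j‖ ≤ C * (1 / 2) ^ k * (1 / 2) ^ j) : ‖mkHalf₂ f C h‖ ≤ 4 * C :=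
  (norm_mkHalf_le _ _ _).trans (by ring_nf; rfl)

@[simp] theorem coeff_coeff_mkHalf₂ (f : ℕ → ℕ → E) (C : ℝ)
    (h : ∀ k j, ‖f k j‖ ≤ C * (1 / 2) ^ k * (1 / 2) ^ j) (k j : ℕ) :
    ((mkHalf₂ f C h).coeff k).coeff j = f k j := by
  rw [mkHalf₂, coeff_mkHalf, coeff_mkHalf]

theorem eval_eval_eq_of_hasSum (φ : ContrHom E B) {x y : B} (hx : ‖x‖ ≤ 1) (hy : ‖y‖ ≤ 1)
    (a : AbsSeries (AbsSeries E)) {s : B}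
    (h : HasSum (fun v : ℕ × ℕ => φ ((a.coeff v.1).coeff v.2) * x ^ v.2 * y ^ v.1) s) :
    eval (eval φ x) y a = s :=
  (hasSum_eval (eval φ x) hy a).unique <| h.prod_fiberwise fun k =>
    (hasSum_eval φ hx (a.coeff k)).mul_right (y ^ k)

end Double

end AbsSeries

/-! ### Taylor expansion in two directions -/

section Taylor

variable {V : Type*} [NormedAddCommGroup V] [NormedSpace ℝ V]

/-- The derivative bounds make the Taylor series converge on the ball of radius `1 / N`, but a
priori its sum is `f` only near `x`. The identity theorem on the connected ball, where both
functions are analytic, extends the equality. -/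
theorem hasSum_taylor_of_bound {f : V → ℝ} {x : V} {N : ℝ} (hN : 0 < N)
    (hf : AnalyticOnNhd ℝ f (Metric.ball x (1 / N)))
    (hb : ∀ m : ℕ, ‖iteratedFDeriv ℝ m f x‖ ≤ N ^ (m + 1) * m.factorial) {v : V}
    (hv : ‖v‖ < 1 / N) :
    HasSum (fun m : ℕ => (m.factorial : ℝ)⁻¹ * iteratedFDeriv ℝ m f x fun _ => v) (f (x + v)) := by
  let p : FormalMultilinearSeries ℝ V ℝ := fun m => (m.factorial : ℝ)⁻¹ • iteratedFDeriv ℝ m f x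
  have hpos : 0 < 1 / N := by positivity
  have hr : ENNReal.ofReal (1 / N) ≤ p.radius := by
    refine p.le_radius_of_bound (r := (1 / N).toNNReal) N fun m => ?_
    rw [Real.coe_toNNReal _ hpos.le, norm_smul, norm_inv, Real.norm_natCast]
    have hm : (0 : ℝ) < m.factorial := by positivity
    calc _ ≤ (m.factorial : ℝ)⁻¹ * (N ^ (m + 1) * m.factorial) * (1 / N) ^ m := by gcongr; exact hb m
      _ = N := by
        rw [one_div N, inv_pow, pow_succ]
        field_simp
  have hp0 : 0 < ENNReal.ofReal (1 / N) := ENNReal.ofReal_pos.2 hpos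
  have hp := p.hasFPowerSeriesOnBall (hp0.trans_le hr)
  have hball : Metric.ball (0 : V) (1 / N) = Metric.eball (0 : V) (ENNReal.ofReal (1 / N)) :=
    (Metric.eball_ofReal).symm
  have hsub : Metric.ball (0 : V) (1 / N) ⊆ Metric.eball (0 : V) p.radius := by
    rw [hball]; exact Metric.eball_subset_eball hr
  have h1 : AnalyticOnNhd ℝ p.sum (Metric.ball (0 : V) (1 / N)) := hp.analyticOnNhd.mono hsub
  have h2 : AnalyticOnNhd ℝ (fun y => f (x + y)) (Metric.ball (0 : V) (1 / N)) := by
    intro y hy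
    have hmem : x + y ∈ Metric.ball x (1 / N) := by simpa using hy
    exact (hf _ hmem).comp_of_eq (analyticAt_const.add analyticAt_id) rfl
  have h3 : (fun y => f (x + y)) =ᶠ[nhds 0] p.sum := by
    obtain ⟨q, s, hq⟩ := hf x (Metric.mem_ball_self hpos)
    filter_upwards [Metric.eball_mem_nhds (0 : V) hq.r_pos] with y hy
    rw [← (hq.hasSum hy).tsum_eq]
    refine tsum_congr fun m => ?_
    have := hq.factorial_smul y m
    change _ = (m.factorial : ℝ)⁻¹ • iteratedFDeriv ℝ m f x (fun _ => y)
    rw [← this, ← Nat.cast_smul_eq_nsmul ℝ, smul_smul, inv_mul_cancel₀ (by positivity), one_smul]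
  have h4 := h2.eqOn_of_preconnected_of_eventuallyEq h1 (convex_ball _ _).isPreconnected
    (Metric.mem_ball_self hpos) h3
  have hv' : v ∈ Metric.ball (0 : V) (1 / N) := by simpa using hv
  have h5 := hp.hasSum (hsub hv')
  rw [zero_add, ← h4 hv'] at h5
  exact h5

/-- The coefficient of `b ^ i c ^ (m - i)` in the Taylor expansion of `f (x + b e₁ + c e₂)`. -/
def dirCoeff (f : V → ℝ) (e₁ e₂ : V) (m i : ℕ) (x : V) : ℝ :=
  (m.factorial : ℝ)⁻¹ * ∑ s ∈ Finset.powersetCard i (Finset.univ : Finset (Fin m)),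
    iteratedFDeriv ℝ m f x (s.piecewise (fun _ => e₁) fun _ => e₂)

theorem abs_dirCoeff_le {f : V → ℝ} {x : V} {N : ℝ} (hN : 0 < N) {m : ℕ}
    (hb : ‖iteratedFDeriv ℝ m f x‖ ≤ N ^ (m + 1) * m.factorial) {e₁ e₂ : V} (h₁ : ‖e₁‖ ≤ 1)
    (h₂ : ‖e₂‖ ≤ 1) (i : ℕ) : |dirCoeff f e₁ e₂ m i x| ≤ N * (2 * N) ^ m := by
  have hm : (0 : ℝ) < m.factorial := by positivity
  have hs : ∀ s : Finset (Fin m),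
      ‖iteratedFDeriv ℝ m f x (s.piecewise (fun _ => e₁) fun _ => e₂)‖ ≤
        N ^ (m + 1) * m.factorial := by
    intro s
    refine (ContinuousMultilinearMap.le_opNorm _ _).trans ?_
    have : ∏ k : Fin m, ‖s.piecewise (fun _ => e₁) (fun _ => e₂) k‖ ≤ 1 := by
      refine Finset.prod_le_one (fun _ _ => norm_nonneg _) fun k _ => ?_
      by_cases hk : k ∈ s <;> simp [hk, h₁, h₂]
    exact (mul_le_mul hb this (Finset.prod_nonneg fun _ _ => norm_nonneg _)
      (by positivity)).trans (mul_one _).le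
  have hc : ((m.choose i : ℕ) : ℝ) ≤ 2 ^ m := by exact_mod_cast Nat.choose_le_two_pow m i
  rw [dirCoeff, abs_mul, abs_inv, Nat.abs_cast]
  calc _ ≤ (m.factorial : ℝ)⁻¹ * (m.choose i * (N ^ (m + 1) * m.factorial)) := by
        gcongr
        refine (norm_sum_le_of_le _ fun s _ => hs s).trans ?_
        simp
    _ ≤ (m.factorial : ℝ)⁻¹ * (2 ^ m * (N ^ (m + 1) * m.factorial)) := by gcongr
    _ = _ := by
        rw [mul_pow, pow_succ]
        field_simp

/-- Multilinearity expands the term over the sets of slots that receive the first direction; sets of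
equal cardinality contribute the same powers of `b` and `c`. In the antidiagonal, `v.2` counts the
slots of `e₁` and `v.1` those of `e₂`. -/
theorem taylor_term_eq_sum (f : V → ℝ) (e₁ e₂ x : V) (b c : ℝ) (m : ℕ) :
    (m.factorial : ℝ)⁻¹ * iteratedFDeriv ℝ m f x (fun _ => b • e₁ + c • e₂) =
      ∑ v ∈ Finset.HasAntidiagonal.antidiagonal m,
        dirCoeff f e₁ e₂ (v.1 + v.2) v.2 x * b ^ v.2 * c ^ v.1 := by
  have h1 : iteratedFDeriv ℝ m f x (fun _ => b • e₁ + c • e₂) =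
      ∑ s : Finset (Fin m), b ^ s.card * c ^ (m - s.card) *
        iteratedFDeriv ℝ m f x (s.piecewise (fun _ => e₁) fun _ => e₂) := by
    have := (iteratedFDeriv ℝ m f x).map_add_univ (fun _ => b • e₁) (fun _ => c • e₂)
    refine this.trans (Finset.sum_congr rfl fun s _ => ?_)
    have h2 : (s.piecewise (fun _ => b • e₁) fun _ => c • e₂) =
        fun k : Fin m => (s.piecewise (fun _ => b) (fun _ => c) k : ℝ) •
          s.piecewise (fun _ => e₁) (fun _ => e₂) k := by
      funext k
      by_cases hk : k ∈ s <;> simp [hk]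
    rw [h2, ContinuousMultilinearMap.map_smul_univ, smul_eq_mul, Finset.prod_piecewise]
    simp [Finset.card_univ_sdiff]
  rw [h1, ← Finset.powerset_univ, Finset.sum_powerset, Finset.card_univ, Fintype.card_fin,
    Finset.mul_sum, ← Finset.Nat.sum_antidiagonal_swap,
    Finset.Nat.sum_antidiagonal_eq_sum_range_succ_mk]
  refine Finset.sum_congr rfl fun j hj => ?_
  have hj : j ≤ m := by have := Finset.mem_range.1 hj; omega
  have h4 : dirCoeff f e₁ e₂ (m - j + j) j x = dirCoeff f e₁ e₂ m j x := by
    rw [Nat.sub_add_cancel hj]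
  simp only [Prod.swap_prod_mk, h4]
  rw [dirCoeff]
  have h3 : ∀ s ∈ Finset.powersetCard j (Finset.univ : Finset (Fin m)),
      b ^ s.card * c ^ (m - s.card) *
        iteratedFDeriv ℝ m f x (s.piecewise (fun _ => e₁) fun _ => e₂) =
      b ^ j * c ^ (m - j) * iteratedFDeriv ℝ m f x (s.piecewise (fun _ => e₁) fun _ => e₂) := by
    intro s hs
    rw [(Finset.mem_powersetCard.1 hs).2]
  rw [Finset.sum_congr rfl h3, ← Finset.mul_sum]
  ring

end Taylor
end

noncomputable section

/-! ### Periodic functions -/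

/-- Continuous `T`-periodic functions. -/
abbrev PeriodicFun (T : ℝ) := C(AddCircle T, ℝ)

section Average

variable {T : ℝ}

theorem continuous_zeroMeanPrimitive {g : ℝ → ℝ} (hg : Continuous g) :
    Continuous (zeroMeanPrimitive T g) := by
  unfold zeroMeanPrimitive
  refine Continuous.sub (intervalIntegral.continuous_primitive (fun a b => ?_) 0) continuous_const
  exact (hg.sub continuous_const).intervalIntegrable a b

theorem hasDerivAt_zeroMeanPrimitive {g : ℝ → ℝ} (hg : Continuous g) (t : ℝ) :
    HasDerivAt (zeroMeanPrimitive T g) (g t - average T g) t := by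
  unfold zeroMeanPrimitive
  have hc : Continuous fun s => g s - average T g := hg.sub continuous_const
  exact (intervalIntegral.integral_hasDerivAt_right (hc.intervalIntegrable 0 t)
    (hc.stronglyMeasurableAtFilter _ _) hc.continuousAt).sub_const _

theorem integral_sub_average (hT : 0 < T) {g : ℝ → ℝ} (hg : Continuous g)
    (hp : Function.Periodic g T) (t : ℝ) : ∫ s in t..t + T, (g s - average T g) = 0 := by
  rw [intervalIntegral.integral_sub (hg.intervalIntegrable _ _) intervalIntegrable_const,
    hp.intervalIntegral_add_eq t 0, intervalIntegral.integral_const, average, zero_add,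
    add_sub_cancel_left, smul_eq_mul, mul_inv_cancel_left₀ hT.ne', sub_self]

theorem periodic_zeroMeanPrimitive (hT : 0 < T) {g : ℝ → ℝ} (hg : Continuous g)
    (hp : Function.Periodic g T) : Function.Periodic (zeroMeanPrimitive T g) T := by
  intro t
  have hc : Continuous fun s => g s - average T g := hg.sub continuous_const
  have := intervalIntegral.integral_add_adjacent_intervals (hc.intervalIntegrable 0 t)
    (hc.intervalIntegrable (μ := MeasureTheory.volume) t (t + T))
  rw [integral_sub_average hT hg hp, add_zero] at this
  rw [zeroMeanPrimitive, zeroMeanPrimitive, this]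

theorem average_add {f g : ℝ → ℝ} (hf : Continuous f) (hg : Continuous g) :
    average T (fun t => f t + g t) = average T f + average T g := by
  rw [average, intervalIntegral.integral_add (hf.intervalIntegrable _ _)
    (hg.intervalIntegrable _ _), mul_add, ← average, ← average]

theorem average_const_mul (r : ℝ) (f : ℝ → ℝ) :
    average T (fun t => r * f t) = r * average T f := by
  rw [average, intervalIntegral.integral_const_mul, average, mul_left_comm]

theorem continuous_integral_sub_average {g : ℝ → ℝ} (hg : Continuous g) :
    Continuous fun u => ∫ s in (0 : ℝ)..u, (g s - average T g) :=
  intervalIntegral.continuous_primitive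
    (fun a b => (hg.sub continuous_const).intervalIntegrable a b) 0

theorem zeroMeanPrimitive_add {f g : ℝ → ℝ} (hf : Continuous f) (hg : Continuous g) (t : ℝ) :
    zeroMeanPrimitive T (fun t => f t + g t) t =
      zeroMeanPrimitive T f t + zeroMeanPrimitive T g t := by
  have h : ∀ u, ∫ s in (0 : ℝ)..u, (f s + g s - average T (fun t => f t + g t)) =
      (∫ s in (0 : ℝ)..u, (f s - average T f)) + ∫ s in (0 : ℝ)..u, (g s - average T g) := by
    intro u
    have hf' : Continuous fun s => f s - average T f := hf.sub continuous_const
    have hg' : Continuous fun s => g s - average T g := hg.sub continuous_const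
    rw [← intervalIntegral.integral_add (hf'.intervalIntegrable _ _) (hg'.intervalIntegrable _ _)]
    refine intervalIntegral.integral_congr fun s _ => ?_
    change f s + g s - average T (fun t => f t + g t) = f s - average T f + (g s - average T g)
    rw [average_add hf hg]; ring
  simp only [zeroMeanPrimitive, h]
  rw [average_add (continuous_integral_sub_average hf) (continuous_integral_sub_average hg)]
  ring

theorem zeroMeanPrimitive_const_mul (r : ℝ) (f : ℝ → ℝ) (t : ℝ) :
    zeroMeanPrimitive T (fun t => r * f t) t = r * zeroMeanPrimitive T f t := by
  have h : ∀ u, ∫ s in (0 : ℝ)..u, (r * f s - average T fun t => r * f t) =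
      r * ∫ s in (0 : ℝ)..u, (f s - average T f) := by
    intro u
    rw [← intervalIntegral.integral_const_mul, average_const_mul]
    simp only [mul_sub]
  simp only [zeroMeanPrimitive, h]
  rw [average_const_mul, mul_sub]

theorem average_zeroMeanPrimitive (hT : 0 < T) {g : ℝ → ℝ} (hg : Continuous g) :
    average T (zeroMeanPrimitive T g) = 0 := by
  have h := continuous_integral_sub_average (T := T) hg
  change T⁻¹ * ∫ t in (0 : ℝ)..T, ((∫ s in (0 : ℝ)..t, (g s - average T g)) -
    average T (fun u => ∫ s in (0 : ℝ)..u, (g s - average T g))) = 0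
  rw [intervalIntegral.integral_sub (h.intervalIntegrable _ _) intervalIntegrable_const,
    intervalIntegral.integral_const, sub_zero, smul_eq_mul, mul_sub, inv_mul_cancel_left₀ hT.ne',
    ← average, sub_self]

theorem average_comp_add {g : ℝ → ℝ} (hp : Function.Periodic g T) (d : ℝ) :
    average T (fun t => g (t + d)) = average T g := by
  rw [average, average, intervalIntegral.integral_comp_add_right, zero_add, add_comm T d,
    hp.intervalIntegral_add_eq d 0, zero_add]

/-- A primitive with a fixed base point does not commute with translations; its normalization to
mean zero does, because averages of periodic functions are translation invariant. The shift of the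
initial phase rests on this. -/
theorem zeroMeanPrimitive_comp_add (hT : 0 < T) {g : ℝ → ℝ} (hg : Continuous g)
    (hp : Function.Periodic g T) (d : ℝ) :
    zeroMeanPrimitive T (fun t => g (t + d)) = fun t => zeroMeanPrimitive T g (t + d) := by
  have hc : Continuous fun s => g s - average T g := hg.sub continuous_const
  have hP : Function.Periodic (fun u => ∫ s in (0 : ℝ)..u, (g s - average T g)) T := by
    intro t
    have := periodic_zeroMeanPrimitive hT hg hp t
    simpa [zeroMeanPrimitive] using this
  have hcont : Continuous fun u => ∫ s in (0 : ℝ)..u, (g s - average T g) :=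
    intervalIntegral.continuous_primitive (fun a b => hc.intervalIntegrable a b) 0
  have h1 : ∀ t, ∫ s in (0 : ℝ)..t, (g (s + d) - average T g) =
      (∫ s in (0 : ℝ)..t + d, (g s - average T g)) - ∫ s in (0 : ℝ)..d, (g s - average T g) := by
    intro t
    rw [intervalIntegral.integral_comp_add_right (fun s => g s - average T g), zero_add,
      intervalIntegral.integral_interval_sub_left (hc.intervalIntegrable _ _)
        (hc.intervalIntegrable _ _)]
  funext t
  simp only [zeroMeanPrimitive, average_comp_add hp d, h1]
  have h2 := average_comp_add hP d
  have h3 : average T (fun u => (∫ s in (0 : ℝ)..u + d, (g s - average T g)) -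
      ∫ s in (0 : ℝ)..d, (g s - average T g)) =
      average T (fun u => ∫ s in (0 : ℝ)..u + d, (g s - average T g)) -
        ∫ s in (0 : ℝ)..d, (g s - average T g) := by
    have hcd : Continuous fun u => ∫ s in (0 : ℝ)..u + d, (g s - average T g) :=
      hcont.comp (continuous_id.add continuous_const)
    rw [average, intervalIntegral.integral_sub (hcd.intervalIntegrable _ _)
      intervalIntegrable_const, intervalIntegral.integral_const, sub_zero, smul_eq_mul, mul_sub,
      inv_mul_cancel_left₀ hT.ne', ← average]
  rw [h3, h2]; ring

theorem abs_average_le (hT : 0 < T) {g : ℝ → ℝ} {C : ℝ} (h : ∀ t ∈ Set.Icc 0 T, |g t| ≤ C) :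
    |average T g| ≤ C := by
  have := intervalIntegral.norm_integral_le_of_norm_le_const (a := 0) (b := T) (f := g) (C := C)
    fun t ht => h t (by rw [Set.uIoc_of_le hT.le] at ht; exact Set.Ioc_subset_Icc_self ht)
  rw [average, abs_mul, abs_of_pos (inv_pos.2 hT)]
  rw [sub_zero, abs_of_pos hT, Real.norm_eq_abs] at this
  calc _ ≤ T⁻¹ * (C * T) := by gcongr
    _ = C := by field_simp

/-- The integrand is at most `2 C` over a length at most `T`, and subtracting the average of the
primitive doubles the bound. -/
theorem abs_zeroMeanPrimitive_le (hT : 0 < T) {g : ℝ → ℝ} {C : ℝ} (hC : ∀ t, |g t| ≤ C)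
    {t : ℝ} (ht : t ∈ Set.Icc 0 T) : |zeroMeanPrimitive T g t| ≤ 4 * T * C := by
  have hC0 : 0 ≤ C := (abs_nonneg _).trans (hC 0)
  have h1 : ∀ u ∈ Set.Icc 0 T, |∫ s in (0 : ℝ)..u, (g s - average T g)| ≤ 2 * C * T := by
    intro u hu
    have h2 : ∀ s, ‖g s - average T g‖ ≤ 2 * C := fun s =>
      (norm_sub_le _ _).trans (by
        have := hC s
        have := abs_average_le hT fun t _ => hC t
        simp only [Real.norm_eq_abs]; linarith)
    have := intervalIntegral.norm_integral_le_of_norm_le_const (a := 0) (b := u)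
      fun s _ => h2 s
    rw [sub_zero, abs_of_nonneg hu.1, Real.norm_eq_abs] at this
    exact this.trans (mul_le_mul_of_nonneg_left hu.2 (by positivity))
  have h3 := abs_average_le hT h1
  have h4 := h1 t ht
  rw [zeroMeanPrimitive]
  refine (abs_sub _ _).trans ?_
  linarith

end Average

namespace PeriodicFun

variable {T : ℝ} [hT : Fact (0 < T)]

/-- A continuous periodic function on the line. -/
def mk (g : ℝ → ℝ) (hg : Continuous g) (hp : Function.Periodic g T) : PeriodicFun T :=
  ⟨hp.lift, continuous_coinduced_dom.2 hg⟩

@[simp] theorem mk_apply (g : ℝ → ℝ) (hg : Continuous g) (hp : Function.Periodic g T) (t : ℝ) :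
    mk g hg hp (t : AddCircle T) = g t := hp.lift_coe t

/-- The function on the line. -/
def toFun (f : PeriodicFun T) (t : ℝ) : ℝ := f (t : AddCircle T)

theorem continuous_toFun (f : PeriodicFun T) : Continuous f.toFun :=
  f.continuous.comp (AddCircle.continuous_mk' T)

theorem periodic_toFun (f : PeriodicFun T) : Function.Periodic f.toFun T := fun t => by
  simp [toFun]

theorem ext_toFun {f g : PeriodicFun T} (h : ∀ t, f.toFun t = g.toFun t) : f = g :=
  ContinuousMap.ext fun x => QuotientAddGroup.induction_on x h

@[simp] theorem toFun_mk (g : ℝ → ℝ) (hg : Continuous g) (hp : Function.Periodic g T) :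
    (mk g hg hp).toFun = g := funext fun t => mk_apply g hg hp t

theorem abs_toFun_le (f : PeriodicFun T) (t : ℝ) : |f.toFun t| ≤ ‖f‖ := f.norm_coe_le_norm _

theorem norm_le_of_forall {f : PeriodicFun T} {C : ℝ} (h : ∀ t ∈ Set.Icc 0 T, |f.toFun t| ≤ C) :
    ‖f‖ ≤ C := by
  refine (ContinuousMap.norm_le_of_nonempty f).2 fun x => ?_
  obtain ⟨t, ht, rfl⟩ := AddCircle.coe_image_Icc_eq T 0 ▸ Set.mem_univ x
  rw [zero_add] at ht
  exact h t ht

/-- The value at a point. -/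
def evalAt (t : ℝ) : ContrHom (PeriodicFun T) ℝ where
  toFun f := f.toFun t
  map_one' := rfl
  map_mul' _ _ := rfl
  map_zero' := rfl
  map_add' _ _ := rfl
  commutes' _ := rfl
  norm_le' f := f.abs_toFun_le t

@[simp] theorem evalAt_apply (t : ℝ) (f : PeriodicFun T) : evalAt t f = f.toFun t := rfl

@[simp] theorem toFun_add (f g : PeriodicFun T) (t : ℝ) :
    (f + g).toFun t = f.toFun t + g.toFun t := rfl

@[simp] theorem toFun_sub (f g : PeriodicFun T) (t : ℝ) :
    (f - g).toFun t = f.toFun t - g.toFun t := rfl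

@[simp] theorem toFun_smul (r : ℝ) (f : PeriodicFun T) (t : ℝ) :
    (r • f).toFun t = r * f.toFun t := rfl

@[simp] theorem toFun_algebraMap (r : ℝ) (t : ℝ) :
    (algebraMap ℝ (PeriodicFun T) r).toFun t = r := rfl

/-- The average, as a linear map. -/
def avgLinear : PeriodicFun T →ₗ[ℝ] ℝ where
  toFun f := average T f.toFun
  map_add' f g := average_add f.continuous_toFun g.continuous_toFun
  map_smul' r f := average_const_mul r f.toFun

/-- The average. -/
def avg : PeriodicFun T →L[ℝ] ℝ :=
  avgLinear.mkContinuous 1 fun f => by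
    rw [one_mul]
    exact abs_average_le hT.out fun t _ => f.abs_toFun_le t

theorem avg_apply (f : PeriodicFun T) : avg f = average T f.toFun := rfl

theorem norm_avg_le : ‖(avg : PeriodicFun T →L[ℝ] ℝ)‖ ≤ 1 :=
  LinearMap.mkContinuous_norm_le _ zero_le_one _

/-- The average as a constant function. -/
def avgConst : PeriodicFun T →L[ℝ] PeriodicFun T := avg.smulRight (1 : PeriodicFun T)

theorem toFun_avgConst (f : PeriodicFun T) (t : ℝ) : (avgConst f).toFun t = avg f :=
  mul_one _

theorem norm_avgConst_le : ‖(avgConst : PeriodicFun T →L[ℝ] PeriodicFun T)‖ ≤ 1 := by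
  rw [avgConst, ContinuousLinearMap.norm_smulRight_apply, norm_one, mul_one]
  exact norm_avg_le

/-- The zero-average primitive, as a linear map. -/
def primLinear : PeriodicFun T →ₗ[ℝ] PeriodicFun T where
  toFun f := mk (zeroMeanPrimitive T f.toFun) (continuous_zeroMeanPrimitive f.continuous_toFun)
    (periodic_zeroMeanPrimitive hT.out f.continuous_toFun f.periodic_toFun)
  map_add' f g := ext_toFun fun t => by
    rw [toFun_add, toFun_mk, toFun_mk, toFun_mk]
    exact zeroMeanPrimitive_add f.continuous_toFun g.continuous_toFun t
  map_smul' r f := ext_toFun fun t => by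
    rw [RingHom.id_apply, toFun_smul, toFun_mk, toFun_mk]
    exact zeroMeanPrimitive_const_mul r f.toFun t

theorem toFun_primLinear (f : PeriodicFun T) :
    (primLinear f).toFun = zeroMeanPrimitive T f.toFun :=
  toFun_mk _ (continuous_zeroMeanPrimitive f.continuous_toFun)
    (periodic_zeroMeanPrimitive hT.out f.continuous_toFun f.periodic_toFun)

/-- The zero-average primitive. -/
def prim : PeriodicFun T →L[ℝ] PeriodicFun T :=
  primLinear.mkContinuous (4 * T) fun f => norm_le_of_forall fun t ht => by
    rw [toFun_primLinear]
    exact abs_zeroMeanPrimitive_le hT.out f.abs_toFun_le ht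

theorem toFun_prim (f : PeriodicFun T) : (prim f).toFun = zeroMeanPrimitive T f.toFun :=
  toFun_primLinear f

theorem avg_prim (f : PeriodicFun T) : avg (prim f) = 0 := by
  rw [avg_apply, toFun_prim]
  exact average_zeroMeanPrimitive hT.out f.continuous_toFun

theorem norm_prim_le : ‖(prim : PeriodicFun T →L[ℝ] PeriodicFun T)‖ ≤ 4 * T :=
  LinearMap.mkContinuous_norm_le _ (by have := hT.out; positivity) _

theorem hasDerivAt_prim (f : PeriodicFun T) (t : ℝ) :
    HasDerivAt (prim f).toFun (f.toFun t - avg f) t := by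
  rw [toFun_prim]
  exact hasDerivAt_zeroMeanPrimitive f.continuous_toFun t

end PeriodicFun
end

noncomputable section

/-! ### Expansion of a function on the extended phase space along a resonant torus -/

/-- `H` is analytic over `W`, periodic in both angles, and satisfies Cauchy estimates with the
constant `N` on the torus `A = A₀`. -/
structure IsTorusFun (o : ResonantOrbit) (W : Set ℝ) (N : ℝ) (H : ℝ × ℝ × ℝ → ℝ) : Prop where
  N_pos : 0 < N
  isOpen : IsOpen W
  ball_subset : Metric.ball o.A₀ (1 / N) ⊆ W
  analytic : AnalyticOnNhd ℝ H {x | x.2.1 ∈ W}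
  periodic : ∀ α t : ℝ, ∀ A ∈ W,
    H (α + 2 * Real.pi, A, t) = H (α, A, t) ∧ H (α, A, t + 2 * Real.pi) = H (α, A, t)
  bound : ∀ (m : ℕ) (α t : ℝ),
    ‖iteratedFDeriv ℝ m H (α, o.A₀, t)‖ ≤ N ^ (m + 1) * (m.factorial : ℝ)

/-- The unperturbed orbit in the extended phase space. -/
def ResonantOrbit.point (o : ResonantOrbit) (t : ℝ) : ℝ × ℝ × ℝ := (o.α₀ t, o.A₀, t + o.t₀)

theorem iteratedFDeriv_add_period {W : Set ℝ} (hW : IsOpen W) {H : ℝ × ℝ × ℝ → ℝ}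
    (hH : ∀ α t : ℝ, ∀ A ∈ W,
      H (α + 2 * Real.pi, A, t) = H (α, A, t) ∧ H (α, A, t + 2 * Real.pi) = H (α, A, t))
    (k l : ℤ) (m : ℕ) {x : ℝ × ℝ × ℝ} (hx : x.2.1 ∈ W) :
    iteratedFDeriv ℝ m H (x + (k * (2 * Real.pi), 0, l * (2 * Real.pi))) =
      iteratedFDeriv ℝ m H x := by
  rw [← iteratedFDeriv_comp_add_right]
  refine Filter.EventuallyEq.eq_of_nhds (Filter.EventuallyEq.iteratedFDeriv ℝ ?_ m)
  have hopen : IsOpen {x : ℝ × ℝ × ℝ | x.2.1 ∈ W} := hW.preimage (by fun_prop)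
  filter_upwards [hopen.mem_nhds hx] with y hy
  obtain ⟨α, A, t⟩ := y
  have h1 : Function.Periodic (fun α => H (α, A, t + l * (2 * Real.pi))) (2 * Real.pi) :=
    fun α => (hH α _ A hy).1
  have h2 : Function.Periodic (fun t => H (α, A, t)) (2 * Real.pi) := fun t => (hH α t A hy).2
  have e1 := h1.int_mul k α
  have e2 := h2.int_mul l t
  simp only [Prod.mk_add_mk, add_zero]
  exact e1.trans e2

namespace IsTorusFun

variable {o : ResonantOrbit} {W : Set ℝ} {N : ℝ} {H : ℝ × ℝ × ℝ → ℝ}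

theorem mem (h : IsTorusFun o W N H) : o.A₀ ∈ W :=
  h.ball_subset (Metric.mem_ball_self (one_div_pos.2 h.N_pos))

theorem continuous_dirCoeff (h : IsTorusFun o W N H) (e₁ e₂ : ℝ × ℝ × ℝ) (m i : ℕ) :
    Continuous fun t => dirCoeff H e₁ e₂ m i (o.point t) := by
  have h1 : Continuous fun t => iteratedFDeriv ℝ m H (o.point t) := by
    refine continuous_iff_continuousAt.2 fun t => ?_
    have hp : Continuous o.point := by unfold ResonantOrbit.point ResonantOrbit.α₀; fun_prop
    exact ContinuousAt.comp (f := o.point) (g := iteratedFDeriv ℝ m H)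
      ((h.analytic.iteratedFDeriv m (o.point t) h.mem).continuousAt) hp.continuousAt
  unfold dirCoeff
  refine continuous_const.mul (continuous_finsetSum _ fun s _ => ?_)
  exact (ContinuousMultilinearMap.apply ℝ (fun _ : Fin m => ℝ × ℝ × ℝ) ℝ _).continuous.comp h1

theorem periodic_dirCoeff (h : IsTorusFun o W N H) (hq : 0 < o.q) (e₁ e₂ : ℝ × ℝ × ℝ)
    (m i : ℕ) : Function.Periodic (fun t => dirCoeff H e₁ e₂ m i (o.point t)) o.T := by
  intro t
  have hq' : (o.q : ℝ) ≠ 0 := by positivity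
  -- During the time `2πq` the angle makes `p` turns and the time variable `q` turns.
  have h1 : o.point (t + o.T) =
      o.point t + ((o.p : ℤ) * (2 * Real.pi), 0, (o.q : ℤ) * (2 * Real.pi)) := by
    simp only [ResonantOrbit.point, ResonantOrbit.α₀, ResonantOrbit.T, Prod.mk_add_mk, add_zero]
    refine Prod.ext ?_ (Prod.ext rfl ?_)
    · field_simp
    · push_cast; ring
  simp only [dirCoeff, h1]
  rw [iteratedFDeriv_add_period h.isOpen h.periodic o.p o.q m (x := o.point t) h.mem]

variable [Fact (0 < o.T)]

/-- The coefficient of `u ^ i w ^ j` of `H (α₀ t + r u, A₀ + r' w, t + t₀)`. -/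
def taylorFun (h : IsTorusFun o W N H) (hq : 0 < o.q) (r r' : ℝ) (j i : ℕ) : PeriodicFun o.T :=
  (r ^ i * r' ^ j) • PeriodicFun.mk
    (fun t => dirCoeff H (1, 0, 0) (0, 1, 0) (j + i) i (o.point t))
    (h.continuous_dirCoeff _ _ _ _) (h.periodic_dirCoeff hq _ _ _ _)

theorem toFun_taylorFun (h : IsTorusFun o W N H) (hq : 0 < o.q) (r r' : ℝ) (j i : ℕ) (t : ℝ) :
    (h.taylorFun hq r r' j i).toFun t =
      r ^ i * r' ^ j * dirCoeff H (1, 0, 0) (0, 1, 0) (j + i) i (o.point t) := by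
  rw [taylorFun, PeriodicFun.toFun_smul, PeriodicFun.toFun_mk]

/-- The coefficients of total order `m` are at most `N (2 N) ^ m`; scales below `1 / (4 N)` turn
this into decay by `1 / 2` per order. -/
theorem norm_taylorFun_le (h : IsTorusFun o W N H) (hq : 0 < o.q) {r r' : ℝ} (hr' : 0 ≤ r')
    (hrr : r' ≤ r) (hr : 4 * N * r ≤ 1) (j i : ℕ) :
    ‖h.taylorFun hq r r' j i‖ ≤ N * (1 / 2) ^ j * (1 / 2) ^ i := by
  have hN := h.N_pos
  refine PeriodicFun.norm_le_of_forall fun t _ => ?_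
  have hr0 : 0 ≤ r := hr'.trans hrr
  rw [toFun_taylorFun, abs_mul, abs_of_nonneg (by positivity)]
  have h1 := abs_dirCoeff_le hN (h.bound (j + i) (o.α₀ t) (t + o.t₀))
    (e₁ := (1, 0, 0)) (e₂ := (0, 1, 0)) (by simp [Prod.norm_def]) (by simp [Prod.norm_def]) i
  calc _ ≤ r ^ i * r' ^ j * (N * (2 * N) ^ (j + i)) := by gcongr; exact h1
    _ = N * (2 * N * r') ^ j * (2 * N * r) ^ i := by rw [pow_add, mul_pow, mul_pow]; ring
    _ ≤ N * (1 / 2) ^ j * (1 / 2) ^ i := by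
      gcongr
      · nlinarith
      · linarith

/-- The expansion of `H (α₀ t + r u, A₀ + r' w, t + t₀)` in `w` (outer variable) and `u` (inner
variable). -/
def series (h : IsTorusFun o W N H) (hq : 0 < o.q) {r r' : ℝ} (hr' : 0 ≤ r')
    (hrr : r' ≤ r) (hr : 4 * N * r ≤ 1) : AbsSeries (AbsSeries (PeriodicFun o.T)) :=
  AbsSeries.mkHalf₂ (h.taylorFun hq r r') N (h.norm_taylorFun_le hq hr' hrr hr)

theorem norm_series_le (h : IsTorusFun o W N H) (hq : 0 < o.q) {r r' : ℝ} (hr' : 0 ≤ r')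
    (hrr : r' ≤ r) (hr : 4 * N * r ≤ 1) : ‖h.series hq hr' hrr hr‖ ≤ 4 * N :=
  AbsSeries.norm_mkHalf₂_le _ _ _

/-- Absolute convergence allows the double series to be summed along antidiagonals, where it becomes
the Taylor series at the point of the unperturbed orbit. -/
theorem eval_series (h : IsTorusFun o W N H) (hq : 0 < o.q) {r r' : ℝ} (hr' : 0 ≤ r')
    (hrr : r' ≤ r) (hr : 4 * N * r ≤ 1) (t : ℝ) {u w : ℝ} (hu : |u| ≤ 1) (hw : |w| ≤ 1) :
    AbsSeries.eval (AbsSeries.eval (PeriodicFun.evalAt t) u) w (h.series hq hr' hrr hr) =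
      H (o.α₀ t + r * u, o.A₀ + r' * w, t + o.t₀) := by
  have hN := h.N_pos
  have hr0 : 0 ≤ r := hr'.trans hrr
  refine AbsSeries.eval_eval_eq_of_hasSum _ hu hw _ ?_
  simp only [series, AbsSeries.coeff_coeff_mkHalf₂, PeriodicFun.evalAt_apply]
  set g : ℕ × ℕ → ℝ := fun v => (h.taylorFun hq r r' v.1 v.2).toFun t * u ^ v.2 * w ^ v.1 with hg
  have hs : Summable g := by
    have hgeo : Summable fun v : ℕ × ℕ => (N * (1 / 2) ^ v.1) * (1 / 2) ^ v.2 :=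
      ((AbsSeries.hasSum_half_geometric N).summable.mul_of_nonneg
        (g := fun n : ℕ => (1 / 2 : ℝ) ^ n) summable_geometric_two
        (fun _ => by positivity) fun _ => by positivity)
    refine Summable.of_norm_bounded hgeo fun v => ?_
    rw [hg, norm_mul, norm_mul, norm_pow, norm_pow]
    have h1 : ‖(h.taylorFun hq r r' v.1 v.2).toFun t‖ ≤ N * (1 / 2) ^ v.1 * (1 / 2) ^ v.2 :=
      (PeriodicFun.abs_toFun_le _ t).trans (h.norm_taylorFun_le hq hr' hrr hr _ _)
    have h2 : ‖u‖ ^ v.2 ≤ 1 := pow_le_one₀ (norm_nonneg _) hu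
    have h3 : ‖w‖ ^ v.1 ≤ 1 := pow_le_one₀ (norm_nonneg _) hw
    calc _ ≤ (N * (1 / 2) ^ v.1 * (1 / 2) ^ v.2) * 1 * 1 := by gcongr
      _ = _ := by ring
  have hsig := ((Finset.HasAntidiagonal.sigmaAntidiagonalEquivProd (A := ℕ)).hasSum_iff.2 hs.hasSum).sigma
    fun m => (Finset.HasAntidiagonal.antidiagonal m).hasSum g
  have hv : ‖((r * u) • ((1, 0, 0) : ℝ × ℝ × ℝ) + (r' * w) • ((0, 1, 0) : ℝ × ℝ × ℝ))‖ < 1 / N := by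
    have h1 : |r * u| ≤ r := by
      rw [abs_mul, abs_of_nonneg hr0]; exact mul_le_of_le_one_right hr0 hu
    have h2 : |r' * w| ≤ r := by
      rw [abs_mul, abs_of_nonneg hr']; exact (mul_le_of_le_one_right hr' hw).trans hrr
    have h3 : r < 1 / N := by rw [lt_div_iff₀ hN]; nlinarith
    simp only [Prod.norm_def, Prod.smul_mk, Prod.mk_add_mk, smul_eq_mul, mul_one, mul_zero,
      add_zero, zero_add, norm_zero, Real.norm_eq_abs]
    refine max_lt (h1.trans_lt h3) (max_lt (h2.trans_lt h3) (one_div_pos.2 hN))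
  have hana : AnalyticOnNhd ℝ H (Metric.ball (o.point t) (1 / N)) := by
    refine h.analytic.mono fun y hy => h.ball_subset ?_
    rw [Metric.mem_ball, Prod.dist_eq, Prod.dist_eq] at hy
    exact ((le_max_left _ _).trans (le_max_right _ _)).trans_lt hy
  have htay := hasSum_taylor_of_bound hN hana (fun m => h.bound m _ _) hv
  have hval : o.point t + ((r * u) • ((1, 0, 0) : ℝ × ℝ × ℝ) + (r' * w) • ((0, 1, 0) : ℝ × ℝ × ℝ)) =
      (o.α₀ t + r * u, o.A₀ + r' * w, t + o.t₀) := by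
    simp [ResonantOrbit.point]
  rw [hval] at htay
  have : HasSum (fun m => ∑ v ∈ Finset.HasAntidiagonal.antidiagonal m, g v)
      (H (o.α₀ t + r * u, o.A₀ + r' * w, t + o.t₀)) := by
    convert! htay using 2 with m
    rw [taylor_term_eq_sum]
    refine Finset.sum_congr rfl fun v _ => ?_
    rw [hg, mul_pow, mul_pow]
    simp only [toFun_taylorFun]
    ring
  rw [this.unique hsig]
  exact hs.hasSum

end IsTorusFun

/-- The function `ω (A₀ + r w) - ω (A₀) - ω' (A₀) r w` as a power series in `w`. -/
theorem exists_quadratic_series {ω : ℝ → ℝ} {A₀ N : ℝ} (hN : 0 < N)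
    (hω : AnalyticOnNhd ℝ ω (Metric.ball A₀ (1 / N)))
    (hb : ∀ m : ℕ, |iteratedDeriv m ω A₀| ≤ N ^ (m + 1) * (m.factorial : ℝ)) {r : ℝ} (hr0 : 0 ≤ r)
    (hr : 4 * N * r ≤ 1) :
    ∃ a : AbsSeries ℝ, ‖a‖ ≤ 8 * N ^ 3 * r ^ 2 ∧ a ∈ AbsSeries.vanish ℝ 2 ∧
      ∀ w : ℝ, |w| ≤ 1 → AbsSeries.eval (ContrHom.id ℝ) w a =
        ω (A₀ + r * w) - ω A₀ - deriv ω A₀ * (r * w) := by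
  -- Deleting orders zero and one leaves the factor `N ^ 3 r ^ 2`; being quadratic in `r`, it is
  -- small even relative to `r`.
  let f : ℕ → ℝ := fun m => if m < 2 then 0 else r ^ m * ((m.factorial : ℝ)⁻¹ * iteratedDeriv m ω A₀)
  have hf : ∀ m, ‖f m‖ ≤ 4 * N ^ 3 * r ^ 2 * (1 / 2) ^ m := by
    intro m
    simp only [f]
    split_ifs with hm
    · rw [norm_zero]; positivity
    · obtain ⟨k, rfl⟩ := Nat.exists_eq_add_of_le' (not_lt.1 hm)
      rw [norm_mul, norm_mul, norm_pow, norm_inv, Real.norm_natCast, Real.norm_eq_abs,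
        Real.norm_eq_abs, abs_of_nonneg hr0]
      have hfac : (0 : ℝ) < (k + 2).factorial := by positivity
      calc _ ≤ r ^ (k + 2) * (((k + 2).factorial : ℝ)⁻¹ *
            (N ^ (k + 2 + 1) * ((k + 2).factorial : ℝ))) := by gcongr; exact hb _
        _ = N ^ 3 * r ^ 2 * (N * r) ^ k := by
          rw [mul_pow]
          field_simp
          ring
        _ ≤ N ^ 3 * r ^ 2 * (1 / 2) ^ k := by
          gcongr
          nlinarith
        _ = _ := by rw [pow_add]; ring
  refine ⟨AbsSeries.mkHalf f _ hf, (AbsSeries.norm_mkHalf_le _ _ _).trans (by ring_nf; rfl),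
    fun i hi => ?_, fun w hw => ?_⟩
  · rw [AbsSeries.coeff_mkHalf]; exact if_pos hi
  · refine (AbsSeries.hasSum_eval (ContrHom.id ℝ) hw _).unique ?_
    simp only [AbsSeries.coeff_mkHalf, ContrHom.id_apply]
    have hv : ‖r * w‖ < 1 / N := by
      have h1 : |r * w| ≤ r := by
        rw [abs_mul, abs_of_nonneg hr0]; exact mul_le_of_le_one_right hr0 hw
      refine h1.trans_lt ?_
      rw [lt_div_iff₀ hN]; nlinarith
    have h1 := hasSum_taylor_of_bound hN hω (fun m => by
      rw [norm_iteratedFDeriv_eq_norm_iteratedDeriv]; exact hb m) hv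
    have h2 : ∀ m : ℕ, (m.factorial : ℝ)⁻¹ * iteratedFDeriv ℝ m ω A₀ (fun _ => r * w) =
        r ^ m * ((m.factorial : ℝ)⁻¹ * iteratedDeriv m ω A₀) * w ^ m := by
      intro m
      have : (iteratedFDeriv ℝ m ω A₀ fun _ => r * w) = (r * w) ^ m * iteratedDeriv m ω A₀ := by
        have := (iteratedFDeriv ℝ m ω A₀).map_smul_univ (fun _ : Fin m => r * w) (fun _ => 1)
        simpa [iteratedDeriv] using this
      rw [this, mul_pow]; ring
    simp only [h2] at h1
    have h3 := (hasSum_nat_add_iff' 2).2 h1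
    refine ((hasSum_nat_add_iff' 2).1 ?_)
    convert! h3 using 1
    simp [f, Finset.sum_range_succ]
    ring
end

noncomputable section

/-! ### The auxiliary system in a Banach algebra -/

/-- The rescaled data of the auxiliary system: the angular correction is `r u`, the action correction
is `r' w`, the average angle is `r₀ b` and the perturbation parameter is `ε₀ e`. -/
structure AuxData (E : Type*) [NormedCommRing E] [NormedAlgebra ℝ E] [CompleteSpace E] where
  r : ℝ
  r' : ℝ
  r₀ : ℝ
  ε₀ : ℝ
  ω' : ℝ
  F : AbsSeries (AbsSeries E)
  G : AbsSeries (AbsSeries E)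
  O : AbsSeries ℝ

namespace AuxData

variable {E : Type*} [NormedCommRing E] [NormedAlgebra ℝ E] [CompleteSpace E]

/-- Smallness of the scales, for operators whose norm is at most `p`. -/
structure Small (d : AuxData E) (p : ℝ) : Prop where
  r_pos : 0 < d.r
  r'_pos : 0 < d.r'
  r₀_pos : 0 < d.r₀
  ε₀_pos : 0 < d.ε₀
  p_nonneg : 0 ≤ p
  O_mem : d.O ∈ AbsSeries.vanish ℝ 2
  angle : d.r₀ + p * (2 * d.ε₀ * ‖d.F‖ + ‖d.O‖) + |d.ω'| * (p * (p * (2 * d.ε₀ * ‖d.G‖))) ≤ d.r / 2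
  action : p * (2 * d.ε₀ * ‖d.G‖) + |d.ω'|⁻¹ * (2 * d.ε₀ * ‖d.F‖ + ‖d.O‖) ≤ d.r' / 2

variable {B : Type*} [NormedCommRing B] [NormedAlgebra ℝ B] [CompleteSpace B] [NormOneClass B]
variable {B' : Type*} [NormedCommRing B'] [NormedAlgebra ℝ B'] [CompleteSpace B'] [NormOneClass B']

/-- The perturbation in the action equation. -/
def gam (d : AuxData E) (φ : ContrHom E B) (e u w : B) : B :=
  d.ε₀ • (e * AbsSeries.eval (AbsSeries.eval φ u) w d.G)

/-- The perturbation in the angle equation. -/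
def phi (d : AuxData E) (φ : ContrHom E B) (e u w : B) : B :=
  d.ε₀ • (e * AbsSeries.eval (AbsSeries.eval φ u) w d.F) +
    AbsSeries.eval (ContrHom.ofReal B) w d.O

/-- The auxiliary system in integral form. -/
structure IsSol (d : AuxData E) (φ : ContrHom E B) (P A : B →L[ℝ] B) (e b u w : B) : Prop where
  angle : d.r • u = d.r₀ • b + P (d.phi φ e u w) + d.ω' • P (P (d.gam φ e u w))
  action : d.r' • w = P (d.gam φ e u w) - d.ω'⁻¹ • A (d.phi φ e u w)

theorem map_gam (d : AuxData E) (φ : ContrHom E B) (ψ : ContrHom B B') {e u w : B}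
    (hu : ‖u‖ ≤ 1) (hw : ‖w‖ ≤ 1) :
    ψ (d.gam φ e u w) = d.gam (ψ.comp φ) (ψ e) (ψ u) (ψ w) := by
  rw [gam, gam, map_smul, map_mul, AbsSeries.map_eval ψ _ hw, AbsSeries.comp_eval ψ φ hu]

theorem comp_ofReal (ψ : ContrHom B B') : ψ.comp (ContrHom.ofReal B) = ContrHom.ofReal B' := by
  ext x
  exact AlgHomClass.commutes ψ x

theorem map_phi (d : AuxData E) (φ : ContrHom E B) (ψ : ContrHom B B') {e u w : B}
    (hu : ‖u‖ ≤ 1) (hw : ‖w‖ ≤ 1) :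
    ψ (d.phi φ e u w) = d.phi (ψ.comp φ) (ψ e) (ψ u) (ψ w) := by
  rw [phi, phi, map_add, map_smul, map_mul, AbsSeries.map_eval ψ _ hw, AbsSeries.comp_eval ψ φ hu,
    AbsSeries.map_eval ψ _ hw, comp_ofReal]

/-- Every term of the system is built from evaluations, ring operations and the operators `P` and
`A`, so a homomorphism that intertwines the operators preserves solutions. Solutions in different
algebras are thereby related without any appeal to uniqueness. -/
theorem IsSol.map {d : AuxData E} {φ : ContrHom E B} {P A : B →L[ℝ] B} {e b u w : B}
    (h : d.IsSol φ P A e b u w) (hu : ‖u‖ ≤ 1) (hw : ‖w‖ ≤ 1) (ψ : ContrHom B B')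
    {P' A' : B' →L[ℝ] B'} (hP : ∀ x, ψ (P x) = P' (ψ x)) (hA : ∀ x, ψ (A x) = A' (ψ x)) :
    d.IsSol (ψ.comp φ) P' A' (ψ e) (ψ b) (ψ u) (ψ w) where
  angle := by
    rw [← map_gam d φ ψ hu hw, ← map_phi d φ ψ hu hw, ← hP, ← hP, ← hP, ← map_smul, h.angle,
      map_add, map_add, map_smul, map_smul]
  action := by
    rw [← map_gam d φ ψ hu hw, ← map_phi d φ ψ hu hw, ← hP, ← hA, ← map_smul, h.action,
      map_sub, map_smul]

theorem norm_gam_sub_le (d : AuxData E) (φ : ContrHom E B) (hε : 0 ≤ d.ε₀) {e u w u' w' : B}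
    (he : ‖e‖ ≤ 1) (hu : ‖u‖ ≤ 1 / 2) (hw : ‖w‖ ≤ 1 / 2) (hu' : ‖u'‖ ≤ 1 / 2) (hw' : ‖w'‖ ≤ 1 / 2)
    {C : ℝ} (h1 : ‖u - u'‖ ≤ C) (h2 : ‖w - w'‖ ≤ C) :
    ‖d.gam φ e u w - d.gam φ e u' w'‖ ≤ 2 * d.ε₀ * ‖d.G‖ * C := by
  rw [gam, gam, ← smul_sub, ← mul_sub, norm_smul, Real.norm_of_nonneg hε]
  have h3 := AbsSeries.norm_eval_eval_sub_le φ hu hw hu' hw' d.G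
  calc _ ≤ d.ε₀ * (1 * (‖d.G‖ * (C + C))) := by
        gcongr
        refine (norm_mul_le _ _).trans ?_
        gcongr
        exact h3.trans (by gcongr)
    _ = _ := by ring

theorem norm_phi_sub_le (d : AuxData E) (φ : ContrHom E B) (hε : 0 ≤ d.ε₀) {e u w u' w' : B}
    (he : ‖e‖ ≤ 1) (hu : ‖u‖ ≤ 1 / 2) (hw : ‖w‖ ≤ 1 / 2) (hu' : ‖u'‖ ≤ 1 / 2) (hw' : ‖w'‖ ≤ 1 / 2)
    {C : ℝ} (h1 : ‖u - u'‖ ≤ C) (h2 : ‖w - w'‖ ≤ C) :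
    ‖d.phi φ e u w - d.phi φ e u' w'‖ ≤ (2 * d.ε₀ * ‖d.F‖ + ‖d.O‖) * C := by
  have h3 := AbsSeries.norm_eval_eval_sub_le φ hu hw hu' hw' d.F
  have h4 := AbsSeries.norm_eval_sub_le (ContrHom.ofReal B) hw hw' d.O
  have h5 : d.phi φ e u w - d.phi φ e u' w' =
      d.ε₀ • (e * (AbsSeries.eval (AbsSeries.eval φ u) w d.F -
        AbsSeries.eval (AbsSeries.eval φ u') w' d.F)) +
      (AbsSeries.eval (ContrHom.ofReal B) w d.O - AbsSeries.eval (ContrHom.ofReal B) w' d.O) := by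
    rw [phi, phi, mul_sub, smul_sub]; abel
  rw [h5]
  refine (norm_add_le _ _).trans ?_
  rw [norm_smul, Real.norm_of_nonneg hε]
  calc _ ≤ d.ε₀ * (1 * (‖d.F‖ * (C + C))) + ‖d.O‖ * C := by
        gcongr
        · refine (norm_mul_le _ _).trans ?_
          gcongr
          exact h3.trans (by gcongr)
        · exact h4.trans (by gcongr)
    _ = _ := by ring

theorem norm_gam_le (d : AuxData E) (φ : ContrHom E B) (hε : 0 ≤ d.ε₀) {e : B} (he : ‖e‖ ≤ 1)
    (u w : B) : ‖d.gam φ e u w‖ ≤ d.ε₀ * ‖d.G‖ := by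
  rw [gam, norm_smul, Real.norm_of_nonneg hε]
  gcongr
  refine (norm_mul_le _ _).trans ((mul_le_mul he (ContrHom.norm_le _ _) (norm_nonneg _)
    zero_le_one).trans (one_mul _).le)

theorem norm_phi_le (d : AuxData E) (φ : ContrHom E B) (hε : 0 ≤ d.ε₀) {e : B} (he : ‖e‖ ≤ 1)
    (u w : B) : ‖d.phi φ e u w‖ ≤ d.ε₀ * ‖d.F‖ + ‖d.O‖ := by
  rw [phi]
  refine (norm_add_le _ _).trans (add_le_add ?_ (ContrHom.norm_le _ _))
  rw [norm_smul, Real.norm_of_nonneg hε]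
  gcongr
  refine (norm_mul_le _ _).trans ((mul_le_mul he (ContrHom.norm_le _ _) (norm_nonneg _)
    zero_le_one).trans (one_mul _).le)

/-- A map of the ball of radius `1 / 2` into itself which is Lipschitz with constant `1 / 2` has a
fixed point. -/
theorem exists_fixedPoint_of_lipschitz_half {X : Type*} [NormedAddCommGroup X] [CompleteSpace X]
    {f : X → X} (hf : ∀ x, ‖x‖ ≤ 1 / 2 → ‖f x‖ ≤ 1 / 2)
    (hL : ∀ x y, ‖x‖ ≤ 1 / 2 → ‖y‖ ≤ 1 / 2 → ‖f x - f y‖ ≤ 1 / 2 * ‖x - y‖) :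
    ∃ x, ‖x‖ ≤ 1 / 2 ∧ f x = x := by
  let s : Set X := Metric.closedBall 0 (1 / 2)
  have hs : ∀ {x}, x ∈ s ↔ ‖x‖ ≤ 1 / 2 := by intro x; simp [s]
  have hm : Set.MapsTo f s s := fun x hx => hs.2 (hf x (hs.1 hx))
  have hc : ContractingWith (1 / 2) (hm.restrict f s s) := by
    refine ⟨?_, LipschitzWith.of_dist_le_mul fun x y => ?_⟩
    · rw [← NNReal.coe_lt_coe]; norm_num
    · rw [Subtype.dist_eq, Subtype.dist_eq, dist_eq_norm, dist_eq_norm]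
      simpa using hL x y (hs.1 x.2) (hs.1 y.2)
  obtain ⟨y, hy, hfy, -⟩ := hc.exists_fixedPoint' Metric.isClosed_closedBall.isComplete hm
    (x := 0) (hs.2 (by simp)) (edist_ne_top _ _)
  exact ⟨y, hs.1 hy, hfy⟩

/-- The two inequalities in `Small` serve twice: they keep the fixed-point map in the ball of radius
`1 / 2`, and they bound its Lipschitz constant by `1 / 2`. The factor `2` in front of `ε₀` accounts
for `u` and `w` varying simultaneously. -/
theorem Small.exists_isSol {d : AuxData E} {p : ℝ} (hd : d.Small p) (φ : ContrHom E B)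
    {P A : B →L[ℝ] B} (hP : ‖P‖ ≤ p) (hA : ‖A‖ ≤ 1) {e b : B} (he : ‖e‖ ≤ 1) (hb : ‖b‖ ≤ 1) :
    ∃ u w, ‖u‖ ≤ 1 / 2 ∧ ‖w‖ ≤ 1 / 2 ∧ d.IsSol φ P A e b u w := by
  have hε := hd.ε₀_pos
  have hr := hd.r_pos
  have hr' := hd.r'_pos
  have hr₀ := hd.r₀_pos
  have hp := hd.p_nonneg
  have hF : 0 ≤ d.ε₀ * ‖d.F‖ := by positivity
  have hG : 0 ≤ d.ε₀ * ‖d.G‖ := by positivity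
  have hPx : ∀ {x : B} {c : ℝ}, ‖x‖ ≤ c → ‖P x‖ ≤ p * c := fun {x c} hx =>
    (P.le_opNorm x).trans (mul_le_mul hP hx (norm_nonneg _) hp)
  have hAx : ∀ {x : B} {c : ℝ}, ‖x‖ ≤ c → ‖A x‖ ≤ c := fun {x c} hx =>
    (A.le_opNorm x).trans ((mul_le_mul hA hx (norm_nonneg _) zero_le_one).trans (one_mul _).le)
  let f : B × B → B × B := fun x =>
    (d.r⁻¹ • (d.r₀ • b + P (d.phi φ e x.1 x.2) + d.ω' • P (P (d.gam φ e x.1 x.2))),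
      d.r'⁻¹ • (P (d.gam φ e x.1 x.2) - d.ω'⁻¹ • A (d.phi φ e x.1 x.2)))
  obtain ⟨x, hx, hfx⟩ := exists_fixedPoint_of_lipschitz_half (f := f) (fun x _ => by
    have h1 := d.norm_gam_le φ hε.le he x.1 x.2
    have h2 := d.norm_phi_le φ hε.le he x.1 x.2
    refine norm_prod_le_iff.2 ⟨?_, ?_⟩
    · simp only [f]
      rw [norm_smul, norm_inv, Real.norm_of_nonneg hr.le, inv_mul_le_iff₀ hr]
      have h3 : ‖d.r₀ • b‖ ≤ d.r₀ := by
        rw [norm_smul, Real.norm_of_nonneg hr₀.le]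
        exact mul_le_of_le_one_right hr₀.le hb
      have h4 : ‖d.ω' • P (P (d.gam φ e x.1 x.2))‖ ≤ |d.ω'| * (p * (p * (2 * d.ε₀ * ‖d.G‖))) := by
        rw [norm_smul, Real.norm_eq_abs]
        exact mul_le_mul_of_nonneg_left (hPx (hPx (h1.trans (by linarith)))) (abs_nonneg _)
      have h5 := hPx (h2.trans (show _ ≤ 2 * d.ε₀ * ‖d.F‖ + ‖d.O‖ by linarith))
      have := norm_add₃_le (a := d.r₀ • b) (b := P (d.phi φ e x.1 x.2))
        (c := d.ω' • P (P (d.gam φ e x.1 x.2)))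
      linarith [hd.angle]
    · simp only [f]
      rw [norm_smul, norm_inv, Real.norm_of_nonneg hr'.le, inv_mul_le_iff₀ hr']
      have h4 : ‖d.ω'⁻¹ • A (d.phi φ e x.1 x.2)‖ ≤ |d.ω'|⁻¹ * (2 * d.ε₀ * ‖d.F‖ + ‖d.O‖) := by
        rw [norm_smul, norm_inv, Real.norm_eq_abs]
        exact mul_le_mul_of_nonneg_left (hAx (h2.trans (by linarith))) (by positivity)
      have h5 := hPx (h1.trans (show _ ≤ 2 * d.ε₀ * ‖d.G‖ by linarith))
      have := norm_sub_le (P (d.gam φ e x.1 x.2)) (d.ω'⁻¹ • A (d.phi φ e x.1 x.2))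
      linarith [hd.action]) (fun x y hx hy => by
    have hx1 := (norm_fst_le x).trans hx
    have hx2 := (norm_snd_le x).trans hx
    have hy1 := (norm_fst_le y).trans hy
    have hy2 := (norm_snd_le y).trans hy
    have hc1 : ‖x.1 - y.1‖ ≤ ‖x - y‖ := norm_fst_le (x - y)
    have hc2 : ‖x.2 - y.2‖ ≤ ‖x - y‖ := norm_snd_le (x - y)
    have h1 := d.norm_gam_sub_le φ hε.le he hx1 hx2 hy1 hy2 hc1 hc2
    have h2 := d.norm_phi_sub_le φ hε.le he hx1 hx2 hy1 hy2 hc1 hc2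
    set C := ‖x - y‖ with hC
    have hC0 : 0 ≤ C := norm_nonneg _
    refine norm_prod_le_iff.2 ⟨?_, ?_⟩
    · have h3 : (f x - f y).1 = d.r⁻¹ • (P (d.phi φ e x.1 x.2 - d.phi φ e y.1 y.2) +
          d.ω' • P (P (d.gam φ e x.1 x.2 - d.gam φ e y.1 y.2))) := by
        simp only [f, Prod.fst_sub, map_sub, ← smul_sub]
        congr 1
        rw [smul_sub]; abel
      rw [h3, norm_smul, norm_inv, Real.norm_of_nonneg hr.le, inv_mul_le_iff₀ hr]
      have h4 := mul_le_mul_of_nonneg_left (hPx (hPx h1)) (abs_nonneg d.ω')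
      have h5 := hPx h2
      refine (norm_add_le _ _).trans ?_
      rw [norm_smul, Real.norm_eq_abs]
      have := mul_le_mul_of_nonneg_right hd.angle hC0
      have h6 : 0 ≤ d.r₀ * C := by positivity
      linarith
    · have h3 : (f x - f y).2 = d.r'⁻¹ • (P (d.gam φ e x.1 x.2 - d.gam φ e y.1 y.2) -
          d.ω'⁻¹ • A (d.phi φ e x.1 x.2 - d.phi φ e y.1 y.2)) := by
        simp only [f, Prod.snd_sub, map_sub, ← smul_sub]
        congr 1
        rw [smul_sub]; abel
      rw [h3, norm_smul, norm_inv, Real.norm_of_nonneg hr'.le, inv_mul_le_iff₀ hr']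
      have h4 := mul_le_mul_of_nonneg_left (hAx h2) (show 0 ≤ |d.ω'|⁻¹ by positivity)
      have h5 := hPx h1
      refine (norm_sub_le _ _).trans ?_
      rw [norm_smul, norm_inv, Real.norm_eq_abs]
      have := mul_le_mul_of_nonneg_right hd.action hC0
      linarith)
  refine ⟨x.1, x.2, (norm_fst_le x).trans hx, (norm_snd_le x).trans hx, ?_, ?_⟩
  · conv_lhs => rw [← hfx]
    simp only [f]
    rw [smul_inv_smul₀ hr.ne']
  · conv_lhs => rw [← hfx]
    simp only [f]
    rw [smul_inv_smul₀ hr'.ne']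

theorem eval_zero_of_mem_vanish {a : AbsSeries ℝ} (ha : a ∈ AbsSeries.vanish ℝ 2) :
    AbsSeries.eval (ContrHom.ofReal B) 0 a = 0 := by
  refine (AbsSeries.hasSum_eval (ContrHom.ofReal B) (by simp) a).unique ?_
  have : ∀ n, ContrHom.ofReal B (a.coeff n) * (0 : B) ^ n = 0 := by
    intro n
    rcases Nat.eq_zero_or_pos n with rfl | hn
    · rw [ha 0 (by norm_num), map_zero, zero_mul]
    · rw [zero_pow hn.ne', mul_zero]
  simp only [this]
  exact hasSum_zero

/-- For vanishing perturbation parameter the solution is trivial. -/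
theorem IsSol.of_zero {d : AuxData E} {p : ℝ} (hd : d.Small p) {φ : ContrHom E B}
    {P A : B →L[ℝ] B} (hA : ‖A‖ ≤ 1) {b u w : B} (hw : ‖w‖ ≤ 1 / 2) (h : d.IsSol φ P A 0 b u w) :
    w = 0 ∧ d.r • u = d.r₀ • b := by
  have hgam : d.gam φ 0 u w = 0 := by rw [gam, zero_mul, smul_zero]
  have hphi : d.phi φ 0 u w = AbsSeries.eval (ContrHom.ofReal B) w d.O := by
    rw [phi, zero_mul, smul_zero, zero_add]
  have h1 := h.action
  rw [hgam, hphi, map_zero, zero_sub] at h1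
  have h2 : ‖AbsSeries.eval (ContrHom.ofReal B) w d.O‖ ≤ ‖d.O‖ * ‖w‖ := by
    have := AbsSeries.norm_eval_sub_le (ContrHom.ofReal B) hw (y := 0) (by simp) d.O
    rwa [eval_zero_of_mem_vanish hd.O_mem, sub_zero, sub_zero] at this
  -- With `e = 0` the action equation is homogeneous, and its right side is at most half of its left
  -- side in norm; hence `w = 0`.
  have h3 : d.r' * ‖w‖ ≤ |d.ω'|⁻¹ * (‖d.O‖ * ‖w‖) := by
    have := congrArg norm h1
    rw [norm_smul, norm_neg, norm_smul, norm_inv, Real.norm_of_nonneg hd.r'_pos.le,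
      Real.norm_eq_abs] at this
    rw [this]
    gcongr
    exact (A.le_opNorm _).trans ((mul_le_mul hA h2 (norm_nonneg _) zero_le_one).trans
      (one_mul _).le)
  have h4 : |d.ω'|⁻¹ * ‖d.O‖ ≤ d.r' / 2 := by
    refine le_trans ?_ hd.action
    have := hd.p_nonneg
    have := hd.ε₀_pos
    have h5 : 0 ≤ p * (2 * d.ε₀ * ‖d.G‖) := by positivity
    have h6 : 0 ≤ |d.ω'|⁻¹ * (2 * d.ε₀ * ‖d.F‖) := by positivity
    linarith
  have h5 : ‖w‖ = 0 := by
    have h6 := mul_le_mul_of_nonneg_right h4 (norm_nonneg w)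
    have h7 : d.r' * ‖w‖ ≤ 0 := by linarith
    have h8 := hd.r'_pos
    have h9 := norm_nonneg w
    nlinarith
  have hw0 : w = 0 := norm_eq_zero.1 h5
  refine ⟨hw0, ?_⟩
  have h6 := h.angle
  rw [hgam, hphi, hw0, eval_zero_of_mem_vanish hd.O_mem] at h6
  simpa using h6

end AuxData
end

noncomputable section

/-! ### The auxiliary system near a resonant torus -/

/-- Bounds on the system near the torus that do not depend on the initial phase. -/
structure LocalBound (S : PerturbedSystem) (o : ResonantOrbit) (N : ℝ) : Prop where
  q_pos : 0 < o.q
  q_le : (o.q : ℝ) ≤ N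
  ball_subset : Metric.ball o.A₀ (1 / N) ⊆ S.W
  ω_le : ∀ m : ℕ, |iteratedDeriv m S.ω o.A₀| ≤ N ^ (m + 1) * (m.factorial : ℝ)
  F_le : ∀ (m : ℕ) (α t : ℝ),
    ‖iteratedFDeriv ℝ m S.F (α, o.A₀, t)‖ ≤ N ^ (m + 1) * (m.factorial : ℝ)
  G_le : ∀ (m : ℕ) (α t : ℝ),
    ‖iteratedFDeriv ℝ m S.G (α, o.A₀, t)‖ ≤ N ^ (m + 1) * (m.factorial : ℝ)
  twist_le : 1 ≤ N * |deriv S.ω o.A₀|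

/-- The data of the auxiliary system represent the functions of the perturbed system. -/
structure AuxData.Represents {o : ResonantOrbit} [Fact (0 < o.T)]
    (d : AuxData (PeriodicFun o.T)) (N : ℝ) (S : PerturbedSystem) : Prop where
  small : d.Small (4 * o.T)
  r₀_eq : d.r₀ = 1 / (16 * N)
  ε₀_eq : d.ε₀ = 1 / (2 ^ 18 * N ^ 6)
  norm_G_le : d.ε₀ * ‖d.G‖ ≤ 1
  ω'_eq : d.ω' = deriv S.ω o.A₀
  ω'_ne : d.ω' ≠ 0
  eval_F : ∀ t u w : ℝ, |u| ≤ 1 → |w| ≤ 1 →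
    AbsSeries.eval (AbsSeries.eval (PeriodicFun.evalAt t) u) w d.F =
      S.F (o.α₀ t + d.r * u, o.A₀ + d.r' * w, t + o.t₀)
  eval_G : ∀ t u w : ℝ, |u| ≤ 1 → |w| ≤ 1 →
    AbsSeries.eval (AbsSeries.eval (PeriodicFun.evalAt t) u) w d.G =
      S.G (o.α₀ t + d.r * u, o.A₀ + d.r' * w, t + o.t₀)
  eval_O : ∀ w : ℝ, |w| ≤ 1 → AbsSeries.eval (ContrHom.id ℝ) w d.O =
    S.ω (o.A₀ + d.r' * w) - S.ω o.A₀ - deriv S.ω o.A₀ * (d.r' * w)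
  mem_W : ∀ w : ℝ, |w| ≤ 1 → o.A₀ + d.r' * w ∈ S.W

/-- The variables stand for `p = 4 T`, `m = |ω'|` and the norms of `F`, `G`, `O`. The scale `r'` is
of order `N ^ (-4)` so that the quadratic part, of size `N ^ 3 r' ^ 2`, stays below `r'` after
division by `ω'`. The scale `ε₀` is of order `N ^ (-6)` so that `|ω'| p ^ 2 ε₀ ‖G‖`, of size `N ^ 5
ε₀`, stays below `r`. -/
theorem scale_estimates {N p m x y z : ℝ} (hN : 1 ≤ N) (hp0 : 0 ≤ p) (hp : p ≤ 28 * N)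
    (hm0 : 0 ≤ m) (hm : m ≤ N ^ 2) (hm' : 1 ≤ N * m) (hx0 : 0 ≤ x) (hx : x ≤ 4 * N) (hy0 : 0 ≤ y)
    (hy : y ≤ 4 * N) (hz0 : 0 ≤ z) (hz : z ≤ 8 * N ^ 3 * (1 / (2 ^ 7 * N ^ 4)) ^ 2) :
    1 / (16 * N) + p * (2 * (1 / (2 ^ 18 * N ^ 6)) * x + z) +
        m * (p * (p * (2 * (1 / (2 ^ 18 * N ^ 6)) * y))) ≤ 1 / (4 * N) / 2 ∧
      p * (2 * (1 / (2 ^ 18 * N ^ 6)) * y) + m⁻¹ * (2 * (1 / (2 ^ 18 * N ^ 6)) * x + z) ≤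
        1 / (2 ^ 7 * N ^ 4) / 2 := by
  have hN0 : 0 < N := by linarith
  have hi0 : 0 < N⁻¹ := inv_pos.2 hN0
  have hi1 : N⁻¹ ≤ 1 := inv_le_one_of_one_le₀ hN
  have hmpos : 0 < m := by
    by_contra h
    have : m = 0 := le_antisymm (not_lt.1 h) hm0
    rw [this, mul_zero] at hm'; linarith
  have hminv : m⁻¹ ≤ N := by
    rw [inv_le_iff_one_le_mul₀ hmpos]; exact hm'
  have hx' : 2 * (1 / (2 ^ 18 * N ^ 6)) * x ≤ 2 * (1 / (2 ^ 18 * N ^ 6)) * (4 * N) := by gcongr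
  have hy' : 2 * (1 / (2 ^ 18 * N ^ 6)) * y ≤ 2 * (1 / (2 ^ 18 * N ^ 6)) * (4 * N) := by gcongr
  have hxy : 2 * (1 / (2 ^ 18 * N ^ 6)) * (4 * N) = N⁻¹ ^ 5 / 2 ^ 15 := by field_simp; norm_num
  have hz' : z ≤ N⁻¹ ^ 5 / 2 ^ 11 := hz.trans (le_of_eq (by field_simp; norm_num))
  rw [hxy] at hx' hy'
  have hxz : 2 * (1 / (2 ^ 18 * N ^ 6)) * x + z ≤ N⁻¹ ^ 5 * (17 / 2 ^ 15) := by linarith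
  have hxz0 : 0 ≤ 2 * (1 / (2 ^ 18 * N ^ 6)) * x + z := by positivity
  have hy0' : 0 ≤ 2 * (1 / (2 ^ 18 * N ^ 6)) * y := by positivity
  have e1 : p * (2 * (1 / (2 ^ 18 * N ^ 6)) * x + z) ≤ 28 * N * (N⁻¹ ^ 5 * (17 / 2 ^ 15)) := by
    gcongr
  have e2 : m * (p * (p * (2 * (1 / (2 ^ 18 * N ^ 6)) * y))) ≤
      N ^ 2 * (28 * N * (28 * N * (N⁻¹ ^ 5 / 2 ^ 15))) := by gcongr
  have e3 : p * (2 * (1 / (2 ^ 18 * N ^ 6)) * y) ≤ 28 * N * (N⁻¹ ^ 5 / 2 ^ 15) := by gcongr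
  have e4 : m⁻¹ * (2 * (1 / (2 ^ 18 * N ^ 6)) * x + z) ≤ N * (N⁻¹ ^ 5 * (17 / 2 ^ 15)) := by
    gcongr
  have f1 : 28 * N * (N⁻¹ ^ 5 * (17 / 2 ^ 15)) = N⁻¹ ^ 4 * (28 * 17 / 2 ^ 15) := by field_simp
  have f2 : N ^ 2 * (28 * N * (28 * N * (N⁻¹ ^ 5 / 2 ^ 15))) = N⁻¹ * (28 * 28 / 2 ^ 15) := by
    field_simp
  have f3 : 28 * N * (N⁻¹ ^ 5 / 2 ^ 15) = N⁻¹ ^ 4 * (28 / 2 ^ 15) := by field_simp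
  have f4 : N * (N⁻¹ ^ 5 * (17 / 2 ^ 15)) = N⁻¹ ^ 4 * (17 / 2 ^ 15) := by field_simp
  have g1 : 1 / (16 * N) = N⁻¹ * (1 / 16) := by field_simp
  have g2 : 1 / (4 * N) / 2 = N⁻¹ * (1 / 8) := by field_simp; norm_num
  have g3 : 1 / (2 ^ 7 * N ^ 4) / 2 = N⁻¹ ^ 4 * (1 / 2 ^ 8) := by field_simp
  have h4 : N⁻¹ ^ 4 ≤ N⁻¹ := pow_le_of_le_one hi0.le hi1 (by norm_num)
  have h40 : 0 < N⁻¹ ^ 4 := by positivity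
  rw [f1] at e1
  rw [f2] at e2
  rw [f3] at e3
  rw [f4] at e4
  rw [g1, g2, g3]
  constructor <;> linarith

namespace LocalBound

variable {S : PerturbedSystem} {o : ResonantOrbit} {N : ℝ}

theorem withPhase (h : LocalBound S o N) (t₀ : ℝ) : LocalBound S (o.withPhase t₀) N :=
  ⟨h.q_pos, h.q_le, h.ball_subset, h.ω_le, h.F_le, h.G_le, h.twist_le⟩

theorem one_le (h : LocalBound S o N) : 1 ≤ N :=
  le_trans (by exact_mod_cast h.q_pos) h.q_le

theorem T_pos (h : LocalBound S o N) : 0 < o.T := by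
  have : (0 : ℝ) < o.q := by exact_mod_cast h.q_pos
  have := Real.pi_pos
  unfold ResonantOrbit.T
  positivity

theorem isTorusFun_F (h : LocalBound S o N) : IsTorusFun o S.W N S.F :=
  ⟨by linarith [h.one_le], S.isOpen_W, h.ball_subset, S.analytic_F, S.periodic_F, h.F_le⟩

theorem isTorusFun_G (h : LocalBound S o N) : IsTorusFun o S.W N S.G :=
  ⟨by linarith [h.one_le], S.isOpen_W, h.ball_subset, S.analytic_G, S.periodic_G, h.G_le⟩

theorem exists_represents (h : LocalBound S o N) [Fact (0 < o.T)] :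
    ∃ d : AuxData (PeriodicFun o.T), d.Represents N S := by
  have hN := h.one_le
  have hN0 : 0 < N := by linarith
  have hr' : (0 : ℝ) ≤ 1 / (2 ^ 7 * N ^ 4) := by positivity
  have h14 : N ≤ N ^ 4 := le_self_pow₀ hN (by norm_num)
  have hrr : 1 / (2 ^ 7 * N ^ 4) ≤ 1 / (4 * N) := by
    apply one_div_le_one_div_of_le (by positivity)
    linarith
  have hr : 4 * N * (1 / (4 * N)) ≤ 1 := by
    rw [mul_one_div_cancel (by positivity)]
  have hr'1 : 4 * N * (1 / (2 ^ 7 * N ^ 4)) ≤ 1 :=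
    (mul_le_mul_of_nonneg_left hrr (by positivity)).trans hr
  obtain ⟨O, hO1, hO2, hO3⟩ := exists_quadratic_series hN0
    (S.analytic_ω.mono h.ball_subset) h.ω_le hr' hr'1
  let d : AuxData (PeriodicFun o.T) :=
    { r := 1 / (4 * N), r' := 1 / (2 ^ 7 * N ^ 4), r₀ := 1 / (16 * N),
      ε₀ := 1 / (2 ^ 18 * N ^ 6), ω' := deriv S.ω o.A₀,
      F := h.isTorusFun_F.series h.q_pos hr' hrr hr,
      G := h.isTorusFun_G.series h.q_pos hr' hrr hr, O := O }
  have hF : ‖d.F‖ ≤ 4 * N := h.isTorusFun_F.norm_series_le h.q_pos hr' hrr hr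
  have hG : ‖d.G‖ ≤ 4 * N := h.isTorusFun_G.norm_series_le h.q_pos hr' hrr hr
  have hT0 := h.T_pos
  -- Four times the period is `8 π q`, and `π < 3.5`.
  have hT : 4 * o.T ≤ 28 * N := by
    have h1 : o.T = 2 * Real.pi * o.q := rfl
    have h2 := Real.pi_lt_d2
    have h3 := h.q_le
    have h4 : Real.pi * o.q ≤ 3.5 * N := by
      have := Real.pi_pos
      gcongr; linarith
    rw [h1]; linarith
  have hω1 : |deriv S.ω o.A₀| ≤ N ^ 2 := by
    have := h.ω_le 1
    simpa [iteratedDeriv_one] using this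
  have hest := scale_estimates hN (by positivity) hT (abs_nonneg _) hω1 h.twist_le
    (norm_nonneg d.F) hF (norm_nonneg d.G) hG (norm_nonneg O) hO1
  refine ⟨d, ⟨by positivity, by positivity, by positivity, by positivity, by positivity, hO2,
    hest.1, hest.2⟩, rfl, rfl, ?_, rfl, ?_, ?_, ?_, hO3, ?_⟩
  · have h1 : d.ε₀ * ‖d.G‖ ≤ 1 / (2 ^ 18 * N ^ 6) * (4 * N) :=
      mul_le_mul_of_nonneg_left hG (by positivity)
    refine h1.trans ?_
    rw [one_div_mul_eq_div, div_le_one (by positivity)]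
    have : N ≤ N ^ 6 := le_self_pow₀ hN (by norm_num)
    linarith
  · intro h0
    have h0' : deriv S.ω o.A₀ = 0 := h0
    have := h.twist_le
    rw [h0', abs_zero, mul_zero] at this
    linarith
  · intro t u w hu hw
    exact h.isTorusFun_F.eval_series h.q_pos hr' hrr hr t hu hw
  · intro t u w hu hw
    exact h.isTorusFun_G.eval_series h.q_pos hr' hrr hr t hu hw
  · intro w hw
    refine h.ball_subset ?_
    rw [Metric.mem_ball, Real.dist_eq, add_sub_cancel_left, abs_mul, abs_of_nonneg hr']
    have h1 : 1 / (4 * N) < 1 / N := one_div_lt_one_div_of_lt hN0 (by linarith)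
    exact ((mul_le_of_le_one_right hr' hw).trans hrr).trans_lt h1

end LocalBound

namespace AuxData.Represents

variable {S : PerturbedSystem} {o : ResonantOrbit} {N : ℝ} [Fact (0 < o.T)]
  {d : AuxData (PeriodicFun o.T)}

theorem gam_real (hd : d.Represents N S) (t e : ℝ) {u w : ℝ} (hu : |u| ≤ 1)
    (hw : |w| ≤ 1) : d.gam (PeriodicFun.evalAt t) e u w =
      d.ε₀ * e * S.G (o.α₀ t + d.r * u, o.A₀ + d.r' * w, t + o.t₀) := by
  rw [AuxData.gam, hd.eval_G t u w hu hw, smul_eq_mul, mul_assoc]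

theorem phi_real (hd : d.Represents N S) (t e : ℝ) {u w : ℝ} (hu : |u| ≤ 1)
    (hw : |w| ≤ 1) : d.phi (PeriodicFun.evalAt t) e u w =
      d.ε₀ * e * S.F (o.α₀ t + d.r * u, o.A₀ + d.r' * w, t + o.t₀) +
        S.ω (o.A₀ + d.r' * w) - S.ω o.A₀ - deriv S.ω o.A₀ * (d.r' * w) := by
  have : ContrHom.ofReal ℝ = ContrHom.id ℝ := rfl
  rw [AuxData.phi, hd.eval_F t u w hu hw, smul_eq_mul, mul_assoc, this, hd.eval_O w hw]
  ring

/-- Solutions of the auxiliary system in the algebra of periodic functions solve the differential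
equations. -/
theorem hasDerivAt (hd : d.Represents N S) {e b : ℝ} {u w : PeriodicFun o.T}
    (hu : ‖u‖ ≤ 1 / 2) (hw : ‖w‖ ≤ 1 / 2)
    (h : d.IsSol (ContrHom.id _) PeriodicFun.prim PeriodicFun.avgConst
      (algebraMap ℝ _ e) (algebraMap ℝ _ b) u w)
    (h0 : PeriodicFun.avg (d.gam (ContrHom.id _) (algebraMap ℝ _ e) u w) = 0) (t : ℝ) :
    o.A₀ + d.r' * w.toFun t ∈ S.W ∧
    HasDerivAt (fun t => d.r * u.toFun t)
      (S.ω (o.A₀ + d.r' * w.toFun t) - S.ω o.A₀ + d.ε₀ * e *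
        S.F (o.α₀ t + d.r * u.toFun t, o.A₀ + d.r' * w.toFun t, t + o.t₀)) t ∧
    HasDerivAt (fun t => d.r' * w.toFun t)
      (d.ε₀ * e * S.G (o.α₀ t + d.r * u.toFun t, o.A₀ + d.r' * w.toFun t, t + o.t₀)) t := by
  have hut : |u.toFun t| ≤ 1 := (u.abs_toFun_le t).trans (by linarith)
  have hwt : |w.toFun t| ≤ 1 := (w.abs_toFun_le t).trans (by linarith)
  have hu1 : ‖u‖ ≤ 1 := by linarith
  have hw1 : ‖w‖ ≤ 1 := by linarith
  set Γ := d.gam (ContrHom.id _) (algebraMap ℝ (PeriodicFun o.T) e) u w with hΓ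
  set Φ := d.phi (ContrHom.id _) (algebraMap ℝ (PeriodicFun o.T) e) u w with hΦ
  have hΓt : Γ.toFun t = d.ε₀ * e *
      S.G (o.α₀ t + d.r * u.toFun t, o.A₀ + d.r' * w.toFun t, t + o.t₀) := by
    rw [← hd.gam_real t e hut hwt]
    exact d.map_gam (ContrHom.id _) (PeriodicFun.evalAt t) hu1 hw1
  have hΦt : Φ.toFun t = d.ε₀ * e *
      S.F (o.α₀ t + d.r * u.toFun t, o.A₀ + d.r' * w.toFun t, t + o.t₀) +
        S.ω (o.A₀ + d.r' * w.toFun t) - S.ω o.A₀ - deriv S.ω o.A₀ * (d.r' * w.toFun t) := by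
    rw [← hd.phi_real t e hut hwt]
    exact d.map_phi (ContrHom.id _) (PeriodicFun.evalAt t) hu1 hw1
  have hang : ∀ t, d.r * u.toFun t = d.r₀ * b + (PeriodicFun.prim Φ).toFun t +
      d.ω' * (PeriodicFun.prim (PeriodicFun.prim Γ)).toFun t := by
    intro t
    have := congrArg (fun f : PeriodicFun o.T => f.toFun t) h.angle
    simpa using this
  have hact : ∀ t, d.r' * w.toFun t = (PeriodicFun.prim Γ).toFun t -
      d.ω'⁻¹ * PeriodicFun.avg Φ := by
    intro t
    have := congrArg (fun f : PeriodicFun o.T => f.toFun t) h.action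
    simpa [PeriodicFun.toFun_avgConst] using this
  refine ⟨hd.mem_W _ hwt, ?_, ?_⟩
  · have h1 := ((PeriodicFun.hasDerivAt_prim Φ t).const_add (d.r₀ * b)).add
      ((PeriodicFun.hasDerivAt_prim (PeriodicFun.prim Γ) t).const_mul d.ω')
    rw [PeriodicFun.avg_prim, hΦt] at h1
    convert! h1 using 1
    · funext t; exact hang t
    · have h2 : (PeriodicFun.prim Γ).toFun t =
          d.r' * w.toFun t + d.ω'⁻¹ * PeriodicFun.avg Φ := by rw [hact]; ring
      have h3 := hd.ω'_ne
      rw [h2, sub_zero, mul_add, mul_inv_cancel_left₀ h3, hd.ω'_eq]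
      ring
  · have h1 := (PeriodicFun.hasDerivAt_prim Γ t).sub_const (d.ω'⁻¹ * PeriodicFun.avg Φ)
    -- Only here is the bifurcation equation used: the action equation holds without a correction
    -- because the mean of `Γ` is zero.
    rw [h0, sub_zero, hΓt] at h1
    convert! h1 using 1
    funext t; exact hact t

end AuxData.Represents
end

noncomputable section

/-! ### Taylor coefficients -/

/-- Uniqueness of power series expansions links `taylorCoeff`, defined by derivatives, to
coefficients in the series algebras. -/
theorem taylorCoeff_of_hasSum {f : ℝ → ℝ} {c : ℕ → ℝ} {ρ : ℝ} (hρ : 0 < ρ)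
    (h : ∀ x : ℝ, |x| < ρ → HasSum (fun n => c n * x ^ n) (f x)) (n : ℕ) : taylorCoeff n f = c n := by
  have h1 : HasFPowerSeriesAt f (FormalMultilinearSeries.ofScalars ℝ c) 0 := by
    rw [hasFPowerSeriesAt_iff]
    filter_upwards [Metric.ball_mem_nhds (0 : ℝ) hρ] with x hx
    have hx' : |x| < ρ := by simpa using hx
    simpa [FormalMultilinearSeries.coeff_ofScalars, mul_comm] using h x hx'
  obtain ⟨r, hr⟩ := h1
  have h2 := hr.factorial_smul 1 n
  rw [taylorCoeff, iteratedDeriv, ← h2]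
  have hn : (n.factorial : ℝ) ≠ 0 := by positivity
  simp [hn]

namespace AbsSeries

variable {E : Type*} [NormedCommRing E] [NormedAlgebra ℝ E] [CompleteSpace E]
variable {B : Type*} [NormedCommRing B] [NormedAlgebra ℝ B] [CompleteSpace B] [NormOneClass B]

theorem eval_zero (φ : ContrHom E B) (a : AbsSeries E) : eval φ 0 a = φ (a.coeff 0) := by
  refine (hasSum_eval φ (by simp) a).unique ?_
  have := hasSum_single (f := fun n => φ (a.coeff n) * (0 : B) ^ n) 0
    fun n hn => by rw [zero_pow hn, mul_zero]
  simpa using this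

theorem eval_trunc (φ : ContrHom E B) {x : B} (hx : ‖x‖ ≤ 1) (k : ℕ) [NormOneClass E]
    (a : AbsSeries E) :
    eval φ x (trunc k a) = ∑ m ∈ Finset.range (k + 1), φ (a.coeff m) * x ^ m := by
  refine (hasSum_eval φ hx _).unique ?_
  have := hasSum_sum_of_ne_finset_zero (L := SummationFilter.unconditional ℕ)
    (s := Finset.range (k + 1)) (f := fun n => φ ((trunc k a).coeff n) * x ^ n) fun n hn => by
      rw [coeff_trunc, if_neg (by simpa using hn), map_zero, zero_mul]
  convert! this using 1
  refine Finset.sum_congr rfl fun n hn => ?_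
  rw [coeff_trunc, if_pos (by have := Finset.mem_range.1 hn; omega)]

end AbsSeries

namespace AuxData

open AbsSeries

variable {E : Type*} [NormedCommRing E] [NormedAlgebra ℝ E] [CompleteSpace E] [NormOneClass E]

/-- The coefficients of the solution of the auxiliary system that is a series in `e`. -/
theorem IsSol.coeff_zero {d : AuxData E} {p : ℝ} (hd : d.Small p) {P A : E →L[ℝ] E}
    (hA : ‖A‖ ≤ 1) {b : E} {u w : AbsSeries E} (hu : ‖u‖ ≤ 1 / 2) (hw : ‖w‖ ≤ 1 / 2)
    (h : d.IsSol (const E) (AbsSeries.map P) (AbsSeries.map A) (monomial 1 1) (const E b) u w) :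
    w.coeff 0 = 0 ∧ d.r • u.coeff 0 = d.r₀ • b := by
  -- The coefficient of order zero is the value at `e = 0`, where the solution is trivial.
  have h1 := h.map (by linarith) (by linarith) (eval (ContrHom.id E) 0) (P' := P) (A' := A)
    (fun x => by rw [eval_zero, eval_zero, coeff_map]; rfl)
    (fun x => by rw [eval_zero, eval_zero, coeff_map]; rfl)
  simp only [eval_zero, ContrHom.id_apply, const_apply, coeff_monomial] at h1
  exact h1.of_zero hd hA ((w.norm_coeff_le 0).trans hw)

theorem IsSol.coeff_succ {d : AuxData E} {P A : E →L[ℝ] E} {b : E} {u w : AbsSeries E}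
    (h : d.IsSol (const E) (AbsSeries.map P) (AbsSeries.map A) (monomial 1 1) (const E b) u w)
    (k : ℕ) :
    d.r • u.coeff (k + 1) = P ((d.phi (const E) (monomial 1 1) u w).coeff (k + 1)) +
      d.ω' • P (P ((d.gam (const E) (monomial 1 1) u w).coeff (k + 1))) ∧
    d.r' • w.coeff (k + 1) = P ((d.gam (const E) (monomial 1 1) u w).coeff (k + 1)) -
      d.ω'⁻¹ • A ((d.phi (const E) (monomial 1 1) u w).coeff (k + 1)) := by
  constructor
  · have := congrArg (fun a : AbsSeries E => a.coeff (k + 1)) h.angle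
    simpa [const_apply, coeff_monomial] using this
  · have := congrArg (fun a : AbsSeries E => a.coeff (k + 1)) h.action
    simpa using this

/-- The perturbation carries a factor `e`, so its coefficient of order `k + 1` sees only the orders
up to `k` of the arguments. This is why the recursion for the formal solution is well posed. -/
theorem gam_trunc_coeff (d : AuxData E) {u w : AbsSeries E} (hu : ‖u‖ ≤ 1) (hw : ‖w‖ ≤ 1)
    (k : ℕ) : (d.gam (const E) (monomial 1 1) (trunc k u) (trunc k w)).coeff (k + 1) =
      (d.gam (const E) (monomial 1 1) u w).coeff (k + 1) := by
  have hu' := (norm_trunc_le k u).trans hu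
  have hw' := (norm_trunc_le k w).trans hw
  have h1 := eval_sub_mem_vanish (φ := eval (const E) (trunc k u)) (ψ := eval (const E) u)
    (eval_sub_mem_vanish (fun d => by rw [sub_self]; exact zero_mem _) hu' hu
      (trunc_sub_mem_vanish k u)) hw' hw (trunc_sub_mem_vanish k w) d.G
  have h2 : (monomial 1 1 : AbsSeries E) ∈ vanish E 1 := fun i hi => by
    rw [coeff_monomial, if_neg (by omega)]
  have h3 := smul_mem_vanish d.ε₀ (mul_mem_vanish h2 h1) (k + 1) (by omega)
  rw [mul_sub, smul_sub, coeff_sub] at h3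
  exact sub_eq_zero.1 h3

/-- The part from `ω` has no factor `e`; instead it is quadratic in `w`, and `w` has no constant
term, which again gains one order. -/
theorem phi_trunc_coeff {d : AuxData E} {p : ℝ} (hd : d.Small p) {u w : AbsSeries E}
    (hu : ‖u‖ ≤ 1) (hw : ‖w‖ ≤ 1) (hw0 : w.coeff 0 = 0)
    (k : ℕ) : (d.phi (const E) (monomial 1 1) (trunc k u) (trunc k w)).coeff (k + 1) =
      (d.phi (const E) (monomial 1 1) u w).coeff (k + 1) := by
  have hu' := (norm_trunc_le k u).trans hu
  have hw' := (norm_trunc_le k w).trans hw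
  have h1 := eval_sub_mem_vanish (φ := eval (const E) (trunc k u)) (ψ := eval (const E) u)
    (eval_sub_mem_vanish (fun d => by rw [sub_self]; exact zero_mem _) hu' hu
      (trunc_sub_mem_vanish k u)) hw' hw (trunc_sub_mem_vanish k w) d.F
  have h2 : (monomial 1 1 : AbsSeries E) ∈ vanish E 1 := fun i hi => by
    rw [coeff_monomial, if_neg (by omega)]
  have h3 := smul_mem_vanish d.ε₀ (mul_mem_vanish h2 h1) (k + 1) (by omega)
  rw [mul_sub, smul_sub, coeff_sub] at h3
  have hv : w ∈ vanish E 1 := fun i hi => by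
    obtain rfl : i = 0 := by omega
    exact hw0
  have hv' : trunc k w ∈ vanish E 1 := fun i hi => by
    obtain rfl : i = 0 := by omega
    rw [coeff_trunc, hw0, ite_self]
  have h4 := eval_sub_mem_vanish_of_quadratic (ContrHom.ofReal (AbsSeries E)) hw' hw hv' hv
    (trunc_sub_mem_vanish k w) hd.O_mem (k + 1) (by omega)
  rw [coeff_sub] at h4
  rw [phi, phi, coeff_add, coeff_add, sub_eq_zero.1 h3, sub_eq_zero.1 h4]

end AuxData

/-! ### The formal solution is the Taylor expansion of the solution of the auxiliary system -/

namespace AuxData.Represents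

open AbsSeries

variable {S : PerturbedSystem} {o : ResonantOrbit} {N : ℝ} [Fact (0 < o.T)]
  {d : AuxData (PeriodicFun o.T)}

/-- The partial sum of a series with periodic coefficients, in the original parameter. -/
def partialSum (ε₀ c : ℝ) (u : AbsSeries (PeriodicFun o.T)) (k : ℕ) (ε t : ℝ) : ℝ :=
  c * ∑ m ∈ Finset.range (k + 1), (u.coeff m).toFun t * (ε / ε₀) ^ m

theorem partialSum_succ (ε₀ c : ℝ) (u : AbsSeries (PeriodicFun o.T)) (k : ℕ) (ε t : ℝ) :
    partialSum ε₀ c u (k + 1) ε t =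
      partialSum ε₀ c u k ε t + ε ^ (k + 1) * (c * (u.coeff (k + 1)).toFun t / ε₀ ^ (k + 1)) := by
  rw [partialSum, Finset.sum_range_succ, mul_add, partialSum, div_pow]
  ring

/-- For fixed `t`, evaluation at `ε / ε₀` exhibits the perturbation along the truncated solution as
a convergent power series in `ε`. By `gam_trunc_coeff` its coefficient of order `k + 1` is that of
the untruncated solution. -/
theorem taylorCoeff_gammaFun (hd : d.Represents N S) {u w : AbsSeries (PeriodicFun o.T)}
    (hu : ‖u‖ ≤ 1) (hw : ‖w‖ ≤ 1) (k : ℕ) (t : ℝ) :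
    taylorCoeff (k + 1) (S.gammaFun o (partialSum d.ε₀ d.r u k, partialSum d.ε₀ d.r' w k) t) =
      ((d.gam (const _) (monomial 1 1) u w).coeff (k + 1)).toFun t / d.ε₀ ^ (k + 1) := by
  have hε := hd.small.ε₀_pos
  have hu' := (norm_trunc_le k u).trans hu
  have hw' := (norm_trunc_le k w).trans hw
  rw [← d.gam_trunc_coeff hu hw]
  refine taylorCoeff_of_hasSum (c := fun m =>
    ((d.gam (const _) (monomial 1 1) (trunc k u) (trunc k w)).coeff m).toFun t / d.ε₀ ^ m)
    hε (fun ε hεε => ?_) (k + 1)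
  have hz : ‖ε / d.ε₀‖ ≤ 1 := by
    rw [Real.norm_eq_abs, abs_div, abs_of_pos hε, div_le_one hε]; exact hεε.le
  have h1 := hasSum_eval (PeriodicFun.evalAt t) hz
    (d.gam (const _) (monomial 1 1) (trunc k u) (trunc k w))
  rw [d.map_gam _ _ hu' hw', eval_comp_const _ hz, eval_monomial _ hz, map_one, pow_one, one_mul,
    hd.gam_real _ _ ((ContrHom.norm_le (eval (PeriodicFun.evalAt t) (ε / d.ε₀)) _).trans hu')
      ((ContrHom.norm_le (eval (PeriodicFun.evalAt t) (ε / d.ε₀)) _).trans hw'),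
    eval_trunc _ hz, eval_trunc _ hz] at h1
  convert! h1 using 1
  · funext m
    rw [div_pow, PeriodicFun.evalAt_apply]; ring
  · rw [mul_div_cancel₀ _ hε.ne']; rfl

theorem taylorCoeff_phiFun (hd : d.Represents N S) {u w : AbsSeries (PeriodicFun o.T)}
    (hu : ‖u‖ ≤ 1) (hw : ‖w‖ ≤ 1) (hw0 : w.coeff 0 = 0) (k : ℕ) (t : ℝ) :
    taylorCoeff (k + 1) (S.phiFun o (partialSum d.ε₀ d.r u k, partialSum d.ε₀ d.r' w k) t) =
      ((d.phi (const _) (monomial 1 1) u w).coeff (k + 1)).toFun t / d.ε₀ ^ (k + 1) := by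
  have hε := hd.small.ε₀_pos
  have hu' := (norm_trunc_le k u).trans hu
  have hw' := (norm_trunc_le k w).trans hw
  rw [← phi_trunc_coeff hd.small hu hw hw0]
  refine taylorCoeff_of_hasSum (c := fun m =>
    ((d.phi (const _) (monomial 1 1) (trunc k u) (trunc k w)).coeff m).toFun t / d.ε₀ ^ m)
    hε (fun ε hεε => ?_) (k + 1)
  have hz : ‖ε / d.ε₀‖ ≤ 1 := by
    rw [Real.norm_eq_abs, abs_div, abs_of_pos hε, div_le_one hε]; exact hεε.le
  have h1 := hasSum_eval (PeriodicFun.evalAt t) hz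
    (d.phi (const _) (monomial 1 1) (trunc k u) (trunc k w))
  rw [d.map_phi _ _ hu' hw', eval_comp_const _ hz, eval_monomial _ hz, map_one, pow_one, one_mul,
    hd.phi_real _ _ ((ContrHom.norm_le (eval (PeriodicFun.evalAt t) (ε / d.ε₀)) _).trans hu')
      ((ContrHom.norm_le (eval (PeriodicFun.evalAt t) (ε / d.ε₀)) _).trans hw'),
    eval_trunc _ hz, eval_trunc _ hz] at h1
  convert! h1 using 1
  · funext m
    rw [div_pow, PeriodicFun.evalAt_apply]; ring
  · rw [mul_div_cancel₀ _ hε.ne']; rfl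

/-- Comparing coefficients of order `k + 1` in the integral equations reproduces the recursion that
defines the formal solution, up to the scales and powers of `ε₀`. -/
theorem formalSolution_eq (hd : d.Represents N S) {b : ℝ} {u w : AbsSeries (PeriodicFun o.T)}
    (hu : ‖u‖ ≤ 1 / 2) (hw : ‖w‖ ≤ 1 / 2)
    (h : d.IsSol (const _) (AbsSeries.map PeriodicFun.prim) (AbsSeries.map PeriodicFun.avgConst)
      (monomial 1 1) (const _ (algebraMap ℝ _ b)) u w) (k : ℕ) :
    S.formalSolution o (d.r₀ * b) k = (partialSum d.ε₀ d.r u k, partialSum d.ε₀ d.r' w k) := by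
  have hε := hd.small.ε₀_pos
  obtain ⟨hw0, hu0⟩ := h.coeff_zero hd.small PeriodicFun.norm_avgConst_le hu hw
  induction k with
  | zero =>
    have hu0' : ∀ t, d.r * (u.coeff 0).toFun t = d.r₀ * b := fun t => by
      simpa using congrArg (fun f : PeriodicFun o.T => f.toFun t) hu0
    refine Prod.ext ?_ ?_
    · funext ε t
      simp [PerturbedSystem.formalSolution, partialSum, hu0']
    · funext ε t
      simp only [PerturbedSystem.formalSolution, partialSum, zero_add, Finset.range_one,
        Finset.sum_singleton, hw0, pow_zero, mul_one]
      exact (mul_zero _).symm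
  | succ k ih =>
    obtain ⟨h1, h2⟩ := h.coeff_succ k
    set Γ := (d.gam (const _) (monomial 1 1) u w).coeff (k + 1) with hΓ
    set Φ := (d.phi (const _) (monomial 1 1) u w).coeff (k + 1) with hΦ
    have hG : (fun t => taylorCoeff (k + 1) (S.gammaFun o (S.formalSolution o (d.r₀ * b) k) t)) =
        ((d.ε₀ ^ (k + 1))⁻¹ • Γ).toFun := by
      funext t
      rw [ih, hd.taylorCoeff_gammaFun (by linarith) (by linarith), PeriodicFun.toFun_smul,
        div_eq_inv_mul]
    have hP : (fun t => taylorCoeff (k + 1) (S.phiFun o (S.formalSolution o (d.r₀ * b) k) t)) =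
        ((d.ε₀ ^ (k + 1))⁻¹ • Φ).toFun := by
      funext t
      rw [ih, hd.taylorCoeff_phiFun (by linarith) (by linarith) hw0, PeriodicFun.toFun_smul,
        div_eq_inv_mul]
    have h1' : ∀ t, d.r * (u.coeff (k + 1)).toFun t = (PeriodicFun.prim Φ).toFun t +
        d.ω' * (PeriodicFun.prim (PeriodicFun.prim Γ)).toFun t := fun t => by
      simpa using congrArg (fun f : PeriodicFun o.T => f.toFun t) h1
    have h2' : ∀ t, d.r' * (w.coeff (k + 1)).toFun t = (PeriodicFun.prim Γ).toFun t -
        d.ω'⁻¹ * PeriodicFun.avg Φ := fun t => by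
      simpa [PeriodicFun.toFun_avgConst] using congrArg (fun f : PeriodicFun o.T => f.toFun t) h2
    simp only [PerturbedSystem.formalSolution, hG, hP, ← PeriodicFun.toFun_prim,
      ← PeriodicFun.avg_apply]
    refine Prod.ext ?_ ?_
    · funext ε t
      simp only [partialSum_succ, ih, h1', map_smul, PeriodicFun.toFun_smul, ← hd.ω'_eq]
      rw [div_eq_inv_mul]; ring
    · funext ε t
      simp only [partialSum_succ, ih, h2', map_smul, PeriodicFun.toFun_smul, ← hd.ω'_eq,
        smul_eq_mul]
      rw [div_eq_inv_mul, div_eq_inv_mul]; ring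

theorem taylorCoeff_formalSolution (hd : d.Represents N S) {b : ℝ}
    {u w : AbsSeries (PeriodicFun o.T)} (hu : ‖u‖ ≤ 1 / 2) (hw : ‖w‖ ≤ 1 / 2)
    (h : d.IsSol (const _) (AbsSeries.map PeriodicFun.prim) (AbsSeries.map PeriodicFun.avgConst)
      (monomial 1 1) (const _ (algebraMap ℝ _ b)) u w) (k : ℕ) :
    (fun t => taylorCoeff (k + 1) (S.gammaFun o (S.formalSolution o (d.r₀ * b) k) t)) =
      ((d.ε₀ ^ (k + 1))⁻¹ • (d.gam (const _) (monomial 1 1) u w).coeff (k + 1)).toFun ∧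
    (fun t => taylorCoeff (k + 1) (S.phiFun o (S.formalSolution o (d.r₀ * b) k) t)) =
      ((d.ε₀ ^ (k + 1))⁻¹ • (d.phi (const _) (monomial 1 1) u w).coeff (k + 1)).toFun := by
  obtain ⟨hw0, -⟩ := h.coeff_zero hd.small PeriodicFun.norm_avgConst_le hu hw
  rw [hd.formalSolution_eq hu hw h]
  constructor
  · funext t
    rw [hd.taylorCoeff_gammaFun (by linarith) (by linarith), PeriodicFun.toFun_smul,
      div_eq_inv_mul]
  · funext t
    rw [hd.taylorCoeff_phiFun (by linarith) (by linarith) hw0, PeriodicFun.toFun_smul,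
      div_eq_inv_mul]

theorem gammaMean_eq (hd : d.Represents N S) {b : ℝ}
    {u w : AbsSeries (PeriodicFun o.T)} (hu : ‖u‖ ≤ 1 / 2) (hw : ‖w‖ ≤ 1 / 2)
    (h : d.IsSol (const _) (AbsSeries.map PeriodicFun.prim) (AbsSeries.map PeriodicFun.avgConst)
      (monomial 1 1) (const _ (algebraMap ℝ _ b)) u w) (k : ℕ) :
    S.gammaMean o k (d.r₀ * b) = (d.ε₀ ^ (k + 1))⁻¹ *
      PeriodicFun.avg ((d.gam (const _) (monomial 1 1) u w).coeff (k + 1)) := by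
  rw [PerturbedSystem.gammaMean, (hd.taylorCoeff_formalSolution hu hw h k).1,
    ← PeriodicFun.avg_apply, map_smul, smul_eq_mul]

end AuxData.Represents
end

noncomputable section

open AbsSeries

/-! ### Shift of the average angle -/

theorem LocalBound.exists_isSol_series {S : PerturbedSystem} {o : ResonantOrbit} {N : ℝ}
    [Fact (0 < o.T)] {d : AuxData (PeriodicFun o.T)} (hd : d.Represents N S) {b : ℝ}
    (hb : |b| ≤ 1) : ∃ u w : AbsSeries (PeriodicFun o.T), ‖u‖ ≤ 1 / 2 ∧ ‖w‖ ≤ 1 / 2 ∧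
      d.IsSol (const _) (AbsSeries.map PeriodicFun.prim) (AbsSeries.map PeriodicFun.avgConst)
        (monomial 1 1) (const _ (algebraMap ℝ _ b)) u w := by
  refine hd.small.exists_isSol (const _) ((norm_map_le _).trans PeriodicFun.norm_prim_le)
    ((norm_map_le _).trans PeriodicFun.norm_avgConst_le) ?_ ?_
  · rw [norm_monomial, norm_one]
  · refine ((const _).norm_le _).trans ?_
    rw [norm_algebraMap']; exact hb

/-- The iterated derivatives in the recursion do not visibly depend continuously and periodically on
`t`; their identification with coefficients in the algebra of periodic functions shows it. -/
theorem LocalBound.exists_periodic_taylorCoeff {S : PerturbedSystem} {o : ResonantOrbit} {N : ℝ}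
    (h : LocalBound S o N) (k : ℕ) :
    (Continuous (fun t => taylorCoeff (k + 1) (S.gammaFun o (S.formalSolution o 0 k) t)) ∧
      Function.Periodic (fun t => taylorCoeff (k + 1) (S.gammaFun o (S.formalSolution o 0 k) t)) o.T) ∧
    (Continuous (fun t => taylorCoeff (k + 1) (S.phiFun o (S.formalSolution o 0 k) t)) ∧
      Function.Periodic (fun t => taylorCoeff (k + 1) (S.phiFun o (S.formalSolution o 0 k) t)) o.T) := by
  have : Fact (0 < o.T) := ⟨h.T_pos⟩
  obtain ⟨d, hd⟩ := h.exists_represents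
  obtain ⟨u, w, hu, hw, hs⟩ := exists_isSol_series hd (b := 0) (by simp)
  have := hd.taylorCoeff_formalSolution hu hw hs k
  rw [mul_zero] at this
  rw [this.1, this.2]
  exact ⟨⟨PeriodicFun.continuous_toFun _, PeriodicFun.periodic_toFun _⟩,
    ⟨PeriodicFun.continuous_toFun _, PeriodicFun.periodic_toFun _⟩⟩

/-- Translating time by `δ` advances the unperturbed angle by `β₀`, which absorbs the average angle;
the explicit time is kept fixed by lowering the phase by `δ`. -/
theorem PerturbedSystem.gammaFun_shift (S : PerturbedSystem) (o : ResonantOrbit) {β₀ δ : ℝ}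
    (hδ : o.α₀ δ = β₀) {x x' : (ℝ → ℝ → ℝ) × (ℝ → ℝ → ℝ)} {t : ℝ}
    (h1 : ∀ ε, x.1 ε t = β₀ + x'.1 ε (t + δ)) (h2 : ∀ ε, x.2 ε t = x'.2 ε (t + δ)) :
    S.gammaFun o x t = S.gammaFun (o.withPhase (o.t₀ - δ)) x' (t + δ) ∧
      S.phiFun o x t = S.phiFun (o.withPhase (o.t₀ - δ)) x' (t + δ) := by
  have h3 : ∀ ε, o.α₀ t + x.1 ε t = (o.withPhase (o.t₀ - δ)).α₀ (t + δ) + x'.1 ε (t + δ) := by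
    intro ε
    have : (o.withPhase (o.t₀ - δ)).α₀ (t + δ) = o.α₀ t + o.α₀ δ := mul_add _ _ _
    rw [this, hδ, h1, add_assoc]
  have h4 : t + o.t₀ = t + δ + (o.withPhase (o.t₀ - δ)).t₀ := by
    change _ = t + δ + (o.t₀ - δ); ring
  constructor
  · funext ε
    rw [PerturbedSystem.gammaFun, PerturbedSystem.gammaFun, h3, h2, h4]; rfl
  · funext ε
    rw [PerturbedSystem.phiFun, PerturbedSystem.phiFun, h3, h2, h4]; rfl

theorem LocalBound.formalSolution_shift {S : PerturbedSystem} {o : ResonantOrbit} {N : ℝ}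
    (h : LocalBound S o N) {β₀ δ : ℝ} (hδ : o.α₀ δ = β₀) (k : ℕ) :
    (∀ ε t, (S.formalSolution o β₀ k).1 ε t =
      β₀ + (S.formalSolution (o.withPhase (o.t₀ - δ)) 0 k).1 ε (t + δ)) ∧
    (∀ ε t, (S.formalSolution o β₀ k).2 ε t =
      (S.formalSolution (o.withPhase (o.t₀ - δ)) 0 k).2 ε (t + δ)) := by
  induction k with
  | zero => exact ⟨fun ε t => (add_zero β₀).symm, fun ε t => rfl⟩
  | succ k ih =>
    obtain ⟨⟨hGc, hGp⟩, hFc, hFp⟩ := (h.withPhase (o.t₀ - δ)).exists_periodic_taylorCoeff k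
    set o' := o.withPhase (o.t₀ - δ) with ho'
    set Γ := fun t => taylorCoeff (k + 1) (S.gammaFun o' (S.formalSolution o' 0 k) t) with hΓ
    set Φ := fun t => taylorCoeff (k + 1) (S.phiFun o' (S.formalSolution o' 0 k) t) with hΦ
    have hT := h.T_pos
    have hG : (fun t => taylorCoeff (k + 1) (S.gammaFun o (S.formalSolution o β₀ k) t)) =
        fun t => Γ (t + δ) := by
      funext t
      rw [(S.gammaFun_shift o hδ (fun ε => ih.1 ε t) (fun ε => ih.2 ε t)).1]
    have hF : (fun t => taylorCoeff (k + 1) (S.phiFun o (S.formalSolution o β₀ k) t)) =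
        fun t => Φ (t + δ) := by
      funext t
      rw [(S.gammaFun_shift o hδ (fun ε => ih.1 ε t) (fun ε => ih.2 ε t)).2]
    have e1 := zeroMeanPrimitive_comp_add hT hGc hGp δ
    have e2 := zeroMeanPrimitive_comp_add hT hFc hFp δ
    have e3 := zeroMeanPrimitive_comp_add hT (continuous_zeroMeanPrimitive (T := o.T) hGc)
      (periodic_zeroMeanPrimitive hT hGc hGp) δ
    have e4 := average_comp_add hFp δ
    change average o.T _ = average o.T _ at e4
    constructor
    · intro ε t
      change (S.formalSolution o β₀ k).1 ε t + ε ^ (k + 1) * (zeroMeanPrimitive o.T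
        (fun t => taylorCoeff (k + 1) (S.phiFun o (S.formalSolution o β₀ k) t)) t +
        deriv S.ω o.A₀ * zeroMeanPrimitive o.T (zeroMeanPrimitive o.T
          (fun t => taylorCoeff (k + 1) (S.gammaFun o (S.formalSolution o β₀ k) t))) t) =
        β₀ + ((S.formalSolution o' 0 k).1 ε (t + δ) + ε ^ (k + 1) *
          (zeroMeanPrimitive o.T Φ (t + δ) +
            deriv S.ω o.A₀ * zeroMeanPrimitive o.T (zeroMeanPrimitive o.T Γ) (t + δ)))
      rw [hG, hF, e1, e2, e3, ih.1, add_assoc]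
    · intro ε t
      change (S.formalSolution o β₀ k).2 ε t + ε ^ (k + 1) * (zeroMeanPrimitive o.T
        (fun t => taylorCoeff (k + 1) (S.gammaFun o (S.formalSolution o β₀ k) t)) t -
          average o.T (fun t => taylorCoeff (k + 1) (S.phiFun o (S.formalSolution o β₀ k) t)) /
            deriv S.ω o.A₀) =
        (S.formalSolution o' 0 k).2 ε (t + δ) + ε ^ (k + 1) *
          (zeroMeanPrimitive o.T Γ (t + δ) - average o.T Φ / deriv S.ω o.A₀)
      rw [hG, hF, e1, e4, ih.2]

/-- A shift of the average angle amounts to a shift of the initial phase. -/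
theorem LocalBound.gammaMean_eq_melnikov {S : PerturbedSystem} {o : ResonantOrbit} {N : ℝ}
    (h : LocalBound S o N) {β₀ δ : ℝ} (hδ : o.α₀ δ = β₀) (k : ℕ) :
    S.gammaMean o k β₀ = S.melnikov o k (o.t₀ - δ) := by
  obtain ⟨⟨hGc, hGp⟩, -⟩ := (h.withPhase (o.t₀ - δ)).exists_periodic_taylorCoeff k
  have ih := h.formalSolution_shift hδ k
  refine Eq.trans ?_ (average_comp_add hGp δ)
  rw [PerturbedSystem.gammaMean]
  congr 1
  funext t
  rw [(S.gammaFun_shift o hδ (fun ε => ih.1 ε t) (fun ε => ih.2 ε t)).1]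

/-! ### The solution as a double series -/

section Universal

variable {S : PerturbedSystem} {o : ResonantOrbit} {N : ℝ} [Fact (0 < o.T)]
  {d : AuxData (PeriodicFun o.T)}

/-- The embedding of constants into double series. -/
def const₂ (E : Type*) [NormedCommRing E] [NormedAlgebra ℝ E] [CompleteSpace E] :
    ContrHom E (AbsSeries (AbsSeries E)) := (const _).comp (const E)

/-- Evaluation of a double series at real parameters. -/
def evalReal (e b : ℝ) : ContrHom (AbsSeries (AbsSeries (PeriodicFun o.T))) (PeriodicFun o.T) :=
  eval (eval (ContrHom.id _) (algebraMap ℝ _ b)) (algebraMap ℝ _ e)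

/-- Evaluation of the inner variable of a double series at a real number. -/
def evalInner (b : ℝ) :
    ContrHom (AbsSeries (AbsSeries (PeriodicFun o.T))) (AbsSeries (PeriodicFun o.T)) :=
  eval ((const _).comp (eval (ContrHom.id _) (algebraMap ℝ _ b))) (monomial 1 1)

theorem norm_algebraMap_le {b : ℝ} (hb : |b| ≤ 1) : ‖algebraMap ℝ (PeriodicFun o.T) b‖ ≤ 1 := by
  rw [norm_algebraMap']; exact hb

/-- Solutions of the auxiliary system which are double series in the perturbation parameter (outer
variable) and the average angle (inner variable). -/
abbrev IsUniversalSol (d : AuxData (PeriodicFun o.T))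
    (U W : AbsSeries (AbsSeries (PeriodicFun o.T))) : Prop :=
  d.IsSol (const₂ _) (AbsSeries.map (AbsSeries.map PeriodicFun.prim))
    (AbsSeries.map (AbsSeries.map PeriodicFun.avgConst)) (monomial 1 1) (const _ (monomial 1 1)) U W

theorem exists_isUniversalSol (hd : d.Represents N S) :
    ∃ U W, ‖U‖ ≤ 1 / 2 ∧ ‖W‖ ≤ 1 / 2 ∧ IsUniversalSol d U W := by
  refine hd.small.exists_isSol (const₂ _)
    ((norm_map_le _).trans ((norm_map_le _).trans PeriodicFun.norm_prim_le))
    ((norm_map_le _).trans ((norm_map_le _).trans PeriodicFun.norm_avgConst_le)) ?_ ?_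
  · rw [norm_monomial, norm_one]
  · refine ((const _).norm_le _).trans ?_
    rw [norm_monomial, norm_one]

theorem comp_const₂_evalReal {e b : ℝ} (he : |e| ≤ 1) (hb : |b| ≤ 1) :
    (evalReal e b).comp (const₂ (PeriodicFun o.T)) = ContrHom.id _ := by
  ext x
  simp only [evalReal, const₂, ContrHom.comp_apply]
  rw [eval_const _ (norm_algebraMap_le he), eval_const _ (norm_algebraMap_le hb)]

theorem evalReal_map {e b : ℝ} (he : |e| ≤ 1) (hb : |b| ≤ 1)
    (Z : PeriodicFun o.T →L[ℝ] PeriodicFun o.T) (x : AbsSeries (AbsSeries (PeriodicFun o.T))) :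
    evalReal e b (AbsSeries.map (AbsSeries.map Z) x) = Z (evalReal e b x) :=
  map_eval_algebraMap _ _ _ Z (fun y => map_eval_algebraMap _ _ _ _ (fun _ => rfl) hb y) he x

theorem IsUniversalSol.evalReal {U W : AbsSeries (AbsSeries (PeriodicFun o.T))}
    (h : IsUniversalSol d U W) (hU : ‖U‖ ≤ 1 / 2) (hW : ‖W‖ ≤ 1 / 2) {e b : ℝ} (he : |e| ≤ 1)
    (hb : |b| ≤ 1) :
    d.IsSol (ContrHom.id _) PeriodicFun.prim PeriodicFun.avgConst (algebraMap ℝ _ e)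
      (algebraMap ℝ _ b) (evalReal e b U) (evalReal e b W) := by
  have h1 := h.map (by linarith) (by linarith) (_root_.evalReal e b) (evalReal_map he hb _)
    (evalReal_map he hb _)
  rw [comp_const₂_evalReal he hb] at h1
  have h2 : _root_.evalReal (o := o) e b (monomial 1 1) = algebraMap ℝ _ e := by
    rw [_root_.evalReal, eval_monomial _ (norm_algebraMap_le he), map_one, one_mul, pow_one]
  have h3 : _root_.evalReal (o := o) e b (const _ (monomial 1 1)) = algebraMap ℝ _ b := by
    rw [_root_.evalReal, eval_const _ (norm_algebraMap_le he),
      eval_monomial _ (norm_algebraMap_le hb), map_one, one_mul, pow_one]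
  rwa [h2, h3] at h1

theorem IsUniversalSol.evalInner {U W : AbsSeries (AbsSeries (PeriodicFun o.T))}
    (h : IsUniversalSol d U W) (hU : ‖U‖ ≤ 1 / 2) (hW : ‖W‖ ≤ 1 / 2) {b : ℝ} (hb : |b| ≤ 1) :
    d.IsSol (const _) (AbsSeries.map PeriodicFun.prim) (AbsSeries.map PeriodicFun.avgConst)
      (monomial 1 1) (const _ (algebraMap ℝ _ b)) (evalInner b U) (evalInner b W) := by
  have hm : ‖(monomial 1 1 : AbsSeries (PeriodicFun o.T))‖ ≤ 1 := by rw [norm_monomial, norm_one]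
  have hmap : ∀ (Z : PeriodicFun o.T →L[ℝ] PeriodicFun o.T) x,
      _root_.evalInner (o := o) b (AbsSeries.map (AbsSeries.map Z) x) =
        AbsSeries.map Z (_root_.evalInner b x) := fun Z x =>
    map_eval_monomial _ _ _ _ (fun y => map_eval_algebraMap _ _ _ _ (fun _ => rfl) hb y) x
  have h1 := h.map (by linarith) (by linarith) (_root_.evalInner b) (hmap _) (hmap _)
  have h0 : (_root_.evalInner b).comp (const₂ (PeriodicFun o.T)) = const _ := by
    ext x
    simp only [_root_.evalInner, const₂, ContrHom.comp_apply]
    rw [eval_const _ hm, ContrHom.comp_apply, eval_const _ (norm_algebraMap_le hb)]; rfl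
  have h2 : _root_.evalInner (o := o) b (monomial 1 1) = monomial 1 1 := by
    rw [_root_.evalInner, eval_monomial _ hm, map_one, one_mul, pow_one]
  have h3 : _root_.evalInner (o := o) b (const _ (monomial 1 1)) = const _ (algebraMap ℝ _ b) := by
    rw [_root_.evalInner, eval_const _ hm, ContrHom.comp_apply,
      eval_monomial _ (norm_algebraMap_le hb), map_one, one_mul, pow_one]
  rwa [h0, h2, h3] at h1

/-- The mean of the perturbation in the action equation as a double series. -/
def meanSeries (d : AuxData (PeriodicFun o.T)) (U W : AbsSeries (AbsSeries (PeriodicFun o.T))) :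
    AbsSeries (AbsSeries ℝ) :=
  AbsSeries.map (AbsSeries.map PeriodicFun.avg) (d.gam (const₂ _) (monomial 1 1) U W)

theorem norm_meanSeries_le (hd : d.Represents N S) (U W : AbsSeries (AbsSeries (PeriodicFun o.T))) :
    ‖meanSeries d U W‖ ≤ 1 := by
  have h1 : ‖d.gam (const₂ _) (monomial 1 1) U W‖ ≤ 1 :=
    (d.norm_gam_le _ hd.small.ε₀_pos.le (by rw [norm_monomial, norm_one]) _ _).trans hd.norm_G_le
  have h2 : ‖AbsSeries.map (AbsSeries.map (PeriodicFun.avg (T := o.T)))‖ ≤ 1 :=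
    (norm_map_le _).trans ((norm_map_le _).trans PeriodicFun.norm_avg_le)
  refine (ContinuousLinearMap.le_opNorm _ _).trans ?_
  exact mul_le_one₀ h2 (norm_nonneg _) h1

theorem abs_meanSeries_coeff_le (hd : d.Represents N S)
    (U W : AbsSeries (AbsSeries (PeriodicFun o.T))) (k j : ℕ) :
    |((meanSeries d U W).coeff k).coeff j| ≤ 1 :=
  ((norm_coeff_le _ j).trans (norm_coeff_le _ k)).trans (norm_meanSeries_le hd U W)

theorem meanSeries_coeff_zero (d : AuxData (PeriodicFun o.T))
    (U W : AbsSeries (AbsSeries (PeriodicFun o.T))) : (meanSeries d U W).coeff 0 = 0 := by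
  rw [meanSeries, coeff_map, AuxData.gam, mul_comm, coeff_smul, coeff_mul_monomial, if_neg (by omega),
    smul_zero, map_zero]

theorem avg_eval (b : ℝ) (hb : |b| ≤ 1) (y : AbsSeries (PeriodicFun o.T)) :
    eval (ContrHom.id ℝ) b (AbsSeries.map PeriodicFun.avg y) =
      PeriodicFun.avg (eval (ContrHom.id _) (algebraMap ℝ (PeriodicFun o.T) b) y) :=
  map_eval_algebraMap (E := PeriodicFun o.T) (B := PeriodicFun o.T) (E' := ℝ) (B' := ℝ)
    (ContrHom.id _) (ContrHom.id ℝ) PeriodicFun.avg PeriodicFun.avg (fun _ => rfl) hb y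

theorem avg_evalReal {e b : ℝ} (he : |e| ≤ 1) (hb : |b| ≤ 1)
    (y : AbsSeries (AbsSeries (PeriodicFun o.T))) :
    eval (eval (ContrHom.id ℝ) b) e (AbsSeries.map (AbsSeries.map PeriodicFun.avg) y) =
      PeriodicFun.avg (evalReal e b y) :=
  map_eval_algebraMap (E := AbsSeries (PeriodicFun o.T)) (B := PeriodicFun o.T)
    (E' := AbsSeries ℝ) (B' := ℝ) (eval (ContrHom.id _) (algebraMap ℝ _ b))
    (eval (ContrHom.id ℝ) b) (AbsSeries.map PeriodicFun.avg) PeriodicFun.avg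
    (fun y => avg_eval b hb y) he y

theorem evalReal_zero (x : AbsSeries (AbsSeries (PeriodicFun o.T))) :
    evalReal 0 0 x = (x.coeff 0).coeff 0 := by
  have h0 : algebraMap ℝ (PeriodicFun o.T) 0 = 0 := map_zero (algebraMap ℝ (PeriodicFun o.T))
  rw [evalReal, h0, AbsSeries.eval_zero, AbsSeries.eval_zero]; rfl

theorem avg_gam_eq {U W : AbsSeries (AbsSeries (PeriodicFun o.T))} (hU : ‖U‖ ≤ 1 / 2)
    (hW : ‖W‖ ≤ 1 / 2) {e b : ℝ} (he : |e| ≤ 1) (hb : |b| ≤ 1) :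
    PeriodicFun.avg (d.gam (ContrHom.id _) (algebraMap ℝ _ e) (evalReal e b U) (evalReal e b W)) =
      eval (eval (ContrHom.id ℝ) b) e (meanSeries d U W) := by
  have h2 : evalReal (o := o) e b (monomial 1 1) = algebraMap ℝ _ e := by
    rw [evalReal, eval_monomial _ (norm_algebraMap_le he), map_one, one_mul, pow_one]
  rw [← comp_const₂_evalReal he hb, ← h2, ← d.map_gam (const₂ _) (evalReal e b) (by linarith)
    (by linarith)]
  exact (avg_evalReal he hb _).symm

/-- Evaluating only the inner variable keeps a series in the perturbation parameter, at a fixed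
average angle; this is the kind of solution whose coefficients are the formal ones. -/
theorem IsUniversalSol.gammaMean_eq (hd : d.Represents N S)
    {U W : AbsSeries (AbsSeries (PeriodicFun o.T))}
    (h : IsUniversalSol d U W) (hU : ‖U‖ ≤ 1 / 2) (hW : ‖W‖ ≤ 1 / 2) {b : ℝ} (hb : |b| ≤ 1)
    (k : ℕ) : S.gammaMean o k (d.r₀ * b) = (d.ε₀ ^ (k + 1))⁻¹ *
      eval (ContrHom.id ℝ) b ((meanSeries d U W).coeff (k + 1)) := by
  have hm : ‖(monomial 1 1 : AbsSeries (PeriodicFun o.T))‖ ≤ 1 := by rw [norm_monomial, norm_one]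
  have h1 := h.evalInner hU hW hb
  rw [hd.gammaMean_eq ((ContrHom.norm_le _ _).trans hU) ((ContrHom.norm_le _ _).trans hW) h1]
  congr 1
  have h0 : (_root_.evalInner b).comp (const₂ (PeriodicFun o.T)) = const _ := by
    ext x
    simp only [_root_.evalInner, const₂, ContrHom.comp_apply]
    rw [eval_const _ hm, ContrHom.comp_apply, eval_const _ (norm_algebraMap_le hb)]; rfl
  have h2 : _root_.evalInner (o := o) b (monomial 1 1) = monomial 1 1 := by
    rw [_root_.evalInner, eval_monomial _ hm, map_one, one_mul, pow_one]
  have h3 := d.map_gam (const₂ _) (_root_.evalInner b) (e := monomial 1 1) (u := U) (w := W)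
    (by linarith) (by linarith)
  rw [h0, h2] at h3
  rw [← h3, _root_.evalInner, coeff_eval_monomial_one, meanSeries, coeff_map]
  exact (avg_eval b hb _).symm

theorem AuxData.Represents.eq_zero_of_isSol (hd : d.Represents N S) {u w : PeriodicFun o.T}
    (hw : ‖w‖ ≤ 1 / 2)
    (h : d.IsSol (ContrHom.id _) PeriodicFun.prim PeriodicFun.avgConst 0 0 u w) :
    u = 0 ∧ w = 0 := by
  obtain ⟨h3, h4⟩ := AuxData.IsSol.of_zero (B := PeriodicFun o.T) (A := PeriodicFun.avgConst)
    (P := PeriodicFun.prim) (φ := ContrHom.id _) hd.small PeriodicFun.norm_avgConst_le hw h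
  refine ⟨?_, h3⟩
  rw [← inv_smul_smul₀ hd.small.r_pos.ne' u, h4, smul_zero, smul_zero]

theorem IsUniversalSol.isSol_coeff_zero
    {U W : AbsSeries (AbsSeries (PeriodicFun o.T))}
    (h : IsUniversalSol d U W) (hU : ‖U‖ ≤ 1 / 2) (hW : ‖W‖ ≤ 1 / 2) :
    d.IsSol (ContrHom.id _) PeriodicFun.prim PeriodicFun.avgConst 0 0 ((U.coeff 0).coeff 0)
      ((W.coeff 0).coeff 0) := by
  have hz : |(0 : ℝ)| ≤ 1 := by rw [abs_zero]; exact zero_le_one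
  have h1 := h.evalReal hU hW hz hz
  have h0 : algebraMap ℝ (PeriodicFun o.T) 0 = 0 := map_zero (algebraMap ℝ (PeriodicFun o.T))
  rw [h0] at h1
  rw [← evalReal_zero U, ← evalReal_zero W]
  exact h1

theorem IsUniversalSol.coeff_zero (hd : d.Represents N S)
    {U W : AbsSeries (AbsSeries (PeriodicFun o.T))}
    (h : IsUniversalSol d U W) (hU : ‖U‖ ≤ 1 / 2) (hW : ‖W‖ ≤ 1 / 2) :
    (U.coeff 0).coeff 0 = 0 ∧ (W.coeff 0).coeff 0 = 0 :=
  hd.eq_zero_of_isSol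
    ((norm_coeff_le (W.coeff 0) 0).trans ((norm_coeff_le W 0).trans hW))
    (h.isSol_coeff_zero hU hW)

theorem eq_zero_of_eval_eq_zero {a : AbsSeries ℝ}
    (h : ∀ b : ℝ, |b| ≤ 1 → eval (ContrHom.id ℝ) b a = 0) : a = 0 := by
  refine AbsSeries.ext fun n => ?_
  have h1 := taylorCoeff_of_hasSum (f := fun _ => 0) (c := fun n => a.coeff n) one_pos
    (fun x hx => by
      have := hasSum_eval (ContrHom.id ℝ) (x := x) hx.le a
      rwa [h x hx.le] at this) n
  rw [← h1, coeff_zero, taylorCoeff]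
  simp

end Universal
end

noncomputable section

open AbsSeries

/-! ### The bifurcation equation -/

section Bifurcation

variable {S : PerturbedSystem} {o : ResonantOrbit} {N : ℝ} [Fact (0 < o.T)]
  {d : AuxData (PeriodicFun o.T)} {U W : AbsSeries (AbsSeries (PeriodicFun o.T))}

/-- Undoes the rescalings `ε = ε₀ e` and `β₀ = r₀ b`. The coefficients of `𝓕`, given as derivatives
of formal averages, become those of a convergent double series. -/
theorem IsUniversalSol.taylorCoeff_gammaMean (hd : d.Represents N S)
    (h : IsUniversalSol d U W) (hU : ‖U‖ ≤ 1 / 2) (hW : ‖W‖ ≤ 1 / 2) (k j : ℕ) :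
    taylorCoeff j (S.gammaMean o k) =
      ((meanSeries d U W).coeff (k + 1)).coeff j / (d.ε₀ ^ (k + 1) * d.r₀ ^ j) := by
  have hr := hd.small.r₀_pos
  refine taylorCoeff_of_hasSum (c := fun j =>
    ((meanSeries d U W).coeff (k + 1)).coeff j / (d.ε₀ ^ (k + 1) * d.r₀ ^ j)) hr
    (fun x hx => ?_) j
  have hx' : |x / d.r₀| ≤ 1 := by rw [abs_div, abs_of_pos hr, div_le_one hr]; exact hx.le
  have h1 := h.gammaMean_eq hd hU hW hx' k
  rw [mul_div_cancel₀ _ hr.ne'] at h1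
  rw [h1]
  have h2 := (hasSum_eval (ContrHom.id ℝ) (x := x / d.r₀) hx'
    ((meanSeries d U W).coeff (k + 1))).mul_left (d.ε₀ ^ (k + 1))⁻¹
  convert! h2 using 1
  funext j
  rw [ContrHom.id_apply, div_pow]
  field_simp

theorem IsUniversalSol.abs_bifurcationSeries_le (hd : d.Represents N S)
    (h : IsUniversalSol d U W) (hU : ‖U‖ ≤ 1 / 2) (hW : ‖W‖ ≤ 1 / 2) (hN : 1 ≤ N) (κ k j : ℕ) :
    |S.bifurcationSeries o κ k j| ≤ (2 ^ 18 * N ^ 6) ^ (k + κ + 1 + j) := by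
  have hr := hd.small.r₀_pos
  have hε := hd.small.ε₀_pos
  have h1 : (d.r₀)⁻¹ ≤ 2 ^ 18 * N ^ 6 := by
    rw [hd.r₀_eq, one_div, inv_inv]
    have : N ≤ N ^ 6 := le_self_pow₀ hN (by norm_num)
    linarith
  have h2 : (d.ε₀)⁻¹ = 2 ^ 18 * N ^ 6 := by rw [hd.ε₀_eq, one_div, inv_inv]
  rw [PerturbedSystem.bifurcationSeries, h.taylorCoeff_gammaMean hd hU hW, abs_div,
    abs_of_pos (by positivity : 0 < d.ε₀ ^ (k + κ + 1) * d.r₀ ^ j), div_eq_mul_inv, mul_inv,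
    ← inv_pow, ← inv_pow, pow_add _ _ j]
  calc _ ≤ 1 * ((d.ε₀)⁻¹ ^ (k + κ + 1) * (d.r₀)⁻¹ ^ j) := by
        gcongr; exact abs_meanSeries_coeff_le hd U W _ _
    _ ≤ _ := by
        rw [one_mul, h2]
        gcongr

/-- As `p ≠ 0`, each average angle is `α₀ δ` for some `δ`, so the mean at this angle is a value of a
Melnikov function. Vanishing at all phases gives vanishing at all small angles, hence of every
coefficient. Order zero vanishes because of the factor `e`. -/
theorem IsUniversalSol.meanSeries_coeff_eq_zero (hb : LocalBound S o N) (hd : d.Represents N S)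
    (h : IsUniversalSol d U W) (hU : ‖U‖ ≤ 1 / 2) (hW : ‖W‖ ≤ 1 / 2) (hp : o.p ≠ 0) {κ : ℕ}
    (hκ : ∀ k < κ, ∀ t : ℝ, S.melnikov o k t = 0) {k : ℕ} (hk : k < κ + 1) :
    (meanSeries d U W).coeff k = 0 := by
  rcases k with _ | k
  · exact meanSeries_coeff_zero d U W
  · refine eq_zero_of_eval_eq_zero fun b hb1 => ?_
    have h1 := h.gammaMean_eq hd hU hW hb1 k
    have hq : (o.q : ℝ) ≠ 0 := by exact_mod_cast hb.q_pos.ne'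
    have hp' : (o.p : ℝ) ≠ 0 := by exact_mod_cast hp
    have h2 : o.α₀ (d.r₀ * b * o.q / o.p) = d.r₀ * b := by
      rw [ResonantOrbit.α₀]; field_simp
    rw [hb.gammaMean_eq_melnikov h2, hκ k (by omega)] at h1
    have hε := hd.small.ε₀_pos
    exact (mul_eq_zero.1 h1.symm).resolve_left (by positivity)

/-- Zeros of the bifurcation series give zeros of the mean of the perturbation. -/
theorem IsUniversalSol.avg_gam_eq_zero (hb : LocalBound S o N) (hd : d.Represents N S)
    (h : IsUniversalSol d U W) (hU : ‖U‖ ≤ 1 / 2) (hW : ‖W‖ ≤ 1 / 2) (hp : o.p ≠ 0) {κ : ℕ}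
    (hκ : ∀ k < κ, ∀ t : ℝ, S.melnikov o k t = 0) {e b : ℝ} (he : |e| ≤ 1) (hb1 : |b| ≤ 1)
    (h0 : HasSum (fun v : ℕ × ℕ => S.bifurcationSeries o κ v.1 v.2 * (d.ε₀ * e) ^ v.1 *
      (d.r₀ * b) ^ v.2) 0) :
    PeriodicFun.avg (d.gam (ContrHom.id _) (algebraMap ℝ _ e) (_root_.evalReal e b U)
      (_root_.evalReal e b W)) = 0 := by
  rw [avg_gam_eq hU hW he hb1]
  refine eval_eval_eq_of_hasSum _ hb1 he _ ?_
  have hr := hd.small.r₀_pos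
  have hε := hd.small.ε₀_pos
  -- The series of the mean is `𝓕` moved by `κ + 1` orders in the parameter; the orders skipped by
  -- this injection have been shown to vanish.
  have hinj : Function.Injective fun v : ℕ × ℕ => (v.1 + (κ + 1), v.2) := by
    rintro ⟨a, b⟩ ⟨a', b'⟩ hh
    simp only [Prod.mk.injEq, add_left_inj] at hh
    exact Prod.ext hh.1 hh.2
  rw [← hinj.hasSum_iff]
  · have h1 := h0.mul_left (d.ε₀ ^ (κ + 1) * e ^ (κ + 1))
    rw [mul_zero] at h1
    convert! h1 using 1
    funext v
    rw [PerturbedSystem.bifurcationSeries, h.taylorCoeff_gammaMean hd hU hW]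
    simp only [Function.comp_apply, ContrHom.id_apply, mul_pow]
    rw [show v.1 + (κ + 1) = v.1 + κ + 1 by ring]
    field_simp
    rw [pow_add, pow_add, pow_one]
    ring
  · rintro ⟨k, j⟩ hv
    have hk : k < κ + 1 := by
      by_contra hk
      exact hv ⟨(k - (κ + 1), j), Prod.ext (by simp only; omega) rfl⟩
    rw [h.meanSeries_coeff_eq_zero hb hd hU hW hp hκ hk, AbsSeries.coeff_zero, map_zero, zero_mul, zero_mul]

end Bifurcation

theorem iteratedDeriv_comp_affine (f : ℝ → ℝ) (a c : ℝ) (j : ℕ) :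
    iteratedDeriv j (fun x => f (a + c * x)) = fun x => c ^ j * iteratedDeriv j f (a + c * x) := by
  induction j with
  | zero => simp
  | succ j ih =>
    funext x
    rw [iteratedDeriv_succ, ih, deriv_const_mul_field, iteratedDeriv_succ]
    have := deriv_comp_mul_left c (fun y => iteratedDeriv j f (a + y)) x
    rw [this, deriv_comp_const_add, smul_eq_mul, pow_succ, mul_assoc]

/-- At `ε = 0` the bifurcation function is `M_κ (t₀ - (q / p) β₀)`, so its order at `β₀ = 0` is the
order of the zero `t₀`. -/
theorem LocalBound.bifurcationSeries_zero {S : PerturbedSystem} {o : ResonantOrbit} {N : ℝ}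
    (h : LocalBound S o N) (hp : o.p ≠ 0) (κ j : ℕ) :
    S.bifurcationSeries o κ 0 j =
      (-(o.q / o.p : ℝ)) ^ j * iteratedDeriv j (S.melnikov o κ) o.t₀ / j.factorial := by
  have hq : (o.q : ℝ) ≠ 0 := by exact_mod_cast h.q_pos.ne'
  have hp' : (o.p : ℝ) ≠ 0 := by exact_mod_cast hp
  have h1 : S.gammaMean o (0 + κ) = fun β => S.melnikov o κ (o.t₀ + -(o.q / o.p : ℝ) * β) := by
    funext β
    have h2 : o.α₀ (β * o.q / o.p) = β := by
      rw [ResonantOrbit.α₀]; field_simp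
    rw [h.gammaMean_eq_melnikov h2, zero_add]
    congr 1; ring
  rw [PerturbedSystem.bifurcationSeries, taylorCoeff, h1, iteratedDeriv_comp_affine]
  simp only [mul_zero, add_zero]

end

noncomputable section

open Polynomial

/-! ### Double power series with geometric bounds -/

/-- The coefficients of a double series are bounded geometrically. -/
def GeomBound (a : ℕ → ℕ → ℝ) (R : ℝ) : Prop := ∀ k j, |a k j| ≤ R ^ (k + j + 1)

/-- The double series with coefficients `a` sums to `z` at `(x, y)`. -/
def SumsTo (a : ℕ → ℕ → ℝ) (x y z : ℝ) : Prop :=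
  HasSum (fun v : ℕ × ℕ => a v.1 v.2 * x ^ v.1 * y ^ v.2) z

theorem GeomBound.summable {a : ℕ → ℕ → ℝ} {R : ℝ} (h : GeomBound a R) (hR : 0 ≤ R) {x y : ℝ}
    (hx : 2 * R * |x| ≤ 1) (hy : 2 * R * |y| ≤ 1) :
    Summable fun v : ℕ × ℕ => a v.1 v.2 * x ^ v.1 * y ^ v.2 := by
  have hs : Summable fun n : ℕ => (1 / 2 : ℝ) ^ n := summable_geometric_two
  refine Summable.of_norm_bounded ((hs.mul_of_nonneg hs (fun _ => by positivity)
    (fun _ => by positivity)).mul_left R) fun v => ?_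
  rw [Real.norm_eq_abs, abs_mul, abs_mul, abs_pow, abs_pow]
  calc _ ≤ R ^ (v.1 + v.2 + 1) * |x| ^ v.1 * |y| ^ v.2 := by gcongr; exact h _ _
    _ = R * ((R * |x|) ^ v.1 * (R * |y|) ^ v.2) := by rw [mul_pow, mul_pow]; ring
    _ ≤ R * ((1 / 2) ^ v.1 * (1 / 2) ^ v.2) := by gcongr <;> linarith

theorem weightedPart_eval (σ : ℝ) (a : ℕ → ℕ → ℝ) (𝔭 𝔥 m : ℕ) (y : ℝ) :
    (weightedPart σ a 𝔭 𝔥 m).eval y =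
      ∑ v ∈ (Finset.range (m + 1) ×ˢ Finset.range (m + 1)).filter
        (fun v : ℕ × ℕ => 𝔭 * v.1 + 𝔥 * v.2 = m), a v.1 v.2 * σ ^ v.1 * y ^ v.2 := by
  simp [weightedPart, eval_finsetSum]

theorem mem_weighted_iff {𝔭 𝔥 : ℕ} (hp : 0 < 𝔭) (hh : 0 < 𝔥) (m : ℕ) (v : ℕ × ℕ) :
    v ∈ (Finset.range (m + 1) ×ˢ Finset.range (m + 1)).filter
        (fun v : ℕ × ℕ => 𝔭 * v.1 + 𝔥 * v.2 = m) ↔ 𝔭 * v.1 + 𝔥 * v.2 = m := by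
  rw [Finset.mem_filter, Finset.mem_product, Finset.mem_range, Finset.mem_range]
  refine ⟨fun h => h.2, fun h => ⟨⟨?_, ?_⟩, h⟩⟩
  · have := Nat.le_mul_of_pos_left v.1 hp; omega
  · have := Nat.le_mul_of_pos_left v.2 hh; omega

/-- The sum of a double series, ordered by weight. -/
theorem SumsTo.hasSum_weightedPart {σ : ℝ} {a : ℕ → ℕ → ℝ} {𝔭 𝔥 : ℕ} (hp : 0 < 𝔭) (hh : 0 < 𝔥)
    {η y z : ℝ} (h : SumsTo a (σ * η ^ 𝔭) (η ^ 𝔥 * y) z) :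
    HasSum (fun m => η ^ m * (weightedPart σ a 𝔭 𝔥 m).eval y) z := by
  have h1 := h.tsum_fiberwise fun v : ℕ × ℕ => 𝔭 * v.1 + 𝔥 * v.2
  convert! h1 using 1
  funext m
  set F := (Finset.range (m + 1) ×ˢ Finset.range (m + 1)).filter
        (fun v : ℕ × ℕ => 𝔭 * v.1 + 𝔥 * v.2 = m) with hF
  have hset : (fun v : ℕ × ℕ => 𝔭 * v.1 + 𝔥 * v.2) ⁻¹' {m} = (F : Set (ℕ × ℕ)) := by
    ext v
    rw [Set.mem_preimage, Set.mem_singleton_iff, Finset.mem_coe, hF, mem_weighted_iff hp hh]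
  rw [tsum_congr_set_coe (fun v : ℕ × ℕ => a v.1 v.2 * (σ * η ^ 𝔭) ^ v.1 * (η ^ 𝔥 * y) ^ v.2) hset,
    Finset.tsum_subtype' F fun v : ℕ × ℕ => a v.1 v.2 * (σ * η ^ 𝔭) ^ v.1 * (η ^ 𝔥 * y) ^ v.2,
    weightedPart_eval, Finset.mul_sum]
  refine Finset.sum_congr rfl fun v hv => ?_
  rw [hF, mem_weighted_iff hp hh] at hv
  rw [← hv, pow_add, pow_mul, pow_mul]
  ring

theorem weightedPart_eq_zero {a : ℕ → ℕ → ℝ} {s : PuiseuxStep} (h : IsNewtonSegment a s) (σ : ℝ)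
    {m : ℕ} (hm : m < s.𝔰) : weightedPart σ a s.𝔭 s.𝔥 m = 0 := by
  refine Finset.sum_eq_zero fun v hv => ?_
  rw [mem_weighted_iff h.1 h.2.1] at hv
  have h0 : a v.1 v.2 = 0 := by
    by_contra h0
    have := h.2.2.2.1 v.1 v.2 h0
    omega
  rw [h0, zero_mul, map_zero, zero_mul]

theorem hasSum_coeff_mul_pow (P : ℝ[X]) (y : ℝ) : HasSum (fun j => P.coeff j * y ^ j) (P.eval y) := by
  rw [eval_eq_sum_range]
  exact hasSum_sum_of_ne_finset_zero (L := SummationFilter.unconditional ℕ) fun j hj => by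
    rw [coeff_eq_zero_of_natDegree_lt (by simpa [Nat.lt_succ_iff] using hj), zero_mul]

/-- One step of the process carries zeros of the new series to zeros of the old series. -/
theorem IsNewtonSegment.sumsTo_zero {a : ℕ → ℕ → ℝ} {s : PuiseuxStep} (h : IsNewtonSegment a s)
    {σ R : ℝ} (ha : GeomBound a R) (hR : 0 ≤ R) {η y : ℝ} (hx : 2 * R * |σ * η ^ s.𝔭| ≤ 1)
    (hy : 2 * R * |η ^ s.𝔥 * (s.c + y)| ≤ 1) (h0 : SumsTo (nextSeries σ a s) η y 0) :
    SumsTo a (σ * η ^ s.𝔭) (η ^ s.𝔥 * (s.c + y)) 0 := by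
  -- The old series sums to some `z`. Regrouped by weight, with nothing below weight `𝔰`, it is `η ^
  -- 𝔰` times the new series, so `z = 0`; no division by `η` occurs.
  obtain ⟨z, hz⟩ := ha.summable hR hx hy
  have h1 := SumsTo.hasSum_weightedPart h.1 h.2.1 hz
  have h2 : HasSum (fun k => η ^ k * (weightedPart σ a s.𝔭 s.𝔥 (s.𝔰 + k)).eval (s.c + y)) 0 := by
    refine h0.prod_fiberwise fun k => ?_
    have := (hasSum_coeff_mul_pow (taylor s.c (weightedPart σ a s.𝔭 s.𝔥 (s.𝔰 + k))) y).mul_left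
      (η ^ k)
    rw [taylor_eval, add_comm y] at this
    convert! this using 1
    funext j
    simp only [nextSeries]; ring
  have h3 : HasSum (fun m => η ^ m * (weightedPart σ a s.𝔭 s.𝔥 m).eval (s.c + y)) 0 := by
    rw [← (add_right_injective s.𝔰).hasSum_iff]
    · have := h2.mul_left (η ^ s.𝔰)
      rw [mul_zero] at this
      convert! this using 1
      funext k
      simp only [Function.comp_apply, pow_add]; ring
    · intro m hm
      have : m < s.𝔰 := by
        by_contra h'
        exact hm ⟨m - s.𝔰, by simp only; omega⟩
      rw [weightedPart_eq_zero h σ this, eval_zero, mul_zero]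
  rw [← h1.unique h3]
  exact hz

theorem abs_coeff_taylor_monomial_le (c b : ℝ) (i j : ℕ) :
    |(taylor c (C b * X ^ i)).coeff j| ≤ |b| * (1 + |c|) ^ i := by
  rw [C_mul_X_pow_eq_monomial, taylor_monomial, coeff_C_mul, abs_mul, coeff_X_add_C_pow]
  refine mul_le_mul_of_nonneg_left ?_ (abs_nonneg _)
  rw [abs_mul, abs_pow, Nat.abs_cast]
  rcases Nat.lt_or_ge i j with h | h
  · rw [Nat.choose_eq_zero_of_lt h]
    simp only [Nat.cast_zero, mul_zero]; positivity
  · rw [add_pow]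
    refine le_trans (le_of_eq ?_) (Finset.single_le_sum
      (f := fun m => 1 ^ m * |c| ^ (i - m) * (i.choose m : ℝ)) (fun m _ => by positivity)
      (Finset.mem_range.2 (Nat.lt_succ_of_le h)))
    simp

/-- A coefficient of weight `m = 𝔰 + k` collects at most `(m + 1) ^ 2 ≤ 4 ^ (m + 1)` old ones, each
multiplied by at most `(N + 1) ^ (m + 1)` from the expansion around `c`. Since `𝔰 ≤ N`, the exponent
`m + 1` is at most `(N + 1) (k + j + 1)`. -/
theorem GeomBound.nextSeries {a : ℕ → ℕ → ℝ} {R : ℝ} (ha : GeomBound a R) (hR : 1 ≤ R)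
    {s : PuiseuxStep} (h : IsNewtonSegment a s) {σ : ℝ} (hσ : |σ| = 1) {N : ℕ} (hs : s.𝔰 ≤ N)
    (hc : |s.c| ≤ N) : GeomBound (nextSeries σ a s) ((4 * (N + 1) * R) ^ (N + 1)) := by
  intro k j
  set m := s.𝔰 + k with hm
  have hN : (0 : ℝ) ≤ N := Nat.cast_nonneg N
  have hB : 1 ≤ (N + 1) * R := by nlinarith
  have h1 : ∀ v ∈ (Finset.range (m + 1) ×ˢ Finset.range (m + 1)).filter
      (fun v : ℕ × ℕ => s.𝔭 * v.1 + s.𝔥 * v.2 = m),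
      |(taylor s.c (C (a v.1 v.2 * σ ^ v.1) * X ^ v.2)).coeff j| ≤ ((N + 1) * R) ^ (m + 1) := by
    intro v hv
    rw [mem_weighted_iff h.1 h.2.1] at hv
    have e1 := Nat.le_mul_of_pos_left v.1 h.1
    have e2 := Nat.le_mul_of_pos_left v.2 h.2.1
    refine (abs_coeff_taylor_monomial_le _ _ _ _).trans ?_
    rw [abs_mul, abs_pow, hσ, one_pow, mul_one]
    calc _ ≤ R ^ (v.1 + v.2 + 1) * (N + 1) ^ v.2 := by
          refine mul_le_mul (ha _ _) (pow_le_pow_left₀ (by positivity) (by linarith) _)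
            (by positivity) (by positivity)
      _ ≤ R ^ (m + 1) * (N + 1) ^ (m + 1) := by
          refine mul_le_mul (pow_le_pow_right₀ hR (by omega))
            (pow_le_pow_right₀ (by linarith) (by omega)) (by positivity) (by positivity)
      _ = _ := by rw [mul_pow]; ring
  have h2 : |(taylor s.c (weightedPart σ a s.𝔭 s.𝔥 m)).coeff j| ≤
      ((m + 1) * (m + 1) : ℕ) • ((N + 1) * R) ^ (m + 1) := by
    rw [weightedPart, map_sum, finsetSum_coeff]
    refine (Finset.abs_sum_le_sum_abs _ _).trans ((Finset.sum_le_card_nsmul _ _ _ h1).trans ?_)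
    refine nsmul_le_nsmul_left (by positivity) ((Finset.card_filter_le _ _).trans ?_)
    simp
  have h3 : (((m + 1) * (m + 1) : ℕ) : ℝ) ≤ 4 ^ (m + 1) := by
    have : (m + 1) < 2 ^ (m + 1) := Nat.lt_two_pow_self
    have h4 : (m + 1) * (m + 1) ≤ 4 ^ (m + 1) := by
      calc _ ≤ 2 ^ (m + 1) * 2 ^ (m + 1) := Nat.mul_le_mul this.le this.le
        _ = _ := by rw [← mul_pow]; norm_num
    exact_mod_cast h4
  rw [nsmul_eq_mul] at h2
  refine h2.trans ?_
  calc _ ≤ 4 ^ (m + 1) * ((N + 1) * R) ^ (m + 1) := by gcongr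
    _ = (4 * (N + 1) * R) ^ (m + 1) := by rw [← mul_pow]; ring
    _ ≤ (4 * (N + 1) * R) ^ ((N + 1) * (k + j + 1)) := by
        refine pow_le_pow_right₀ (by linarith) ?_
        have : (N + 1) * (k + j + 1) = N + k + 1 + (N * k + N * j + j) := by ring
        omega
    _ = _ := by rw [pow_mul]

end

noncomputable section

open Polynomial

/-! ### Orders and multiplicities in the Newton-Puiseux process -/

/-- The series restricted to `ε = 0` vanishes exactly to order `n` at `y = 0`. -/
def HasOrder (a : ℕ → ℕ → ℝ) (n : ℕ) : Prop := (∀ j < n, a 0 j = 0) ∧ a 0 n ≠ 0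

theorem coeff_weightedPart {𝔭 𝔥 : ℕ} (hp : 0 < 𝔭) (hh : 0 < 𝔥) (σ : ℝ) (a : ℕ → ℕ → ℝ) {k j m : ℕ}
    (h : 𝔭 * k + 𝔥 * j = m) : (weightedPart σ a 𝔭 𝔥 m).coeff j = a k j * σ ^ k := by
  rw [weightedPart, finsetSum_coeff, Finset.sum_eq_single (k, j)]
  · exact (coeff_C_mul_X_pow _ _ _).trans (if_pos rfl)
  · rintro ⟨k', j'⟩ hv hne
    rw [mem_weighted_iff hp hh] at hv
    rw [coeff_C_mul_X_pow, if_neg]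
    rintro rfl
    simp only at hv hne
    have : 𝔭 * k' = 𝔭 * k := by omega
    exact hne (by rw [Nat.eq_of_mul_eq_mul_left hp this])
  · intro hv
    exact absurd ((mem_weighted_iff hp hh m (k, j)).2 h) hv

theorem exists_of_coeff_weightedPart_ne_zero {𝔭 𝔥 : ℕ} (hp : 0 < 𝔭) (hh : 0 < 𝔥) {σ : ℝ}
    {a : ℕ → ℕ → ℝ} {j m : ℕ} (h : (weightedPart σ a 𝔭 𝔥 m).coeff j ≠ 0) :
    ∃ k, 𝔭 * k + 𝔥 * j = m := by
  rw [weightedPart, finsetSum_coeff] at h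
  obtain ⟨⟨k, j'⟩, hv, hne⟩ := Finset.exists_ne_zero_of_sum_ne_zero h
  rw [mem_weighted_iff hp hh] at hv
  rw [coeff_C_mul_X_pow] at hne
  obtain rfl : j = j' := by
    by_contra h'
    exact hne (if_neg h')
  exact ⟨k, hv⟩

/-- The operator `X d/dX - j₀` kills the lowest exponent allowed in `P`, so the next one is `j₀ +
p`, and it costs only one unit of multiplicity at `c`. Repeating it `m` times moves the lowest
exponent up to `j₀ + p m`. -/
theorem add_mul_le_natDegree_of_pow_dvd (p m : ℕ) {c : ℝ} (hc : c ≠ 0) :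
    ∀ (j₀ : ℕ) (P : ℝ[X]), P ≠ 0 → (∀ j, P.coeff j ≠ 0 → ∃ i, j = j₀ + p * i) →
      (X - C c) ^ m ∣ P → j₀ + p * m ≤ P.natDegree := by
  induction m with
  | zero =>
    intro j₀ P hP hs _
    obtain ⟨i, hi⟩ := hs P.natDegree (by rwa [coeff_natDegree, leadingCoeff_ne_zero])
    rw [mul_zero, add_zero]
    exact le_of_le_of_eq (Nat.le_add_right j₀ (p * i)) hi.symm
  | succ m ih =>
    intro j₀ P hP hs hd
    set Q := X * derivative P - C (j₀ : ℝ) * P with hQ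
    have hcoeff : ∀ j, Q.coeff j = (j - j₀ : ℝ) * P.coeff j := by
      intro j
      rw [hQ, coeff_sub, coeff_C_mul]
      rcases j with _ | j
      · rw [coeff_X_mul_zero]; simp
      · rw [coeff_X_mul, coeff_derivative]; push_cast; ring
    -- If the result were zero, `P` would be a monomial, which has no root `c ≠ 0`.
    have hQ0 : Q ≠ 0 := by
      intro h0
      have h1 : ∀ j, j ≠ j₀ → P.coeff j = 0 := by
        intro j hj
        have := hcoeff j
        rw [h0, coeff_zero] at this
        refine (mul_eq_zero.1 this.symm).resolve_left (sub_ne_zero.2 ?_)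
        exact_mod_cast hj
      have h2 : P = C (P.coeff j₀) * X ^ j₀ := by
        ext j
        rw [coeff_C_mul_X_pow]
        split_ifs with h
        · rw [h]
        · exact h1 j h
      have h3 : P.eval c = 0 := by
        have : X - C c ∣ P := (dvd_pow_self _ (Nat.succ_ne_zero m)).trans hd
        exact dvd_iff_isRoot.1 this
      rw [h2, eval_C_mul, eval_X_pow] at h3
      have h4 := (mul_eq_zero.1 h3).resolve_right (pow_ne_zero _ hc)
      rw [h4, C_0, zero_mul] at h2
      exact hP h2
    have h1 := ih (j₀ + p) Q hQ0 (fun j hj => by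
      rw [hcoeff] at hj
      obtain ⟨i, hi⟩ := hs j (right_ne_zero_of_mul hj)
      rcases i with _ | i
      · exact absurd (by rw [hi]; push_cast; ring) (left_ne_zero_of_mul hj)
      · exact ⟨i, by rw [hi]; ring⟩)
      (dvd_sub (dvd_mul_of_dvd_right (by simpa using pow_sub_one_dvd_derivative_of_pow_dvd hd) _)
        (dvd_mul_of_dvd_right ((pow_dvd_pow _ (Nat.le_succ m)).trans hd) _))
    have h2 : Q.natDegree ≤ P.natDegree := natDegree_le_iff_coeff_eq_zero.2 fun j hj => by
      rw [hcoeff, coeff_eq_zero_of_natDegree_lt hj, mul_zero]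
    calc j₀ + p * (m + 1) = j₀ + p + p * m := by ring
      _ ≤ _ := h1.trans h2

/-- Separate the largest factor: `p m! = (p m) (m - 1)!`, and this divides `(p m) (p m - 1)! = (p
m)!`. -/
theorem mul_factorial_dvd_of_mul_le {p m n : ℕ} (hp : 0 < p) (hm : 0 < m) (h : p * m ≤ n) :
    p * m.factorial ∣ n.factorial := by
  refine dvd_trans ?_ (Nat.factorial_dvd_factorial h)
  rw [← Nat.mul_factorial_pred hm.ne', ← Nat.mul_factorial_pred (Nat.mul_pos hp hm).ne',
    ← mul_assoc]
  refine mul_dvd_mul_left _ (Nat.factorial_dvd_factorial (Nat.sub_le_sub_right ?_ 1))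
  exact Nat.le_mul_of_pos_left m hp

/-- Here `p ∣ p!`, and `m! p!` divides `(m + p)!` by integrality of binomial coefficients. -/
theorem mul_factorial_dvd_of_add_le {p m n : ℕ} (hp : 0 < p) (h : m + p ≤ n) :
    p * m.factorial ∣ n.factorial := by
  refine dvd_trans ?_ (Nat.factorial_dvd_factorial h)
  rw [mul_comm]
  exact (mul_dvd_mul_left _ (Nat.dvd_factorial hp le_rfl)).trans
    (Nat.factorial_mul_factorial_dvd_factorial_add m p)

/-- Along a Newton segment the exponents of `y` lie in an arithmetic progression of step `𝔭`, by
coprimality of `𝔭` and `𝔥`. -/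
theorem add_mul_of_coprime {p h k k' j j' m : ℕ} (hc : Nat.Coprime p h) (hjj : j ≤ j')
    (h1 : p * k + h * j = m) (h2 : p * k' + h * j' = m) : ∃ i, j' = j + p * i := by
  obtain ⟨l, rfl⟩ := Nat.exists_eq_add_of_le hjj
  rw [mul_add] at h2
  have h3 : p ∣ h * l := by
    rw [← Nat.dvd_add_right (Dvd.intro k' rfl : p ∣ p * k')]
    exact ⟨k, by omega⟩
  obtain ⟨i, hi⟩ := hc.dvd_of_dvd_mul_left h3
  exact ⟨i, by rw [hi]⟩

namespace IsNewtonSegment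

variable {a : ℕ → ℕ → ℝ} {s : PuiseuxStep} {σ : ℝ} {n : ℕ}

theorem coeff_ne_zero (h : IsNewtonSegment a s) (hσ : σ ≠ 0) {k j : ℕ} (hv : s.𝔭 * k + s.𝔥 * j = s.𝔰)
    (h0 : a k j ≠ 0) : (segmentPolynomial σ a s).coeff j ≠ 0 := by
  rw [segmentPolynomial, coeff_weightedPart h.1 h.2.1 σ a hv]
  exact mul_ne_zero h0 (pow_ne_zero _ hσ)

/-- The point `(0, n)` belongs to the carrier, hence lies on or above the line, which bounds the
exponents on the segment by `n`. -/
theorem natDegree_le (h : IsNewtonSegment a s) (ha : HasOrder a n) :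
    (segmentPolynomial σ a s).natDegree ≤ n := by
  refine natDegree_le_iff_coeff_eq_zero.2 fun j hj => ?_
  by_contra h0
  obtain ⟨k, hk⟩ := exists_of_coeff_weightedPart_ne_zero h.1 h.2.1 h0
  have h1 := h.2.2.2.1 0 n ha.2
  have h2 := Nat.mul_lt_mul_of_pos_left hj h.2.1
  omega

/-- At `η = 0` the new series is the segment polynomial expanded around `c`, so `n'` is the
multiplicity of this root. For `c = 0` it is the lowest exponent, and the second point of the
segment lies at least `𝔭` higher. For `c ≠ 0` the degree is at least `𝔭 n'`. Either inequality gives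
the divisibility. -/
theorem exists_hasOrder_nextSeries (h : IsNewtonSegment a s) (ha : HasOrder a n) (hσ : σ ≠ 0)
    (hr : (segmentPolynomial σ a s).IsRoot s.c) :
    ∃ n', HasOrder (nextSeries σ a s) n' ∧ s.𝔭 * n'.factorial ∣ n.factorial := by
  set P := segmentPolynomial σ a s with hP
  obtain ⟨hp, hh, hco, -, ⟨k₁, j₁⟩, ⟨k₂, j₂⟩, hne, ha₁, ha₂, h₁, h₂⟩ := id h
  simp only at ha₁ ha₂ h₁ h₂
  have hc₁ := h.coeff_ne_zero hσ h₁ ha₁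
  have hc₂ := h.coeff_ne_zero hσ h₂ ha₂
  have hP0 : P ≠ 0 := fun h0 => hc₁ (by rw [← hP, h0, coeff_zero])
  have ht0 : taylor s.c P ≠ 0 := by rwa [Ne, taylor_eq_zero]
  refine ⟨(taylor s.c P).natTrailingDegree, ⟨fun j hj => ?_, ?_⟩, ?_⟩
  · exact coeff_eq_zero_of_lt_natTrailingDegree hj
  · exact trailingCoeff_nonzero_iff_nonzero.2 ht0
  set n' := (taylor s.c P).natTrailingDegree with hn'
  have hdeg : P.natDegree ≤ n := h.natDegree_le ha
  by_cases hc : s.c = 0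
  · have key : ∀ k₁ k₂ j₁ j₂, j₁ < j₂ → s.𝔭 * k₁ + s.𝔥 * j₁ = s.𝔰 → s.𝔭 * k₂ + s.𝔥 * j₂ = s.𝔰 →
        P.coeff j₁ ≠ 0 → P.coeff j₂ ≠ 0 → n' + s.𝔭 ≤ n := by
      intro k₁ k₂ j₁ j₂ hlt h₁ h₂ hc₁ hc₂
      obtain ⟨i, hi⟩ := add_mul_of_coprime hco hlt.le h₁ h₂
      have hi0 : 0 < i := by
        rcases Nat.eq_zero_or_pos i with rfl | hi0
        · omega
        · exact hi0
      have e1 : n' ≤ j₁ := by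
        rw [hn', hc, taylor_zero]
        exact natTrailingDegree_le_of_ne_zero hc₁
      have e2 := le_natDegree_of_ne_zero hc₂
      have e3 := Nat.le_mul_of_pos_right s.𝔭 hi0
      omega
    refine mul_factorial_dvd_of_add_le hp ?_
    rcases lt_trichotomy j₁ j₂ with hlt | rfl | hlt
    · exact key _ _ _ _ hlt h₁ h₂ hc₁ hc₂
    · have : s.𝔭 * k₁ = s.𝔭 * k₂ := by omega
      exact absurd (by rw [Nat.eq_of_mul_eq_mul_left hp this]) hne
    · exact key _ _ _ _ hlt h₂ h₁ hc₂ hc₁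
  · have hn0 : 0 < n' := by
      refine Nat.pos_of_ne_zero fun h0 => ?_
      have : (taylor s.c P).coeff n' ≠ 0 := trailingCoeff_nonzero_iff_nonzero.2 ht0
      rw [h0, taylor_coeff_zero] at this
      exact this hr
    have hdvd : (X - C s.c) ^ n' ∣ P := by
      have h1 : X ^ n' ∣ taylor s.c P :=
        X_pow_dvd_iff.2 fun j hj => coeff_eq_zero_of_lt_natTrailingDegree hj
      obtain ⟨Q, hQ⟩ := h1
      have h2 := congrArg (taylor (-s.c)) hQ
      rw [taylor_taylor, neg_add_cancel, taylor_zero, taylor_mul, taylor_X_pow, C_neg,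
        ← sub_eq_add_neg] at h2
      exact ⟨_, h2⟩
    have hsupp : ∀ j, P.coeff j ≠ 0 → ∃ i, j = P.natTrailingDegree + s.𝔭 * i := by
      intro j hj
      obtain ⟨k, hk⟩ := exists_of_coeff_weightedPart_ne_zero hp hh hj
      have h0 : P.coeff P.natTrailingDegree ≠ 0 := trailingCoeff_nonzero_iff_nonzero.2 hP0
      obtain ⟨k₀, hk₀⟩ := exists_of_coeff_weightedPart_ne_zero hp hh h0
      exact add_mul_of_coprime hco (natTrailingDegree_le_of_ne_zero hj) hk₀ hk
    have := add_mul_le_natDegree_of_pow_dvd s.𝔭 n' hc _ P hP0 hsupp hdvd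
    exact mul_factorial_dvd_of_mul_le hp hn0 (by omega)

end IsNewtonSegment

end

noncomputable section

open AbsSeries

/-! ### The implicit function theorem and the Puiseux series -/

/-- The smallness constant of the implicit function theorem. -/
def implicitConst (N : ℕ) (R : ℝ) : ℝ := 512 * N ^ 2 * R ^ 5

theorem norm_monomial_one (n : ℕ) : ‖(monomial n 1 : AbsSeries ℝ)‖ = 1 := by
  rw [norm_monomial, norm_one]

theorem eval_monomial_real (n : ℕ) (c : ℝ) {x : ℝ} (hx : |x| ≤ 1) :
    eval (ContrHom.id ℝ) x (monomial n c) = c * x ^ n := by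
  rw [eval_monomial _ (by simpa using hx)]; rfl

/-- With `y = r u`, solving for the linear term divides by `a 0 1 * r`. The scale `r` compensates
this division in the terms of order at least two in `y`, and `ρ` in the terms containing the
parameter; the constants are chosen so that both cases give `1 / 8`. -/
theorem implicit_coeff_le {a : ℕ → ℕ → ℝ} {R N r ρ : ℝ} (ha : GeomBound a R) (hR : 1 ≤ R)
    (hN : 1 ≤ N) (hr : r = 1 / (32 * N * R ^ 3)) (hρ0 : 0 ≤ ρ) (hρ : 512 * N ^ 2 * R ^ 5 * ρ ≤ 1)
    (hN1 : 1 ≤ N * |a 0 1|) {k j : ℕ} (hkj : 1 ≤ k ∨ 2 ≤ j) :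
    |-(a k j * ρ ^ k * r ^ j) / (a 0 1 * r)| ≤ 1 / 8 * (1 / 2) ^ k * (1 / 2) ^ j := by
  have hR0 : 0 < R := by linarith
  have hr0 : 0 < r := by rw [hr]; positivity
  have ha1 : 0 < |a 0 1| := by
    by_contra h
    have : |a 0 1| = 0 := le_antisymm (not_lt.1 h) (abs_nonneg _)
    rw [this, mul_zero] at hN1; linarith
  have hinv : |a 0 1|⁻¹ ≤ N := by rwa [inv_le_iff_one_le_mul₀ ha1]
  have hRr : 2 * (R * r) ≤ 1 := by
    have h3 : R ≤ N * R ^ 3 := by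
      have : R ≤ R ^ 3 := le_self_pow₀ hR (by norm_num)
      nlinarith [pow_pos hR0 3]
    rw [hr, mul_one_div, mul_div_assoc', div_le_one (by positivity)]
    nlinarith
  have hRρ : 2 * (R * ρ) ≤ 1 := by
    refine le_trans ?_ hρ
    have : R ≤ N ^ 2 * R ^ 5 := by
      have h1 : R ≤ R ^ 5 := le_self_pow₀ hR (by norm_num)
      have h2 : 1 ≤ N ^ 2 := one_le_pow₀ hN
      nlinarith [pow_pos hR0 5]
    nlinarith
  have key : N * R / r * ((2 * (R * ρ)) ^ k * (2 * (R * r)) ^ j) ≤ 1 / 8 := by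
    rcases hkj with hk | hj
    · calc _ ≤ N * R / r * ((2 * (R * ρ)) ^ 1 * 1) := by
            gcongr ?_ * (?_ * ?_)
            · exact pow_le_pow_of_le_one (by positivity) hRρ hk
            · exact pow_le_one₀ (by positivity) hRr
        _ = (512 * N ^ 2 * R ^ 5 * ρ) * (1 / 8) := by rw [hr]; field_simp; ring
        _ ≤ _ := by linarith
    · calc _ ≤ N * R / r * (1 * (2 * (R * r)) ^ 2) := by
            gcongr ?_ * (?_ * ?_)
            · exact pow_le_one₀ (by positivity) hRρ
            · exact pow_le_pow_of_le_one (by positivity) hRr hj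
        _ = 1 / 8 := by rw [hr]; field_simp; norm_num
  rw [abs_div, abs_neg, abs_mul, abs_mul, abs_mul, abs_pow, abs_pow, abs_of_nonneg hρ0,
    abs_of_pos hr0, div_eq_mul_inv, mul_inv]
  calc _ ≤ R ^ (k + j + 1) * ρ ^ k * r ^ j * (N * r⁻¹) := by
        gcongr
        exact ha k j
    _ = N * R / r * ((2 * (R * ρ)) ^ k * (2 * (R * r)) ^ j) * (1 / 2) ^ k * (1 / 2) ^ j := by
        simp only [mul_pow, one_div, inv_pow, pow_add, pow_one]
        field_simp
    _ ≤ _ := by gcongr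

/-- The implicit function theorem for series with geometric bounds. -/
theorem exists_implicit_series {a : ℕ → ℕ → ℝ} {R : ℝ} {N : ℕ} (ha : GeomBound a R) (hR : 1 ≤ R)
    (hN : 1 ≤ N) (ha0 : a 0 0 = 0) (ha1 : 1 ≤ (N : ℝ) * |a 0 1|) {ρ : ℝ} (hρ0 : 0 ≤ ρ)
    (hρ : implicitConst N R * ρ ≤ 1) {D : ℕ} (hD : 0 < D) :
    ∃ Y : AbsSeries ℝ, ‖Y‖ ≤ 1 ∧
      ∀ x : ℝ, |x| ≤ 1 → SumsTo a ((ρ * x) ^ D) (eval (ContrHom.id ℝ) x Y) 0 := by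
  have hN' : (1 : ℝ) ≤ N := by exact_mod_cast hN
  have hR0 : 0 < R := by linarith
  obtain ⟨r, hr⟩ : ∃ r : ℝ, r = 1 / (32 * N * R ^ 3) := ⟨_, rfl⟩
  have hr0 : 0 < r := by rw [hr]; positivity
  have hRr : 2 * R * r ≤ 1 := by
    have h3 : R ≤ N * R ^ 3 := by
      have : R ≤ R ^ 3 := le_self_pow₀ hR (by norm_num)
      nlinarith [pow_pos hR0 3]
    rw [hr, mul_one_div, div_le_one (by positivity)]
    nlinarith
  have hr1 : r ≤ 1 := by nlinarith
  have hK : 2 * R ≤ implicitConst N R := by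
    have h1 : R ≤ R ^ 5 := le_self_pow₀ hR (by norm_num)
    have h2 : 1 ≤ (N : ℝ) ^ 2 := one_le_pow₀ hN'
    rw [implicitConst]
    nlinarith [pow_pos hR0 5]
  have hRρ : 2 * R * ρ ≤ 1 := le_trans (by gcongr) hρ
  have hρ1 : ρ ≤ 1 := by nlinarith
  have hρD : ρ ^ D ≤ ρ := pow_le_of_le_one hρ0 hρ1 hD.ne'
  have ha1' : a 0 1 ≠ 0 := by
    intro h
    rw [h, abs_zero, mul_zero] at ha1; linarith
  -- These are the coefficients of `H` in the fixed-point form `u = H(x ^ D, u)` of the equation;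
  -- the indices left out are the constant term, which is zero, and the linear term, which has been
  -- solved for.
  set f : ℕ → ℕ → ℝ := fun k j =>
    if 1 ≤ k ∨ 2 ≤ j then -(a k j * (ρ ^ D) ^ k * r ^ j) / (a 0 1 * r) else 0 with hf
  have hfle : ∀ k j, ‖f k j‖ ≤ 1 / 8 * (1 / 2) ^ k * (1 / 2) ^ j := by
    intro k j
    simp only [hf]
    split_ifs with hkj
    · exact implicit_coeff_le ha hR hN' hr (by positivity)
        (le_trans (mul_le_mul_of_nonneg_left hρD (by positivity)) hρ) ha1 hkj
    · rw [norm_zero]; positivity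
  set H := mkHalf₂ f (1 / 8) hfle with hH
  have hHn : ‖H‖ ≤ 1 / 2 := (norm_mkHalf₂_le f (1 / 8) hfle).trans (by norm_num)
  have hX : ‖(monomial D 1 : AbsSeries ℝ)‖ ≤ 1 := (norm_monomial_one D).le
  -- The contraction takes place in the algebra of series in `x`, so its fixed point is a convergent
  -- series from the outset.
  obtain ⟨u, hu, hfix⟩ := AuxData.exists_fixedPoint_of_lipschitz_half
    (f := fun u : AbsSeries ℝ => eval (eval (const ℝ) u) (monomial D 1) H)
    (fun u _ => ((eval (eval (const ℝ) u) (monomial D 1)).norm_le H).trans hHn)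
    (fun u v hu hv => by
      refine (norm_eval_sub_le_of_hom (C := ‖u - v‖)
        (fun e => (norm_eval_sub_le _ hu hv e).trans (mul_comm _ _).le) hX H).trans ?_
      rw [mul_comm]
      gcongr)
  refine ⟨r • u, ?_, fun x hx => ?_⟩
  · rw [norm_smul, Real.norm_of_nonneg hr0.le]
    nlinarith [norm_nonneg u]
  have hx' : ‖x‖ ≤ 1 := hx
  set ψ := eval (ContrHom.id ℝ) x with hψ
  have hu1 : ‖ψ u‖ ≤ 1 := (ψ.norm_le u).trans (by linarith)
  have hxD : ‖x ^ D‖ ≤ 1 := by rw [norm_pow]; exact pow_le_one₀ (norm_nonneg _) hx'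
  have h1 : eval (eval (ContrHom.id ℝ) (ψ u)) (x ^ D) H = ψ u := by
    have := congrArg ψ hfix
    rw [map_eval ψ _ hX, comp_eval ψ _ (by linarith), hψ, eval_comp_const _ hx',
      eval_monomial_real D 1 hx, one_mul] at this
    exact this
  have hxa : 2 * R * |(ρ * x) ^ D| ≤ 1 := by
    rw [abs_pow, abs_mul, abs_of_nonneg hρ0]
    calc _ ≤ 2 * R * (ρ * 1) ^ D := by gcongr
      _ ≤ 2 * R * ρ := by rw [mul_one]; gcongr
      _ ≤ 1 := hRρ
  have hya : 2 * R * |ψ (r • u)| ≤ 1 := by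
    rw [map_smul, smul_eq_mul, abs_mul, abs_of_pos hr0]
    calc _ ≤ 2 * R * (r * 1) := by gcongr; exact hu1
      _ ≤ 1 := by rw [mul_one]; exact hRr
  obtain ⟨z, hz⟩ := ha.summable hR0.le hxa hya
  have h2 : HasSum (fun v : ℕ × ℕ => if v = (0, 1) then a 0 1 * (r * ψ u) else 0)
      (a 0 1 * (r * ψ u)) := hasSum_ite_eq (0, 1) _
  have h3 := (hz.sub h2).mul_left (-(a 0 1 * r)⁻¹)
  -- With `z` the value of the original series, removal of the linear term evaluates `H` to `-(z -
  -- a₀₁ r u) / (a₀₁ r)`. The fixed-point equation says that this is `u`, which forces `z = 0`.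
  have h4 := eval_eval_eq_of_hasSum (ContrHom.id ℝ) hu1 hxD H
    (s := -(a 0 1 * r)⁻¹ * (z - a 0 1 * (r * ψ u))) (by
      convert! h3 using 1
      funext v
      obtain ⟨k, j⟩ := v
      rw [hH, coeff_coeff_mkHalf₂, ContrHom.id_apply, map_smul, smul_eq_mul]
      simp only [hf]
      by_cases hkj : 1 ≤ k ∨ 2 ≤ j
      · rw [if_pos hkj, if_neg (by rintro ⟨⟩; omega)]
        rw [mul_pow, mul_pow r, ← pow_mul, ← pow_mul, mul_pow, div_eq_mul_inv]
        ring
      · obtain rfl : k = 0 := by omega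
        rw [if_neg hkj]
        obtain rfl | rfl : j = 0 ∨ j = 1 := by omega
        · rw [if_neg (by simp), ha0]; simp
        · rw [if_pos rfl]; simp)
  rw [h1] at h4
  have h5 : z = 0 := by
    have := hr0.ne'
    field_simp at h4
    linarith
  rw [h5] at hz
  exact hz

end

/-! ### Convergence of the Newton-Puiseux process -/

noncomputable section

open AbsSeries

/-- The bound on the coefficients after a step of the process. -/
def nextBound (N : ℕ) (R : ℝ) : ℝ := (4 * (N + 1) * R) ^ (N + 1)

theorem le_nextBound (N : ℕ) {R : ℝ} (hR : 1 ≤ R) : R ≤ nextBound N R := by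
  have hN : (0 : ℝ) ≤ N := Nat.cast_nonneg N
  have h1 : R ≤ 4 * (N + 1) * R := by nlinarith
  exact h1.trans (le_self_pow₀ (hR.trans h1) (Nat.succ_ne_zero N))

theorem le_iterate_nextBound (N : ℕ) {R : ℝ} (hR : 1 ≤ R) (i : ℕ) : R ≤ (nextBound N)^[i] R := by
  induction i with
  | zero => exact le_rfl
  | succ i ih =>
    rw [Function.iterate_succ_apply']
    exact ih.trans (le_nextBound N (hR.trans ih))

theorem two_mul_le_implicitConst {N : ℕ} (hN : 1 ≤ N) {R R' : ℝ} (hR : 1 ≤ R) (h : R ≤ R') :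
    2 * R * (N + 1) ≤ implicitConst N R' := by
  have hN' : (1 : ℝ) ≤ N := by exact_mod_cast hN
  have h1 : R ≤ R' ^ 5 := h.trans (le_self_pow₀ (hR.trans h) (by norm_num))
  have h2 : (N : ℝ) ≤ N ^ 2 := le_self_pow₀ hN' (by norm_num)
  have h3 : R * (N + 1) ≤ R' ^ 5 * (2 * N ^ 2) := by
    refine mul_le_mul h1 (by linarith) (by positivity) ?_
    exact (zero_le_one.trans hR).trans h1
  have h4 : 0 ≤ R' ^ 5 * (N : ℝ) ^ 2 :=
    mul_nonneg ((zero_le_one.trans hR).trans h1) (by positivity)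
  rw [implicitConst]
  nlinarith

/-- Substitutes a branch of the new series back through `η = (ρ x) ^ D`, `y ↦ η ^ 𝔥 (c + y)`. The
factor `η ^ 𝔥` removes the constant term and makes the branch as small as `ρ`, and the parameter
becomes `σ η ^ 𝔭`, so `D` is multiplied by `𝔭`. -/
theorem IsNewtonSegment.exists_series {a : ℕ → ℕ → ℝ} {s : PuiseuxStep} (h : IsNewtonSegment a s)
    {σ R : ℝ} {N : ℕ} (ha : GeomBound a R) (hR : 1 ≤ R) (hσ : |σ| = 1) (hc : |s.c| ≤ N) {ρ : ℝ}
    (hρ0 : 0 ≤ ρ) (hρ : 2 * R * (N + 1) * ρ ≤ 1) {D : ℕ} (hD : 0 < D) {Y : AbsSeries ℝ}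
    (hY1 : ‖Y‖ ≤ 1) (hY : ∀ x : ℝ, |x| ≤ 1 →
      SumsTo (nextSeries σ a s) ((ρ * x) ^ D) (eval (ContrHom.id ℝ) x Y) 0) :
    ∃ Z : AbsSeries ℝ, Z.coeff 0 = 0 ∧ ‖Z‖ ≤ ρ * (N + 1) ∧ ∀ x : ℝ, |x| ≤ 1 →
      SumsTo a (σ * (ρ * x) ^ (s.𝔭 * D)) (eval (ContrHom.id ℝ) x Z) 0 := by
  have hN : (0 : ℝ) ≤ N := Nat.cast_nonneg N
  have hhD : 0 < s.𝔥 * D := Nat.mul_pos h.2.1 hD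
  have hRN : 1 ≤ 2 * R * (N + 1) := by nlinarith
  have hρ1 : ρ ≤ 1 := by nlinarith
  have hm : ‖(monomial (s.𝔥 * D) (ρ ^ (s.𝔥 * D)) : AbsSeries ℝ)‖ ≤ ρ := by
    rw [norm_monomial, norm_pow, Real.norm_of_nonneg hρ0]
    exact pow_le_of_le_one hρ0 hρ1 hhD.ne'
  have hcY : ‖algebraMap ℝ (AbsSeries ℝ) s.c + Y‖ ≤ N + 1 := by
    refine (norm_add_le _ _).trans (add_le_add ?_ hY1)
    rw [norm_algebraMap']; exact hc
  have hZ : ‖(algebraMap ℝ (AbsSeries ℝ) s.c + Y) * monomial (s.𝔥 * D) (ρ ^ (s.𝔥 * D))‖ ≤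
      ρ * (N + 1) := by
    refine (norm_mul_le _ _).trans ?_
    rw [mul_comm ρ]
    gcongr
  have heval : ∀ x : ℝ, |x| ≤ 1 → eval (ContrHom.id ℝ) x
      ((algebraMap ℝ (AbsSeries ℝ) s.c + Y) * monomial (s.𝔥 * D) (ρ ^ (s.𝔥 * D))) =
      ((ρ * x) ^ D) ^ s.𝔥 * (s.c + eval (ContrHom.id ℝ) x Y) := by
    intro x hx
    rw [map_mul, eval_monomial_real _ _ hx, map_add, AlgHomClass.commutes, Algebra.algebraMap_self,
      RingHom.id_apply, ← mul_pow, mul_comm s.𝔥, pow_mul]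
    ring
  refine ⟨_, ?_, hZ, fun x hx => ?_⟩
  · rw [coeff_mul_monomial, if_neg (by omega)]
  · have hx' : ‖x‖ ≤ 1 := hx
    have hb := ((eval (ContrHom.id ℝ) x).norm_le _).trans hZ
    rw [heval x hx] at hb ⊢
    rw [mul_comm s.𝔭, pow_mul]
    refine h.sumsTo_zero ha (by linarith) ?_ ?_ (hY x hx)
    · rw [abs_mul, hσ, one_mul, ← pow_mul, abs_pow, abs_mul, abs_of_nonneg hρ0]
      have h1 : (ρ * |x|) ^ (D * s.𝔭) ≤ ρ := by
        refine (pow_le_of_le_one (by positivity) (by nlinarith [abs_nonneg x])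
          (Nat.mul_pos hD h.1).ne').trans (by nlinarith [abs_nonneg x])
      have h2 : R ≤ R * (N + 1) := by nlinarith
      calc _ ≤ 2 * R * ρ := by gcongr
        _ ≤ 2 * R * (N + 1) * ρ := mul_le_mul_of_nonneg_right (by linarith) hρ0
        _ ≤ 1 := hρ
    · refine le_trans (mul_le_mul_of_nonneg_left hb (by linarith)) (le_of_eq_of_le ?_ hρ)
      ring

/-- After the first step the rest is again a process of the same kind, started at the new series
with sign `1`. The induction on the number of steps peels off steps from the front. -/
theorem puiseuxSeries_succ (σ : ℝ) (a : ℕ → ℕ → ℝ) (s : ℕ → PuiseuxStep) (i : ℕ) :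
    puiseuxSeries 1 (nextSeries σ a (s 0)) (fun i => s (i + 1)) i = puiseuxSeries σ a s (i + 1) := by
  induction i with
  | zero => simp [puiseuxSeries, stepSign]
  | succ i ih =>
    rw [puiseuxSeries, ih]
    conv_rhs => rw [puiseuxSeries]
    simp [stepSign]

theorem puiseuxPolynomial_succ (σ : ℝ) (a : ℕ → ℕ → ℝ) (s : ℕ → PuiseuxStep) (i : ℕ) :
    puiseuxPolynomial 1 (nextSeries σ a (s 0)) (fun i => s (i + 1)) i =
      puiseuxPolynomial σ a s (i + 1) := by
  rw [puiseuxPolynomial, puiseuxSeries_succ, puiseuxPolynomial]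
  simp [stepSign]

/-- The Newton-Puiseux process yields a convergent series. -/
theorem exists_puiseux_series {N : ℕ} (hN : 1 ≤ N) (i₀ : ℕ) : ∀ (a : ℕ → ℕ → ℝ) (σ : ℝ)
    (s : ℕ → PuiseuxStep) (n : ℕ) (R : ℝ) (D : ℕ) (ρ : ℝ), |σ| = 1 → 1 ≤ R → GeomBound a R →
    HasOrder a n → ReachesSimpleRoot σ a s i₀ → (∀ i ≤ i₀, (s i).𝔰 ≤ N ∧ |(s i).c| ≤ N) →
    1 ≤ (N : ℝ) * |(puiseuxPolynomial σ a s i₀).derivative.eval (s i₀).c| → 0 < D →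
    n.factorial ∣ D → 0 ≤ ρ → implicitConst N ((nextBound N)^[i₀ + 1] R) * ρ ≤ 1 →
    ∃ Y : AbsSeries ℝ, Y.coeff 0 = 0 ∧ ‖Y‖ ≤ ρ * (N + 1) ∧ ∀ x : ℝ, |x| ≤ 1 →
      SumsTo a (σ * (ρ * x) ^ D) (eval (ContrHom.id ℝ) x Y) 0 := by
  induction i₀ with
  | zero =>
    intro a σ s n R D ρ hσ hR ha hn hs hb hr hD hnD hρ0 hρ
    obtain ⟨hseg, hroot⟩ := hs.1 0 le_rfl
    have hpoly : puiseuxPolynomial σ a s 0 = segmentPolynomial σ a (s 0) := by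
      simp [puiseuxPolynomial, puiseuxSeries, stepSign]
    rw [hpoly] at hroot hr
    have hseg' : IsNewtonSegment a (s 0) := hseg
    have hσ0 : σ ≠ 0 := by rintro rfl; simp at hσ
    obtain ⟨n', hn', hdvd⟩ := hseg'.exists_hasOrder_nextSeries hn hσ0 hroot
    obtain ⟨D', rfl⟩ := (Dvd.intro _ rfl).trans (hdvd.trans hnD)
    have hD' : 0 < D' := Nat.pos_of_mul_pos_left hD
    have hR' : 1 ≤ nextBound N R := hR.trans (le_nextBound N hR)
    -- The constant and linear coefficients of the new series are the value and the derivative of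
    -- the segment polynomial at `c`: zero for a root, and bounded below at the chosen simple root.
    obtain ⟨Y, hY1, hY⟩ := exists_implicit_series (a := nextSeries σ a (s 0))
      (ha.nextSeries hR hseg' hσ (hb 0 le_rfl).1 (hb 0 le_rfl).2) hR' hN
      ((Polynomial.taylor_coeff_zero _ _).trans hroot)
      (by rwa [nextSeries, Polynomial.taylor_coeff_one]) hρ0 hρ hD'
    refine hseg'.exists_series ha hR hσ (hb 0 le_rfl).2 hρ0 (le_trans ?_ hρ) hD' hY1 hY
    exact mul_le_mul_of_nonneg_right
      (two_mul_le_implicitConst hN hR (le_iterate_nextBound N hR _)) hρ0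
  | succ i₀ ih =>
    intro a σ s n R D ρ hσ hR ha hn hs hb hr hD hnD hρ0 hρ
    obtain ⟨hseg, hroot⟩ := hs.1 0 (Nat.zero_le _)
    have hpoly : puiseuxPolynomial σ a s 0 = segmentPolynomial σ a (s 0) := by
      simp [puiseuxPolynomial, puiseuxSeries, stepSign]
    rw [hpoly] at hroot
    have hseg' : IsNewtonSegment a (s 0) := hseg
    have hσ0 : σ ≠ 0 := by rintro rfl; simp at hσ
    obtain ⟨n', hn', hdvd⟩ := hseg'.exists_hasOrder_nextSeries hn hσ0 hroot
    obtain ⟨D', hDD⟩ := hdvd.trans hnD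
    -- The first ramification index `𝔭` is split off, and the remaining exponent is still a multiple
    -- of `n'!`, as the induction hypothesis demands.
    have hDD' : D = (s 0).𝔭 * (n'.factorial * D') := by rw [hDD, mul_assoc]
    rw [hDD'] at hD
    have hD' : 0 < n'.factorial * D' := Nat.pos_of_mul_pos_left hD
    have hR' : 1 ≤ nextBound N R := hR.trans (le_nextBound N hR)
    have hb0 := hb 0 (Nat.zero_le _)
    have hρ' := hρ
    rw [Function.iterate_succ_apply] at hρ'
    obtain ⟨Y, -, hYn, hY⟩ := ih (nextSeries σ a (s 0)) 1 (fun i => s (i + 1)) n' (nextBound N R)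
      (n'.factorial * D') ρ abs_one hR' (ha.nextSeries hR hseg' hσ hb0.1 hb0.2) hn'
      ⟨fun i hi => by
        rw [puiseuxSeries_succ, puiseuxPolynomial_succ]
        exact hs.1 (i + 1) (by omega), by
        rw [puiseuxPolynomial_succ]; exact hs.2⟩
      (fun i hi => hb (i + 1) (by omega)) (by rw [puiseuxPolynomial_succ]; exact hr) hD'
      (Dvd.intro _ rfl) hρ0 hρ'
    have hsmall : 2 * R * (N + 1) * ρ ≤ 1 := le_trans (mul_le_mul_of_nonneg_right
      (two_mul_le_implicitConst hN hR (le_iterate_nextBound N hR _)) hρ0) hρ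
    rw [hDD']
    refine hseg'.exists_series ha hR hσ hb0.2 hρ0 hsmall hD' (hYn.trans ?_)
      (fun x hx => by simpa only [one_mul] using hY x hx)
    refine le_trans ?_ hsmall
    rw [mul_comm ρ]
    gcongr
    nlinarith [Nat.cast_nonneg (α := ℝ) N]

end

noncomputable section

open AbsSeries

/-! ### Subharmonic solutions along a branch of zeros -/

section Branch

variable {o : ResonantOrbit} [Fact (0 < o.T)]

/-- A real series as a series with constant periodic coefficients. -/
def toPeriodic : ContrHom (AbsSeries ℝ) (AbsSeries (PeriodicFun o.T)) :=
  eval ((const _).comp (ContrHom.ofReal _)) (monomial 1 1)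

/-- Substitution of `c z ^ D` for the outer variable and of a series for the inner one. -/
def substBranch (c : ℝ) (D : ℕ) (y : AbsSeries ℝ) :
    ContrHom (AbsSeries (AbsSeries (PeriodicFun o.T))) (AbsSeries (PeriodicFun o.T)) :=
  eval (eval (const _) (toPeriodic y)) (monomial D (algebraMap ℝ _ c))

theorem eval_toPeriodic {x : ℝ} (hx : |x| ≤ 1) (y : AbsSeries ℝ) :
    eval (ContrHom.id _) (algebraMap ℝ (PeriodicFun o.T) x) (toPeriodic y) =
      algebraMap ℝ _ (eval (ContrHom.id ℝ) x y) := by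
  have hx1 : ‖algebraMap ℝ (PeriodicFun o.T) x‖ ≤ 1 := norm_algebraMap_le hx
  have hm : ‖(monomial 1 1 : AbsSeries (PeriodicFun o.T))‖ ≤ 1 := by rw [norm_monomial, norm_one]
  have h1 : (eval (ContrHom.id _) (algebraMap ℝ (PeriodicFun o.T) x)).comp
      ((const _).comp (ContrHom.ofReal _)) = (ContrHom.ofReal (PeriodicFun o.T)).comp
        (ContrHom.id ℝ) := by
    ext r
    rw [ContrHom.comp_apply, ContrHom.comp_apply, eval_const _ hx1]; rfl
  have h2 : ContrHom.ofReal (PeriodicFun o.T) x = algebraMap ℝ _ x := rfl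
  rw [toPeriodic, map_eval _ _ hm, h1, eval_monomial _ hx1, map_one, one_mul, pow_one, ← h2,
    ← map_eval (ContrHom.ofReal (PeriodicFun o.T)) (ContrHom.id ℝ) (by simpa using hx)]
  rfl

theorem eval_substBranch {c : ℝ} (hc : |c| ≤ 1) (D : ℕ) {y : AbsSeries ℝ} (hy : ‖y‖ ≤ 1) {x : ℝ}
    (hx : |x| ≤ 1) (V : AbsSeries (AbsSeries (PeriodicFun o.T))) :
    eval (ContrHom.id _) (algebraMap ℝ (PeriodicFun o.T) x) (substBranch c D y V) =
      evalReal (c * x ^ D) (eval (ContrHom.id ℝ) x y) V := by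
  have hx1 : ‖algebraMap ℝ (PeriodicFun o.T) x‖ ≤ 1 := norm_algebraMap_le hx
  have hm : ‖(monomial D (algebraMap ℝ (PeriodicFun o.T) c))‖ ≤ 1 := by
    rw [norm_monomial]; exact norm_algebraMap_le hc
  have hy1 : ‖(toPeriodic y : AbsSeries (PeriodicFun o.T))‖ ≤ 1 := (toPeriodic.norm_le y).trans hy
  rw [substBranch, map_eval _ _ hm, comp_eval _ _ hy1, eval_comp_const _ hx1, eval_toPeriodic hx,
    eval_monomial _ hx1, evalReal, ContrHom.id_apply, ← map_pow, ← map_mul]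

theorem substBranch_coeff_zero {c : ℝ} (hc : |c| ≤ 1) {D : ℕ} (hD : 0 < D) {y : AbsSeries ℝ}
    (hy : ‖y‖ ≤ 1) (hy0 : y.coeff 0 = 0) (V : AbsSeries (AbsSeries (PeriodicFun o.T))) :
    (substBranch c D y V).coeff 0 = (V.coeff 0).coeff 0 := by
  have hz : |(0 : ℝ)| ≤ 1 := by rw [abs_zero]; exact zero_le_one
  have h1 := eval_substBranch (o := o) hc D hy hz V
  have h0 : algebraMap ℝ (PeriodicFun o.T) 0 = 0 := map_zero (algebraMap ℝ (PeriodicFun o.T))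
  rw [h0, AbsSeries.eval_zero, AbsSeries.eval_zero, hy0, zero_pow hD.ne', mul_zero,
    ContrHom.id_apply, ContrHom.id_apply, evalReal_zero] at h1
  exact h1

theorem hasSum_substBranch {c : ℝ} (hc : |c| ≤ 1) {D : ℕ} (hD : 0 < D) {y : AbsSeries ℝ}
    (hy : ‖y‖ ≤ 1) (hy0 : y.coeff 0 = 0) {V : AbsSeries (AbsSeries (PeriodicFun o.T))}
    (hV : (V.coeff 0).coeff 0 = 0) {x : ℝ} (hx : |x| ≤ 1) (t : ℝ) :
    HasSum (fun k => ((substBranch c D y V).coeff (k + 1)).toFun t * x ^ (k + 1))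
      ((evalReal (c * x ^ D) (eval (ContrHom.id ℝ) x y) V).toFun t) := by
  rw [← eval_substBranch hc D hy hx]
  have hx1 : ‖algebraMap ℝ (PeriodicFun o.T) x‖ ≤ 1 := norm_algebraMap_le hx
  have h1 := (PeriodicFun.evalAt t).hasSum (hasSum_eval (ContrHom.id _) hx1 (substBranch c D y V))
  have h2 : HasSum (fun k => ((substBranch c D y V).coeff k).toFun t * x ^ k)
      ((eval (ContrHom.id _) (algebraMap ℝ (PeriodicFun o.T) x) (substBranch c D y V)).toFun t) := by
    convert! h1 using 1
  rw [← hasSum_nat_add_iff' 1] at h2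
  convert! h2 using 1
  rw [Finset.sum_range_one, substBranch_coeff_zero hc hD hy hy0, hV]
  have h3 : (0 : PeriodicFun o.T).toFun t = 0 := rfl
  rw [h3, zero_mul, sub_zero]

end Branch

/-- The parameter `σ (ρ x) ^ D` and the average angle `Y(x)` are substituted into the universal
solution as series in `x`; this yields coefficients that do not depend on `x`. Along the branch the
mean of `Γ` vanishes, and a translation of time by `t₀` returns to the original system. -/
theorem LocalBound.exists_branch {S : PerturbedSystem} {o : ResonantOrbit} {N : ℝ}
    (hb : LocalBound S o N) (hp : o.p ≠ 0) (hω : S.ω o.A₀ = (o.p : ℝ) / (o.q : ℝ)) {κ : ℕ}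
    (hκ : ∀ k < κ, ∀ t : ℝ, S.melnikov o k t = 0) {σ : ℝ} (hσ : |σ| = 1) {ρ : ℝ} (hρ : 0 < ρ)
    {D : ℕ} (hD : 0 < D) (hρD : 2 ^ 18 * N ^ 6 * ρ ^ D ≤ 1) {Y : AbsSeries ℝ}
    (hY0 : Y.coeff 0 = 0) (hYn : 16 * N * ‖Y‖ ≤ 1) (hY : ∀ x : ℝ, |x| ≤ 1 →
      SumsTo (S.bifurcationSeries o κ) (σ * (ρ * x) ^ D) (eval (ContrHom.id ℝ) x Y) 0) :
    ∃ b B : ℕ → ℝ → ℝ,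
      (∀ k, Continuous (b k) ∧ Function.Periodic (b k) o.T) ∧
      (∀ k, Continuous (B k) ∧ Function.Periodic (B k) o.T) ∧
      (∃ K : ℝ, ∀ (k : ℕ) (t : ℝ), |b k t| * ρ ^ (k + 1) ≤ K ∧ |B k t| * ρ ^ (k + 1) ≤ K) ∧
      ∀ x : ℝ, |x| ≤ 1 → ∃ α A : ℝ → ℝ,
        S.IsSubharmonicSolution o.p o.q (σ * (ρ * x) ^ D) α A ∧
        ∀ t : ℝ, HasSum (fun k : ℕ => b k t * (ρ * x) ^ (k + 1)) (α t - o.α₀ (t - o.t₀)) ∧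
          HasSum (fun k : ℕ => B k t * (ρ * x) ^ (k + 1)) (A t - o.A₀) := by
  have : Fact (0 < o.T) := ⟨hb.T_pos⟩
  obtain ⟨d, hd⟩ := hb.exists_represents
  obtain ⟨U, W, hU, hW, hs⟩ := exists_isUniversalSol hd
  obtain ⟨hU0, hW0⟩ := hs.coeff_zero hd hU hW
  have hε := hd.small.ε₀_pos
  have hr₀ := hd.small.r₀_pos
  have hr := hd.small.r_pos
  have hr' := hd.small.r'_pos
  have hN0 : 0 < N := by linarith [hb.one_le]
  set c : ℝ := σ * ρ ^ D / d.ε₀ with hc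
  set y : AbsSeries ℝ := d.r₀⁻¹ • Y with hy
  have hcn : |c| ≤ 1 := by
    rw [hc, abs_div, abs_mul, hσ, one_mul, abs_of_pos hε, abs_of_pos (pow_pos hρ D), div_le_one hε,
      hd.ε₀_eq, le_div_iff₀ (by positivity), mul_comm]
    exact hρD
  have hyn : ‖y‖ ≤ 1 := by
    rw [hy, norm_smul, norm_inv, Real.norm_of_nonneg hr₀.le, hd.r₀_eq, one_div, inv_inv]
    exact hYn
  have hy0 : y.coeff 0 = 0 := by rw [hy, coeff_smul, hY0, smul_zero]
  set u := substBranch (o := o) c D y U with hu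
  set w := substBranch (o := o) c D y W with hw
  have hun : ‖u‖ ≤ 1 := ((substBranch c D y).norm_le U).trans (by linarith)
  have hwn : ‖w‖ ≤ 1 := ((substBranch c D y).norm_le W).trans (by linarith)
  have hcont : ∀ (r : ℝ) (f : PeriodicFun o.T) (k : ℕ),
      Continuous (fun t => r * f.toFun (t - o.t₀) / ρ ^ k) ∧
        Function.Periodic (fun t => r * f.toFun (t - o.t₀) / ρ ^ k) o.T := by
    intro r f k
    refine ⟨((continuous_const.mul (f.continuous_toFun.comp
      (continuous_id.sub continuous_const))).div_const _), fun t => ?_⟩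
    simp only
    rw [show t + o.T - o.t₀ = t - o.t₀ + o.T by ring, f.periodic_toFun]
  have hbound : ∀ (r : ℝ) (v : AbsSeries (PeriodicFun o.T)), 0 < r → ‖v‖ ≤ 1 → ∀ (k : ℕ) (t : ℝ),
      |r * (v.coeff k).toFun t / ρ ^ k| * ρ ^ k ≤ r := by
    intro r v hr hv k t
    have hρk := pow_pos hρ k
    rw [abs_div, abs_of_pos hρk, div_mul_cancel₀ _ hρk.ne', abs_mul, abs_of_pos hr]
    exact mul_le_of_le_one_right hr.le
      ((PeriodicFun.abs_toFun_le _ t).trans ((norm_coeff_le v k).trans hv))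
  -- The constant coefficients vanish, hence the index `k + 1`. Division by `ρ ^ (k + 1)` converts
  -- powers of `x` into powers of `ρ x`, which is the root of `|ε|`.
  refine ⟨fun k t => d.r * (u.coeff (k + 1)).toFun (t - o.t₀) / ρ ^ (k + 1),
    fun k t => d.r' * (w.coeff (k + 1)).toFun (t - o.t₀) / ρ ^ (k + 1),
    fun k => hcont _ _ _, fun k => hcont _ _ _, ⟨d.r + d.r', fun k t => ⟨?_, ?_⟩⟩, fun x hx => ?_⟩
  · exact (hbound _ u hr hun _ _).trans (by linarith)
  · exact (hbound _ w hr' hwn _ _).trans (by linarith)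
  set e := c * x ^ D with he
  set b := eval (ContrHom.id ℝ) x y with hbx
  have hxD : |x ^ D| ≤ 1 := by rw [abs_pow]; exact pow_le_one₀ (abs_nonneg _) hx
  have hen : |e| ≤ 1 := by
    rw [he, abs_mul]
    exact mul_le_one₀ hcn (abs_nonneg _) hxD
  have hbn : |b| ≤ 1 := ((eval (ContrHom.id ℝ) x).norm_le y).trans hyn
  have hee : d.ε₀ * e = σ * (ρ * x) ^ D := by
    rw [he, hc, mul_pow]; field_simp
  have hbb : d.r₀ * b = eval (ContrHom.id ℝ) x Y := by
    rw [hbx, hy, map_smul, smul_eq_mul, mul_inv_cancel_left₀ hr₀.ne']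
  have h0 := hs.avg_gam_eq_zero hb hd hU hW hp hκ hen hbn (by rw [hee, hbb]; exact hY x hx)
  have hsol := hd.hasDerivAt (((evalReal e b).norm_le U).trans hU)
    (((evalReal e b).norm_le W).trans hW) (hs.evalReal hU hW hen hbn) h0
  set f := evalReal (o := o) e b U with hf
  set g := evalReal (o := o) e b W with hg
  rw [hee] at hsol
  have hq : (o.q : ℝ) ≠ 0 := by exact_mod_cast hb.q_pos.ne'
  have hT : 2 * Real.pi * o.q = o.T := rfl
  refine ⟨fun t => o.α₀ (t - o.t₀) + d.r * f.toFun (t - o.t₀),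
    fun t => o.A₀ + d.r' * g.toFun (t - o.t₀), ⟨fun t => (hsol _).1, fun t => ?_, fun t => ?_,
      fun t => ?_, fun t => ?_⟩, fun t => ⟨?_, ?_⟩⟩
  · have h1 : HasDerivAt (fun t => t - o.t₀) 1 t := (hasDerivAt_id t).sub_const _
    have h2 : HasDerivAt (fun t => o.α₀ (t - o.t₀)) ((o.p : ℝ) / o.q * 1) t :=
      h1.const_mul ((o.p : ℝ) / o.q)
    have h3 := h2.add ((hsol (t - o.t₀)).2.1.comp t h1)
    convert! h3 using 1
    rw [sub_add_cancel, hω]; ring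
  · have h1 : HasDerivAt (fun t => t - o.t₀) 1 t := (hasDerivAt_id t).sub_const _
    have h3 := ((hsol (t - o.t₀)).2.2.comp t h1).const_add o.A₀
    convert! h3 using 1
    rw [sub_add_cancel]; ring
  · beta_reduce
    rw [hT, show t + o.T - o.t₀ = t - o.t₀ + o.T by ring, f.periodic_toFun]
    have : o.α₀ (t - o.t₀ + o.T) = o.α₀ (t - o.t₀) + 2 * Real.pi * o.p := by
      rw [ResonantOrbit.α₀, ResonantOrbit.α₀, ← hT]; field_simp
    rw [this]; ring
  · beta_reduce
    rw [hT, show t + o.T - o.t₀ = t - o.t₀ + o.T by ring, g.periodic_toFun]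
  · have h1 := (hasSum_substBranch hcn hD hyn hy0 hU0 hx (t - o.t₀)).mul_left d.r
    rw [add_sub_cancel_left]
    convert! h1 using 1
    funext k
    rw [mul_pow, ← hu]
    have := pow_pos hρ (k + 1)
    field_simp
  · have h1 := (hasSum_substBranch hcn hD hyn hy0 hW0 hx (t - o.t₀)).mul_left d.r'
    rw [add_sub_cancel_left]
    convert! h1 using 1
    funext k
    rw [mul_pow, ← hw]
    have := pow_pos hρ (k + 1)
    field_simp

end

noncomputable section

open AbsSeries

/-! ### The computable threshold -/

/-- The bound on the coefficients after a step of the process, for natural numbers. -/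
def natNextBound (N R : ℕ) : ℕ := (4 * (N + 1) * R) ^ (N + 1)

/-- The inverse of the radius of convergence in the variable of the Puiseux series. -/
def inverseRadius (N : ℕ) : ℕ :=
  512 * N ^ 2 * ((natNextBound N)^[N + 1] ((2 ^ 18 * N ^ 6) ^ (N + 1))) ^ 5

/-- The inverse of the threshold. -/
def inverseThreshold (N : ℕ) : ℕ := inverseRadius N ^ N ^ N

theorem primrec_pow : Primrec₂ fun a b : ℕ => a ^ b :=
  (Primrec.nat_iterate (f := fun x : ℕ × ℕ => x.2) (g := fun _ => 1) (h := fun x y => x.1 * y)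
    Primrec.snd (Primrec.const 1)
    (Primrec.nat_mul.comp (Primrec.fst.comp Primrec.fst) Primrec.snd)).of_eq fun x => by
      rw [mul_left_iterate]; exact mul_one _

theorem primrec_natNextBound : Primrec₂ natNextBound := by
  have h1 : Primrec fun x : ℕ × ℕ => x.1 + 1 := Primrec.succ.comp Primrec.fst
  exact primrec_pow.comp (Primrec.nat_mul.comp (Primrec.nat_mul.comp (Primrec.const 4) h1)
    Primrec.snd) h1

theorem primrec_inverseRadius : Primrec inverseRadius := by
  have h1 : Primrec fun N : ℕ => N + 1 := Primrec.succ
  have h2 : Primrec fun N : ℕ => (2 ^ 18 * N ^ 6) ^ (N + 1) :=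
    primrec_pow.comp (Primrec.nat_mul.comp (Primrec.const _)
      (primrec_pow.comp Primrec.id (Primrec.const 6))) h1
  exact Primrec.nat_mul.comp (Primrec.nat_mul.comp (Primrec.const 512)
    (primrec_pow.comp Primrec.id (Primrec.const 2)))
    (primrec_pow.comp (Primrec.nat_iterate h1 h2 primrec_natNextBound) (Primrec.const 5))

theorem computable_inverseThreshold : Computable inverseThreshold :=
  (primrec_pow.comp primrec_inverseRadius (primrec_pow.comp Primrec.id Primrec.id)).to_comp

theorem cast_iterate_natNextBound (N R i : ℕ) :
    (((natNextBound N)^[i] R : ℕ) : ℝ) = (nextBound N)^[i] (R : ℝ) := by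
  induction i with
  | zero => rfl
  | succ i ih =>
    rw [Function.iterate_succ_apply', Function.iterate_succ_apply', ← ih, natNextBound, nextBound]
    push_cast; rfl

theorem cast_inverseRadius (N : ℕ) : (inverseRadius N : ℝ) =
    implicitConst N ((nextBound N)^[N + 1] ((2 ^ 18 * N ^ 6) ^ (N + 1))) := by
  rw [inverseRadius, implicitConst, Nat.cast_mul, Nat.cast_pow, cast_iterate_natNextBound]
  norm_num

theorem iterate_nextBound_mono (N : ℕ) {R : ℝ} (hR : 1 ≤ R) {i j : ℕ} (hij : i ≤ j) :
    (nextBound N)^[i] R ≤ (nextBound N)^[j] R := by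
  obtain ⟨l, rfl⟩ := Nat.exists_eq_add_of_le' hij
  rw [Function.iterate_add_apply]
  exact le_iterate_nextBound N (hR.trans (le_iterate_nextBound N hR i)) l

theorem implicitConst_mono (N : ℕ) {R R' : ℝ} (hR : 0 ≤ R) (h : R ≤ R') :
    implicitConst N R ≤ implicitConst N R' := by
  rw [implicitConst, implicitConst]
  gcongr

namespace DataBound

variable {S : PerturbedSystem} {o : ResonantOrbit} {κ n : ℕ} {σ : ℝ} {s : ℕ → PuiseuxStep}
  {i₀ N : ℕ}

theorem localBound (h : DataBound S o κ n σ s i₀ N) (hq : 0 < o.q) : LocalBound S o N :=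
  ⟨hq, by exact_mod_cast h.q_le, h.ball_subset, h.ω_le, h.F_le, h.G_le, h.twist_le⟩

theorem geomBound (h : DataBound S o κ n σ s i₀ N) (hq : 0 < o.q) :
    GeomBound (S.bifurcationSeries o κ) ((2 ^ 18 * N ^ 6) ^ (N + 1)) := by
  have hb := h.localBound hq
  have : Fact (0 < o.T) := ⟨hb.T_pos⟩
  obtain ⟨d, hd⟩ := hb.exists_represents
  obtain ⟨U, W, hU, hW, hs⟩ := exists_isUniversalSol hd
  intro k j
  refine (hs.abs_bifurcationSeries_le hd hU hW hb.one_le κ k j).trans ?_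
  rw [← pow_mul]
  refine pow_le_pow_right₀ ?_ ?_
  · have : (1 : ℝ) ≤ N ^ 6 := one_le_pow₀ hb.one_le
    linarith
  -- The `κ + 1` extra powers caused by dividing out `ε ^ (κ + 1)` are absorbed in the exponent `N +
  -- 1`.
  · have h1 := h.κ_le
    have : (N + 1) * (k + j + 1) = N + k + 1 + j + (N * k + N * j) := by ring
    omega

theorem hasOrder (h : DataBound S o κ n σ s i₀ N) (hq : 0 < o.q) (hp : o.p ≠ 0)
    (h0 : ∀ j < n, iteratedDeriv j (S.melnikov o κ) o.t₀ = 0)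
    (hn : iteratedDeriv n (S.melnikov o κ) o.t₀ ≠ 0) :
    HasOrder (S.bifurcationSeries o κ) n := by
  have hq' : (o.q : ℝ) ≠ 0 := by exact_mod_cast hq.ne'
  have hp' : (o.p : ℝ) ≠ 0 := by exact_mod_cast hp
  constructor
  · intro j hj
    rw [(h.localBound hq).bifurcationSeries_zero hp, h0 j hj, mul_zero, zero_div]
  · rw [(h.localBound hq).bifurcationSeries_zero hp]
    exact div_ne_zero (mul_ne_zero (pow_ne_zero _ (neg_ne_zero.2 (div_ne_zero hq' hp'))) hn)
      (by positivity)

/-- The branch of subharmonic solutions, in a rescaled root of the perturbation parameter. -/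
theorem exists_branch (h : DataBound S o κ n σ s i₀ N) (hq : 0 < o.q) (hp : o.p ≠ 0)
    (hω : S.ω o.A₀ = (o.p : ℝ) / (o.q : ℝ)) (hκ : ∀ k < κ, ∀ t : ℝ, S.melnikov o k t = 0)
    (h0 : ∀ j < n, iteratedDeriv j (S.melnikov o κ) o.t₀ = 0)
    (hn : iteratedDeriv n (S.melnikov o κ) o.t₀ ≠ 0) (hσ : |σ| = 1)
    (hs : ReachesSimpleRoot σ (S.bifurcationSeries o κ) s i₀) {ρ : ℝ}
    (hρ : ρ = 1 / inverseRadius N) :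
    1 ≤ (inverseRadius N : ℝ) ∧ ∃ b B : ℕ → ℝ → ℝ,
      (∀ k, Continuous (b k) ∧ Function.Periodic (b k) o.T) ∧
      (∀ k, Continuous (B k) ∧ Function.Periodic (B k) o.T) ∧
      (∃ K : ℝ, ∀ (k : ℕ) (t : ℝ), |b k t| * ρ ^ (k + 1) ≤ K ∧ |B k t| * ρ ^ (k + 1) ≤ K) ∧
      ∀ x : ℝ, |x| ≤ 1 → ∃ α A : ℝ → ℝ,
        S.IsSubharmonicSolution o.p o.q (σ * (ρ * x) ^ n.factorial) α A ∧
        ∀ t : ℝ, HasSum (fun k : ℕ => b k t * (ρ * x) ^ (k + 1)) (α t - o.α₀ (t - o.t₀)) ∧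
          HasSum (fun k : ℕ => B k t * (ρ * x) ^ (k + 1)) (A t - o.A₀) := by
  have hb := h.localBound hq
  have hN1 : (1 : ℝ) ≤ N := hb.one_le
  have hN : 1 ≤ N := by exact_mod_cast hN1
  have hN6 : (N : ℝ) ≤ N ^ 6 := le_self_pow₀ hN1 (by norm_num)
  have hQ : 1 ≤ 2 ^ 18 * (N : ℝ) ^ 6 := by linarith
  have hR : 1 ≤ (2 ^ 18 * (N : ℝ) ^ 6) ^ (N + 1) := one_le_pow₀ hQ
  have hQR : 2 ^ 18 * (N : ℝ) ^ 6 ≤ (2 ^ 18 * (N : ℝ) ^ 6) ^ (N + 1) :=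
    le_self_pow₀ hQ (Nat.succ_ne_zero N)
  have hK : 2 * (2 ^ 18 * (N : ℝ) ^ 6) ^ (N + 1) * (N + 1) ≤ inverseRadius N := by
    rw [cast_inverseRadius]
    exact two_mul_le_implicitConst hN hR (le_iterate_nextBound N hR _)
  have hK1 : 2 ^ 18 * (N : ℝ) ^ 6 * (N + 1) ≤ inverseRadius N := by
    exact le_trans (mul_le_mul_of_nonneg_right (by linarith) (by positivity)) hK
  have hKQ : 2 ^ 18 * (N : ℝ) ^ 6 ≤ inverseRadius N := by
    refine le_trans ?_ hK1
    exact le_mul_of_one_le_right (by positivity) (by linarith)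
  have hK0 : 1 ≤ (inverseRadius N : ℝ) := hQ.trans hKQ
  have hKpos : 0 < (inverseRadius N : ℝ) := by linarith
  have hρ0 : 0 < ρ := by rw [hρ]; positivity
  have hKρ : inverseRadius N * ρ = 1 := by rw [hρ, mul_one_div_cancel hKpos.ne']
  have hρ1 : ρ ≤ 1 := by nlinarith
  refine ⟨hK0, ?_⟩
  -- The radius must not depend on `i₀`; since the bounds grow with each step, `N + 1` iterations
  -- dominate `i₀ + 1`.
  have hi : implicitConst N ((nextBound N)^[i₀ + 1] ((2 ^ 18 * N ^ 6) ^ (N + 1))) * ρ ≤ 1 := by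
    rw [← hKρ, cast_inverseRadius]
    refine mul_le_mul_of_nonneg_right (implicitConst_mono N ?_
      (iterate_nextBound_mono N hR (Nat.succ_le_succ h.i₀_le))) hρ0.le
    exact (zero_le_one.trans hR).trans (le_iterate_nextBound N hR _)
  obtain ⟨Y, hY0, hYn, hY⟩ := exists_puiseux_series hN i₀ (S.bifurcationSeries o κ) σ s n
    ((2 ^ 18 * N ^ 6) ^ (N + 1)) n.factorial ρ hσ hR (h.geomBound hq) (h.hasOrder hq hp h0 hn) hs
    (fun i hi => ⟨(h.step_le i hi).2.2.1, (h.step_le i hi).2.2.2⟩) h.root_le n.factorial_pos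
    dvd_rfl hρ0.le hi
  refine hb.exists_branch hp hω hκ hσ hρ0 n.factorial_pos ?_ hY0 ?_ hY
  · have h1 : ρ ^ n.factorial ≤ ρ := pow_le_of_le_one hρ0.le hρ1 n.factorial_pos.ne'
    rw [← hKρ]
    gcongr
  · rw [← hKρ]
    calc 16 * N * ‖Y‖ ≤ 16 * N * (ρ * (N + 1)) := by gcongr
      _ = 16 * N * (N + 1) * ρ := by ring
      _ ≤ 2 ^ 18 * (N : ℝ) ^ 6 * (N + 1) * ρ := by gcongr; linarith
      _ ≤ _ := by gcongr

/-- The branch of subharmonic solutions, in the perturbation parameter. -/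
theorem exists_subharmonic (h : DataBound S o κ n σ s i₀ N) (hq : 0 < o.q) (hp : o.p ≠ 0)
    (hω : S.ω o.A₀ = (o.p : ℝ) / (o.q : ℝ)) (hκ : ∀ k < κ, ∀ t : ℝ, S.melnikov o k t = 0)
    (h0 : ∀ j < n, iteratedDeriv j (S.melnikov o κ) o.t₀ = 0)
    (hn : iteratedDeriv n (S.melnikov o κ) o.t₀ ≠ 0) (hσ : σ = 1 ∨ σ = -1)
    (hs : ReachesSimpleRoot σ (S.bifurcationSeries o κ) s i₀) :
    ∃ b B : ℕ → ℝ → ℝ,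
      (∀ k, Continuous (b k) ∧ Function.Periodic (b k) (2 * Real.pi * o.q)) ∧
      (∀ k, Continuous (B k) ∧ Function.Periodic (B k) (2 * Real.pi * o.q)) ∧
      (∃ K : ℝ, ∀ (k : ℕ) (t : ℝ),
        |b k t| * ((1 / ((inverseThreshold N : ℝ) + 1)) ^ (1 / (n.factorial : ℝ))) ^ (k + 1) ≤ K ∧
        |B k t| * ((1 / ((inverseThreshold N : ℝ) + 1)) ^ (1 / (n.factorial : ℝ))) ^ (k + 1) ≤ K) ∧
      ∀ ε : ℝ, |ε| < 1 / ((inverseThreshold N : ℝ) + 1) → 0 ≤ σ * ε →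
        ∃ α A : ℝ → ℝ, S.IsSubharmonicSolution o.p o.q ε α A ∧
          ∀ t : ℝ,
            HasSum (fun k : ℕ => b k t * (|ε| ^ (1 / (n.factorial : ℝ))) ^ (k + 1))
              (α t - o.α₀ (t - o.t₀)) ∧
            HasSum (fun k : ℕ => B k t * (|ε| ^ (1 / (n.factorial : ℝ))) ^ (k + 1))
              (A t - o.A₀) := by
  have hσ1 : |σ| = 1 := by rcases hσ with rfl | rfl <;> simp
  have hσσ : σ * σ = 1 := by rcases hσ with rfl | rfl <;> norm_num
  obtain ⟨hK, b, B, hbc, hBc, ⟨C, hC⟩, hsol⟩ := h.exists_branch hq hp hω hκ h0 hn hσ1 hs rfl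
  set ρ : ℝ := 1 / inverseRadius N with hρ
  have hKpos : 0 < (inverseRadius N : ℝ) := by linarith
  have hρ0 : 0 < ρ := by positivity
  have hn0 : n.factorial ≠ 0 := n.factorial_pos.ne'
  have hle : (1 / ((inverseThreshold N : ℝ) + 1)) ≤ ρ ^ n.factorial := by
    rw [hρ, one_div_pow]
    refine one_div_le_one_div_of_le (by positivity) ?_
    -- The radius in `|ε|` is the radius of the root to the power `n!`; the bound `n! ≤ N ^ N` makes
    -- the threshold depend on `N` alone.
    have h1 : n.factorial ≤ N ^ N :=
      (Nat.factorial_le h.n_le).trans (Nat.factorial_le_pow N)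
    have h2 := pow_le_pow_right₀ hK h1
    rw [inverseThreshold]
    push_cast
    linarith
  have hroot : ∀ x : ℝ, 0 ≤ x → x ≤ 1 / ((inverseThreshold N : ℝ) + 1) →
      x ^ (1 / (n.factorial : ℝ)) ≤ ρ := by
    intro x hx0 hx
    calc _ ≤ (ρ ^ n.factorial) ^ (1 / (n.factorial : ℝ)) :=
          Real.rpow_le_rpow hx0 (hx.trans hle) (by positivity)
      _ = ρ := by rw [one_div]; exact Real.pow_rpow_inv_natCast hρ0.le hn0
  refine ⟨b, B, hbc, hBc, ⟨C, fun k t => ?_⟩, fun ε hε hσε => ?_⟩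
  · have h1 := hroot _ (by positivity : 0 ≤ 1 / ((inverseThreshold N : ℝ) + 1)) le_rfl
    obtain ⟨h2, h3⟩ := hC k t
    exact ⟨le_trans (by gcongr) h2, le_trans (by gcongr) h3⟩
  · set τ := |ε| ^ (1 / (n.factorial : ℝ)) with hτ
    have hτ0 : 0 ≤ τ := by positivity
    have hτρ : τ ≤ ρ := hroot _ (abs_nonneg ε) hε.le
    have hx : |τ / ρ| ≤ 1 := by
      rw [abs_of_nonneg (by positivity), div_le_one hρ0]; exact hτρ
    -- The condition `σ ε ≥ 0` means `|ε| = σ ε`, so the branch parameter reproduces `ε` itself.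
    have hε' : σ * τ ^ n.factorial = ε := by
      have h1 : τ ^ n.factorial = |ε| := by
        rw [hτ, one_div]; exact Real.rpow_inv_natCast_pow (abs_nonneg ε) hn0
      have h2 : |ε| = σ * ε := by
        rw [← abs_of_nonneg hσε, abs_mul, hσ1, one_mul]
      rw [h1, h2, ← mul_assoc, hσσ, one_mul]
    have h1 := hsol (τ / ρ) hx
    rw [mul_div_cancel₀ _ hρ0.ne', hε'] at h1
    exact h1

end DataBound

end

noncomputable section

open scoped NNReal ENNReal Topology

/-! ### Existence of a bound on the data -/

section Cauchy

variable {E : Type*} [NormedAddCommGroup E] [NormedSpace ℝ E]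

theorem NNReal.tsum_sigma_mk_le {ι : Type*} {β : ι → Type*} {f : (Σ i, β i) → ℝ≥0}
    (hf : Summable f) (i : ι) : ∑' b : β i, f ⟨i, b⟩ ≤ ∑' s, f s :=
  NNReal.tsum_comp_le_tsum_of_inj hf sigma_mk_injective

/-- Re-expanding at nearby centres is dominated by one convergent triple sum, independent of the
centre and of the order. This supplies the uniformity in the Cauchy estimates. -/
theorem nnnorm_changeOrigin_mul_pow_le (p : FormalMultilinearSeries ℝ E ℝ) {r : ℝ≥0}
    (hr : ((r : ℝ≥0∞) + r) < p.radius) {x : E} (hx : ‖x‖₊ ≤ r) (k : ℕ) :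
    ‖p.changeOrigin x k‖₊ * r ^ k ≤
      ∑' s : Σ k l : ℕ, { s : Finset (Fin (k + l)) // s.card = l },
        ‖p (s.1 + s.2.1)‖₊ * r ^ s.2.1 * r ^ s.1 := by
  have hs := p.changeOriginSeries_summable_aux₁ hr
  have hrr : (r : ℝ≥0∞) < p.radius := lt_of_le_of_lt le_self_add hr
  have hxr : (‖x‖₊ : ℝ≥0∞) < p.radius := lt_of_le_of_lt (by exact_mod_cast hx) hrr
  have h1 := p.nnnorm_changeOrigin_le k hxr
  have h2 := p.changeOriginSeries_summable_aux₂ hrr k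
  calc _ ≤ (∑' s : Σ l : ℕ, { s : Finset (Fin (k + l)) // s.card = l },
        ‖p (k + s.1)‖₊ * r ^ s.1) * r ^ k := by
        gcongr
        refine h1.trans (Summable.tsum_le_tsum (fun s => by gcongr)
          (p.changeOriginSeries_summable_aux₂ hxr k) h2)
    _ = ∑' s : Σ l : ℕ, { s : Finset (Fin (k + l)) // s.card = l },
        ‖p (k + s.1)‖₊ * r ^ s.1 * r ^ k := (NNReal.tsum_mul_right _ _).symm
    _ ≤ _ := NNReal.tsum_sigma_mk_le hs k

/-- The derivative is the coefficient symmetrized over the `m!` permutations of its arguments, and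
each permuted term obeys the same norm bound. -/
theorem HasFPowerSeriesOnBall.norm_iteratedFDeriv_le_factorial {f : E → ℝ}
    {p : FormalMultilinearSeries ℝ E ℝ} {x : E} {r : ℝ≥0∞} (h : HasFPowerSeriesOnBall f p x r)
    (m : ℕ) : ‖iteratedFDeriv ℝ m f x‖ ≤ m.factorial * ‖p m‖ := by
  refine ContinuousMultilinearMap.opNorm_le_bound (by positivity) fun v => ?_
  rw [h.iteratedFDeriv_eq_sum_of_completeSpace]
  refine (norm_sum_le_of_le _ (f := fun σ : Equiv.Perm (Fin m) => p m fun i => v (σ i))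
    (n := fun _ => ‖p m‖ * ∏ i, ‖v i‖) fun σ _ => ?_).trans ?_
  · refine ((p m).le_opNorm _).trans (le_of_eq ?_)
    rw [Equiv.prod_comp σ fun i => ‖v i‖]
  · rw [Finset.sum_const, nsmul_eq_mul, Finset.card_univ, Fintype.card_perm, Fintype.card_fin]
    exact (mul_assoc _ _ _).symm.le

/-- Cauchy estimates, uniformly near a point. -/
theorem AnalyticAt.eventually_norm_iteratedFDeriv_le {f : E → ℝ} {x : E} (h : AnalyticAt ℝ f x) :
    ∃ C : ℝ, 0 ≤ C ∧ ∀ᶠ y in 𝓝 x, ∀ m : ℕ,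
      ‖iteratedFDeriv ℝ m f y‖ ≤ C ^ (m + 1) * m.factorial := by
  obtain ⟨p, r, hp⟩ := h
  obtain ⟨ρ, hρ0, hρr⟩ : ∃ ρ : ℝ≥0, 0 < ρ ∧ ((ρ : ℝ≥0∞) + ρ) < r := by
    obtain ⟨δ, hδ0, hδ⟩ := ENNReal.lt_iff_exists_nnreal_btwn.1 hp.r_pos
    refine ⟨δ / 2, by positivity [ENNReal.coe_pos.1 hδ0], ?_⟩
    rw [← ENNReal.coe_add, add_halves]; exact hδ
  set M := ∑' s : Σ k l : ℕ, { s : Finset (Fin (k + l)) // s.card = l },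
        ‖p (s.1 + s.2.1)‖₊ * ρ ^ s.2.1 * ρ ^ s.1 with hM
  -- One constant serves both as a bound for the triple sum and as the inverse radius.
  set C : ℝ≥0 := max M ρ⁻¹ with hC
  refine ⟨C, C.2, ?_⟩
  filter_upwards [Metric.ball_mem_nhds x (NNReal.coe_pos.2 hρ0)] with y hy m
  have hy' : ‖y - x‖₊ ≤ ρ := by
    rw [Metric.mem_ball, dist_eq_norm] at hy
    exact_mod_cast hy.le
  have h1 := hp.changeOrigin (y := y - x) (lt_of_le_of_lt (by exact_mod_cast hy')
    (lt_of_le_of_lt le_self_add hρr))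
  rw [add_sub_cancel] at h1
  have h2 := nnnorm_changeOrigin_mul_pow_le p (hρr.trans_le hp.r_le) hy' m
  have h3 : ‖p.changeOrigin (y - x) m‖₊ ≤ C ^ (m + 1) := by
    calc _ = ‖p.changeOrigin (y - x) m‖₊ * ρ ^ m * ρ⁻¹ ^ m := by
          rw [mul_assoc, ← mul_pow, mul_inv_cancel₀ hρ0.ne', one_pow, mul_one]
      _ ≤ M * ρ⁻¹ ^ m := by gcongr
      _ ≤ C * C ^ m := by
          gcongr
          · exact le_max_left _ _
          · exact le_max_right _ _
      _ = _ := by rw [pow_succ, mul_comm]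
  refine (h1.norm_iteratedFDeriv_le_factorial m).trans ?_
  rw [mul_comm]
  gcongr
  exact_mod_cast h3

theorem IsCompact.exists_norm_iteratedFDeriv_le {f : E → ℝ} {K : Set E} (hK : IsCompact K)
    (h : ∀ x ∈ K, AnalyticAt ℝ f x) : ∃ C : ℝ, 0 ≤ C ∧ ∀ y ∈ K, ∀ m : ℕ,
      ‖iteratedFDeriv ℝ m f y‖ ≤ C ^ (m + 1) * m.factorial := by
  refine hK.induction_on (p := fun s => ∃ C : ℝ, 0 ≤ C ∧ ∀ y ∈ s, ∀ m : ℕ,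
      ‖iteratedFDeriv ℝ m f y‖ ≤ C ^ (m + 1) * m.factorial)
    ⟨0, le_rfl, fun y hy => absurd hy (Set.notMem_empty y)⟩ ?_ ?_ ?_
  · rintro s t hst ⟨C, hC0, hC⟩
    exact ⟨C, hC0, fun y hy => hC y (hst hy)⟩
  · rintro s t ⟨C, hC0, hC⟩ ⟨C', hC0', hC'⟩
    refine ⟨max C C', hC0.trans (le_max_left _ _), ?_⟩
    rintro y (hy | hy) m
    · exact (hC y hy m).trans (by gcongr; exact le_max_left _ _)
    · exact (hC' y hy m).trans (by gcongr; exact le_max_right _ _)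
  · intro x hx
    obtain ⟨C, hC0, hC⟩ := (h x hx).eventually_norm_iteratedFDeriv_le
    exact ⟨_, mem_nhdsWithin_of_mem_nhds hC, C, hC0, fun y hy => hy⟩

end Cauchy

/-- Periodicity moves every point of the torus `A = A₀` into a compact fundamental domain, where the
local estimates have a common constant. -/
theorem exists_torus_bound {W : Set ℝ} (hW : IsOpen W) {H : ℝ × ℝ × ℝ → ℝ}
    (hH : AnalyticOnNhd ℝ H {x | x.2.1 ∈ W}) (hper : ∀ α t : ℝ, ∀ A ∈ W,
      H (α + 2 * Real.pi, A, t) = H (α, A, t) ∧ H (α, A, t + 2 * Real.pi) = H (α, A, t))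
    {A₀ : ℝ} (hA : A₀ ∈ W) : ∃ C : ℝ, 0 ≤ C ∧ ∀ (m : ℕ) (α t : ℝ),
      ‖iteratedFDeriv ℝ m H (α, A₀, t)‖ ≤ C ^ (m + 1) * m.factorial := by
  have hK : IsCompact ((Set.Icc 0 (0 + 2 * Real.pi)) ×ˢ ({A₀} : Set ℝ) ×ˢ
      (Set.Icc 0 (0 + 2 * Real.pi))) := isCompact_Icc.prod (isCompact_singleton.prod isCompact_Icc)
  obtain ⟨C, hC0, hC⟩ := hK.exists_norm_iteratedFDeriv_le (f := H) (fun x hx => hH x (by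
    have : x.2.1 = A₀ := hx.2.1
    change x.2.1 ∈ W
    rw [this]; exact hA))
  refine ⟨C, hC0, fun m α t => ?_⟩
  have hpi : 0 < 2 * Real.pi := by positivity
  obtain ⟨k, hk, -⟩ := existsUnique_add_zsmul_mem_Ico hpi α 0
  obtain ⟨l, hl, -⟩ := existsUnique_add_zsmul_mem_Ico hpi t 0
  rw [← iteratedFDeriv_add_period hW hper k l m (x := (α, A₀, t)) hA]
  refine hC _ ⟨?_, ?_, ?_⟩ m
  · simpa using Set.Ico_subset_Icc_self hk
  · exact add_zero A₀
  · simpa using Set.Ico_subset_Icc_self hl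

open Filter in
-- Each single requirement holds for all sufficiently large `N`, so finitely many eventual
-- conditions, the Cauchy estimates counting as one each, hold together.
theorem exists_dataBound (S : PerturbedSystem) (o : ResonantOrbit) (hA : o.A₀ ∈ S.W)
    (hω : deriv S.ω o.A₀ ≠ 0) (κ n : ℕ) (σ : ℝ) (s : ℕ → PuiseuxStep) (i₀ : ℕ)
    (hs : ReachesSimpleRoot σ (S.bifurcationSeries o κ) s i₀) :
    ∃ N : ℕ, DataBound S o κ n σ s i₀ N := by
  obtain ⟨C₁, hC₁, hF⟩ := exists_torus_bound S.isOpen_W S.analytic_F S.periodic_F hA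
  obtain ⟨C₂, hC₂, hG⟩ := exists_torus_bound S.isOpen_W S.analytic_G S.periodic_G hA
  obtain ⟨C₃, hC₃, hO⟩ := (S.analytic_ω o.A₀ hA).eventually_norm_iteratedFDeriv_le
  have hO' := hO.self_of_nhds
  obtain ⟨δ, hδ, hball⟩ := Metric.isOpen_iff.1 S.isOpen_W o.A₀ hA
  set P := puiseuxPolynomial σ (S.bifurcationSeries o κ) s i₀ with hP
  have hroot : P.derivative.eval (s i₀).c ≠ 0 := by
    intro h0
    have hP0 : P ≠ 0 := by
      intro h
      have := hs.2
      rw [← hP, h, Polynomial.rootMultiplicity_zero] at this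
      exact zero_ne_one this
    have := (Polynomial.one_lt_rootMultiplicity_iff_isRoot hP0).2 ⟨(hs.1 i₀ le_rfl).2, h0⟩
    rw [hs.2] at this
    exact lt_irrefl _ this
  have hcast (C : ℝ) : ∀ᶠ N : ℕ in atTop, C ≤ N := tendsto_natCast_atTop_atTop.eventually_ge_atTop C
  have hinv {x : ℝ} (hx : x ≠ 0) : ∀ᶠ N : ℕ in atTop, 1 ≤ (N : ℝ) * |x| := by
    filter_upwards [hcast |x|⁻¹] with N hN
    rwa [← inv_le_iff_one_le_mul₀ (abs_pos.2 hx)]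
  have hstep : ∀ᶠ N : ℕ in atTop, ∀ i ∈ Set.Iic i₀,
      (s i).𝔭 ≤ N ∧ (s i).𝔥 ≤ N ∧ (s i).𝔰 ≤ N ∧ |(s i).c| ≤ (N : ℝ) :=
    (eventually_all_finite (Set.finite_Iic i₀)).2 fun i _ => (eventually_ge_atTop _).and
      ((eventually_ge_atTop _).and ((eventually_ge_atTop _).and (hcast _)))
  have hδ' : ∀ᶠ N : ℕ in atTop, 1 / (N : ℝ) < δ :=
    tendsto_one_div_atTop_nhds_zero_nat.eventually (gt_mem_nhds hδ)
  have : ∀ᶠ N : ℕ in atTop, DataBound S o κ n σ s i₀ N := by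
    filter_upwards [eventually_ge_atTop o.q, eventually_ge_atTop o.p.natAbs, eventually_ge_atTop κ,
      eventually_ge_atTop n, eventually_ge_atTop i₀, hδ', hcast C₁, hcast C₂, hcast C₃, hinv hω,
      hstep, hinv hroot] with N h1 h2 h3 h4 h5 h6 h7 h8 h9 h10 h11 h12
    refine ⟨h1, h2, h3, h4, h5, (Metric.ball_subset_ball h6.le).trans hball, fun m => ?_,
      fun m α t => (hF m α t).trans (by gcongr), fun m α t => (hG m α t).trans (by gcongr), h10,
      h11, h12⟩
    have := hO' m
    rw [norm_iteratedFDeriv_eq_norm_iteratedDeriv] at this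
    exact this.trans (by gcongr)
  exact this.exists

end

/-! ### The theorem on subharmonic solutions -/

theorem theorem3 :
    -- `N ↦ 1 / (e N + 1)` computes the threshold from an integer bound `N` on the data
    ∃ e : ℕ → ℕ, Computable e ∧
      ∀ (S : PerturbedSystem) (o : ResonantOrbit),
        o.A₀ ∈ S.W → o.p ≠ 0 → 0 < o.q → IsCoprime o.p (o.q : ℤ) →
        S.ω o.A₀ = (o.p : ℝ) / (o.q : ℝ) → deriv S.ω o.A₀ ≠ 0 →
      ∀ κ n : ℕ, 0 < n →
        (∀ k < κ, ∀ t : ℝ, S.melnikov o k t = 0) →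
        o.t₀ ∈ Set.Ico 0 (2 * Real.pi) →
        (∀ j < n, iteratedDeriv j (S.melnikov o κ) o.t₀ = 0) →
        iteratedDeriv n (S.melnikov o κ) o.t₀ ≠ 0 →
      ∀ (σ : ℝ), (σ = 1 ∨ σ = -1) →
      ∀ (s : ℕ → PuiseuxStep) (i₀ : ℕ), ReachesSimpleRoot σ (S.bifurcationSeries o κ) s i₀ →
        (∃ N : ℕ, DataBound S o κ n σ s i₀ N) ∧
        ∀ N : ℕ, DataBound S o κ n σ s i₀ N →
          -- coefficients of the expansion in powers of `|ε| ^ (1 / n!)`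
          ∃ b B : ℕ → ℝ → ℝ,
            (∀ k, Continuous (b k) ∧ Function.Periodic (b k) (2 * Real.pi * o.q)) ∧
            (∀ k, Continuous (B k) ∧ Function.Periodic (B k) (2 * Real.pi * o.q)) ∧
            (∃ K : ℝ, ∀ (k : ℕ) (t : ℝ),
              |b k t| * ((1 / ((e N : ℝ) + 1)) ^ (1 / (n.factorial : ℝ))) ^ (k + 1) ≤ K ∧
              |B k t| * ((1 / ((e N : ℝ) + 1)) ^ (1 / (n.factorial : ℝ))) ^ (k + 1) ≤ K) ∧
            ∀ ε : ℝ, |ε| < 1 / ((e N : ℝ) + 1) → 0 ≤ σ * ε →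
              ∃ α A : ℝ → ℝ, S.IsSubharmonicSolution o.p o.q ε α A ∧
                ∀ t : ℝ,
                  HasSum (fun k : ℕ => b k t * (|ε| ^ (1 / (n.factorial : ℝ))) ^ (k + 1))
                    (α t - o.α₀ (t - o.t₀)) ∧
                  HasSum (fun k : ℕ => B k t * (|ε| ^ (1 / (n.factorial : ℝ))) ^ (k + 1))
                    (A t - o.A₀) := by
  refine ⟨inverseThreshold, computable_inverseThreshold, ?_⟩
  intro S o hA hp hq _ hω hω' κ n _ hκ _ h0 hn σ hσ s i₀ hs
  exact ⟨exists_dataBound S o hA hω' κ n σ s i₀ hs,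
    fun N h => h.exists_subharmonic hq hp hω hκ h0 hn hσ hs⟩
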